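/- Let $U\subseteq\{(u^1,u^2)\in\mathbb R^2: u^1\neq 0\}$ be non-empty and open, and let $$R_3^{(3)}=\partial_x\begin{pmatrix}\partial_x & \partial_x\frac{u^2}{u^1}\\ \frac{u^2}{u^1}\partial_x & \frac{(u^2)^2+1}{2(u^1)^2}\partial_x+\partial_x\frac{(u^2)^2+1}{2(u^1)^2}\end{pmatrix}\partial_x .$$ A first-order operator $P_1=g^{ij}\partial_x+\Gamma^{ij}_ku^k_x$ with smooth coefficients on $U$ and $g^{ij}$ symmetric is called compatible with $R_3^{(3)}$ if the Schouten bracket $[P_1,R_3^{(3)}]$ vanishes. For constants $c=(c_1,\dots,c_6)$ let $g_c$ be the contravariant tensor $$g^{11}=c_1u^1+c_2u^2+c_3,\quad g^{12}=g^{21}=c_4u^1-\frac{c_2}{2u^1}+\frac{c_3u^2}{u^1}+\frac{c_2(u^2)^2}{2u^1},\quad g^{22}=2c_4u^2+\frac{c_1}{u^1}+\frac{c_5u^2}{u^1}-\frac{c_1(u^2)^2}{u^1}+c_6 .$$ **(a)** If $U$ is connected and $P_1$ is compatible with $R_3^{(3)}$, then $g=g_c$ on $U$ for a unique $c$. If $P_1$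 is compatible with $R_3^{(3)}$ and $g=g_c$ on $U$, then the Levi-Civita conditions $g^{is}\Gamma^{jk}_s=g^{js}\Gamma^{ik}_s$, $\Gamma^{ij}_k+\Gamma^{ji}_k=\partial_kg^{ij}$ hold on $U$ if and only if $$c_2c_5+2c_1c_3=0,\qquad c_2c_6-2c_3c_4=0,\qquad c_1c_6+c_4c_5=0.\qquad(*)$$ **(b)** The conditions $(*)$ imply that $g_c$ is flat wherever it is non-degenerate. **(c)** The solutions of $(*)$ are exactly the $c$ in one of the following cases: 1. $c_2\ne0$, $c_5=-\frac{2c_1c_3}{c_2}$, $c_6=\frac{2c_3c_4}{c_2}$; 2. $c_2=0$, $c_3\ne0$, $c_1=c_4=0$; 3. $c_2=c_3=0$, $c_6\neq0$, $c_1=-\frac{c_4c_5}{c_6}$; 4. $c_2=c_3=c_6=0$, $c_5\ne0$, $c_4=0$; 5. $c_2=c_3=c_5=c_6=0$. **(d)** Let $c$ be in case $k$ and $d$ in case $l$, with $g=g_c$ and $h=g_d$ non-degenerate on $U$, and write $g_{\lambda,kl}=g_c-\lambda g_d$. This is called a flat pencil if, for every $\lambda$, wherever $g_{\lambda,kl}$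 is non-degenerate, it is flat and its contravariant Christoffel symbols are $\Gamma^{ij}_k(g)-\lambda\Gamma^{ij}_k(h)$. Then: - $g_{\lambda,11}$ is a flat pencil iff $d_3=\frac{d_2c_3}{c_2}$, or $d_1=\frac{d_2c_1}{c_2}$ and $d_4=\frac{d_2c_4}{c_2}$; - $g_{\lambda,12}$ iff $d_5=-\frac{2d_3c_1}{c_2}$ and $d_6=\frac{2d_3c_4}{c_2}$; - $g_{\lambda,13}$ iff $d_6=\frac{2d_4c_3}{c_2}$, with $d_4\ne0$, $c_3\neq0$; - $g_{\lambda,14}$ iff $d_5=-\frac{2d_1c_3}{c_2}$, with $d_1\neq0$, $c_3\ne0$; - $g_{\lambda,15}$ iff $c_3=0$; - $g_{\lambda,22}$, $g_{\lambda,44}$ and $g_{\lambda,55}$ always are flat pencils; - $g_{\lambda,33}$ iff $d_5=d_6=0$ (which does not occur in case 3), or $d_5=\frac{d_6c_5}{c_6}$, or $d_4=\frac{d_6c_4}{c_6}$; - $g_{\lambda,34}$ iff $d_1=-\frac{d_5c_4}{c_6}$; - $g_{\lambda,35}$ iff $d_1=-\frac{d_4c_5}{c_6}$; - $g_{\lambda,45}$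 iff $d_4=0$; - $g_{\lambda,23}$, $g_{\lambda,24}$ and $g_{\lambda,25}$ never are flat pencils. -/

import Mathlib

namespace Trios

noncomputable section

/-- Points of the two-dimensional target space; `u 0`, `u 1` are the coordinates `u¹`, `u²`. -/
abbrev Pt := Fin 2 → ℝ

/-- A contravariant 2-tensor field `g^{ij}`. -/
abbrev Contra := Pt → Matrix (Fin 2) (Fin 2) ℝ

/-- Coefficients `Γ^{ij}_k`, written `Γ u i j k`. -/
abbrev Conn := Pt → Fin 2 → Fin 2 → Fin 2 → ℝ

/-- A matrix differential operator depending on the field: `A u ψ` is the value of the operator,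
taken at the field `u = u(x)`, on the covector-valued function `ψ = ψ(x)`. -/
abbrev FieldOp := (ℝ → Pt) → (ℝ → Pt) → (ℝ → Pt)

/-- The homogeneous first-order operator `P = g^{ij} ∂ₓ + Γ^{ij}_k u^k_x`. -/
def firstOrderOp (g : Contra) (Γ : Conn) : FieldOp := fun u ψ x i =>
  ∑ j, (g (u x) i j * deriv (fun y => ψ y j) x
    + (∑ k, Γ (u x) i j k * deriv (fun y => u y k) x) * ψ x j)

/-- The third-order operator
`R₃⁽³⁾ = ∂ₓ [[∂ₓ, ∂ₓ ∘ a], [a ∂ₓ, b ∂ₓ + ∂ₓ ∘ b]] ∂ₓ`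
with `a = u² / u¹` and `b = ((u²)² + 1) / (2 (u¹)²)`. -/
def R33 : FieldOp := fun u ψ x =>
  let a : ℝ → ℝ := fun y => u y 1 / u y 0
  let b : ℝ → ℝ := fun y => ((u y 1) ^ 2 + 1) / (2 * (u y 0) ^ 2)
  let p : ℝ → ℝ := deriv (fun y => ψ y 0)
  let q : ℝ → ℝ := deriv (fun y => ψ y 1)
  ![deriv (fun y => deriv p y + deriv (fun z => a z * q z) y) x,
    deriv (fun y => a y * deriv p y + (b y * deriv q y + deriv (fun z => b z * q z) y)) x]

/-- The derivative of the operator `A` (acting on a fixed `ψ`) with respect to the field `u`, in the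
direction `v`. -/
def opDeriv (A : FieldOp) (u v ψ : ℝ → Pt) (x : ℝ) (i : Fin 2) : ℝ :=
  deriv (fun ε : ℝ => A (fun y => u y + ε • v y) ψ x i) 0

/-- The density `φ · (A'[B χ] ψ)`. -/
def bracketTerm (A B : FieldOp) (u φ ψ χ : ℝ → Pt) (x : ℝ) : ℝ :=
  ∑ i, φ x i * opDeriv A u (B u χ) ψ x i

/-- The Schouten bracket `[A, B]` at the field `u`, evaluated on three covectors:
`∑_cyc ∫ φ · (A'[B χ] ψ + B'[A χ] ψ) dx`. -/
def schouten (A B : FieldOp) (u φ ψ χ : ℝ → Pt) : ℝ :=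
  ∫ x, (bracketTerm A B u φ ψ χ x + bracketTerm A B u ψ χ φ x + bracketTerm A B u χ φ ψ x
    + (bracketTerm B A u φ ψ χ x + bracketTerm B A u ψ χ φ x + bracketTerm B A u χ φ ψ x))

/-- A test covector: smooth with compact support. -/
def IsTest (ψ : ℝ → Pt) : Prop := ContDiff ℝ (⊤ : ℕ∞) ψ ∧ HasCompactSupport ψ

/-- `[A, B] = 0` for fields with values in `U`. -/
def SchoutenZero (U : Set Pt) (A B : FieldOp) : Prop :=
  ∀ u : ℝ → Pt, ContDiff ℝ (⊤ : ℕ∞) u → (∀ x, u x ∈ U) →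
    ∀ φ ψ χ : ℝ → Pt, IsTest φ → IsTest ψ → IsTest χ → schouten A B u φ ψ χ = 0

/-- `P₁ = g^{ij} ∂ₓ + Γ^{ij}_k u^k_x` has smooth coefficients on `U`, with `g` symmetric, and is
compatible with `R₃⁽³⁾`, that is `[P₁, R₃⁽³⁾] = 0`. -/
structure CompatibleR33 (U : Set Pt) (g : Contra) (Γ : Conn) : Prop where
  smooth_g : ∀ i j, ContDiffOn ℝ (⊤ : ℕ∞) (fun u => g u i j) U
  smooth_Γ : ∀ i j k, ContDiffOn ℝ (⊤ : ℕ∞) (fun u => Γ u i j k) U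
  symm : ∀ u ∈ U, (g u).IsSymm
  bracket : SchoutenZero U (firstOrderOp g Γ) R33

/-- The partial derivative `∂f/∂u^k`. -/
def pd (k : Fin 2) (f : Pt → ℝ) (u : Pt) : ℝ := lineDeriv ℝ f u (Pi.single k 1)

/-- The Levi-Civita conditions `g^{is} Γ^{jk}_s = g^{js} Γ^{ik}_s` and
`Γ^{ij}_k + Γ^{ji}_k = ∂_k g^{ij}` on `U`. -/
def LeviCivita (U : Set Pt) (g : Contra) (Γ : Conn) : Prop :=
  ∀ u ∈ U, (∀ i j k, ∑ s, g u i s * Γ u j k s = ∑ s, g u j s * Γ u i k s) ∧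
    (∀ i j k, Γ u i j k + Γ u j i k = pd k (fun v => g v i j) u)

/-- Christoffel symbols `Γ^k_{ij}` of the covariant metric `(g_{ij}) = (g^{ij})⁻¹`. -/
def christoffel (g : Contra) (u : Pt) (k i j : Fin 2) : ℝ :=
  (1 / 2) * ∑ l, g u k l * (pd i (fun v => (g v)⁻¹ l j) u + pd j (fun v => (g v)⁻¹ l i) u
    - pd l (fun v => (g v)⁻¹ i j) u)

/-- Contravariant Christoffel symbols `Γ^{ij}_k = - g^{il} Γ^j_{lk}`. -/
def contraChristoffel (g : Contra) (u : Pt) (i j k : Fin 2) : ℝ :=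
  - ∑ l, g u i l * christoffel g u j l k

/-- The Riemann curvature tensor `R^l_{kij}` of the covariant metric `(g^{ij})⁻¹`. -/
def riemann (g : Contra) (u : Pt) (l k i j : Fin 2) : ℝ :=
  pd i (fun v => christoffel g v l j k) u - pd j (fun v => christoffel g v l i k) u
    + ∑ m, (christoffel g u l i m * christoffel g u m j k
      - christoffel g u l j m * christoffel g u m i k)

/-- The contravariant tensor `g` is non-degenerate at every point of `U`. -/
def Nondegenerate (U : Set Pt) (g : Contra) : Prop := ∀ u ∈ U, (g u).det ≠ 0

/-- The (pseudo-)metric defined by `g` is flat at every point of `U` where it is non-degenerate. -/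
def Flat (U : Set Pt) (g : Contra) : Prop :=
  ∀ u ∈ U, (g u).det ≠ 0 → ∀ l k i j, riemann g u l k i j = 0

/-- The pencil of contravariant tensors `g_λ = g - λ h`. -/
def pencil (g h : Contra) (lam : ℝ) : Contra := fun u => g u - lam • h u

/-- `g_λ = g - λ h` is a flat pencil on `U` (for `g`, `h` non-degenerate on `U`): for every `λ`
the metric `g_λ` is flat and its contravariant Christoffel symbols are
`Γ^{ij}_k(g) - λ Γ^{ij}_k(h)`; both conditions are imposed where `g_λ` is non-degenerate. -/
def IsFlatPencil (U : Set Pt) (g h : Contra) : Prop :=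
  ∀ lam : ℝ, Flat U (pencil g h lam) ∧
    ∀ u ∈ U, (pencil g h lam u).det ≠ 0 → ∀ i j k,
      contraChristoffel (pencil g h lam) u i j k
        = contraChristoffel g u i j k - lam * contraChristoffel h u i j k

/-- The six constants `c₁, …, c₆`. -/
structure Param where
  c1 : ℝ
  c2 : ℝ
  c3 : ℝ
  c4 : ℝ
  c5 : ℝ
  c6 : ℝ

namespace Param

/-- The contravariant tensor `g^{ij}` with parameters `c₁, …, c₆`. -/
def metric (c : Param) : Contra := fun u =>
  let g12 : ℝ := c.c4 * u 0 - c.c2 / (2 * u 0) + c.c3 * u 1 / u 0 + c.c2 * (u 1) ^ 2 / (2 * u 0)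
  !![c.c1 * u 0 + c.c2 * u 1 + c.c3, g12;
     g12, 2 * c.c4 * u 1 + c.c1 / u 0 + c.c5 * u 1 / u 0 - c.c1 * (u 1) ^ 2 / u 0 + c.c6]

/-- The quadratic conditions on the parameters. -/
def Quadrics (c : Param) : Prop :=
  c.c2 * c.c5 + 2 * c.c1 * c.c3 = 0 ∧ c.c2 * c.c6 - 2 * c.c3 * c.c4 = 0 ∧
    c.c1 * c.c6 + c.c4 * c.c5 = 0

def Case1 (c : Param) : Prop :=
  c.c2 ≠ 0 ∧ c.c5 = -(2 * c.c1 * c.c3 / c.c2) ∧ c.c6 = 2 * c.c3 * c.c4 / c.c2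

def Case2 (c : Param) : Prop := c.c2 = 0 ∧ c.c3 ≠ 0 ∧ c.c1 = 0 ∧ c.c4 = 0

def Case3 (c : Param) : Prop :=
  c.c2 = 0 ∧ c.c3 = 0 ∧ c.c6 ≠ 0 ∧ c.c1 = -(c.c4 * c.c5 / c.c6)

def Case4 (c : Param) : Prop :=
  c.c2 = 0 ∧ c.c3 = 0 ∧ c.c6 = 0 ∧ c.c5 ≠ 0 ∧ c.c4 = 0

def Case5 (c : Param) : Prop := c.c2 = 0 ∧ c.c3 = 0 ∧ c.c5 = 0 ∧ c.c6 = 0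

end Param

end

end Trios

/-!
The bracket of `P = g ∂ₓ + Γ uₓ` with `R₃⁽³⁾` is an integral which is linear in the last covector
`χ`. Integrating by parts until `χ` is undifferentiated and applying the fundamental lemma of the
calculus of variations turns `[P, R₃⁽³⁾] = 0` into the pointwise vanishing of a differential
expression in the field and the two other covectors (`eulerLagrange_eq_zero`). The jets of the field
and of the covectors at a point can be prescribed freely, so each coefficient of this expression
vanishes (`jet_identity`). For the integration by parts it is convenient to write
`R₃⁽³⁾ = ∂ (E ∂ + Sᵀ ∂ + ∂ S) ∂` with `E = diag(1, 0)`; the leading coefficient is the invertible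
matrix `E + S + Sᵀ`.

The coefficients of order zero in `uₓ` determine `Γ` by `g` and give two first-order equations for
`g` (`Gamma_of_compatible`). The coefficients linear in `uₓ`, together with the derivatives of the
previous equations, give a closed system (`pde_of_compatible`): `g¹¹` is affine, and all the
remaining derivatives are expressed by lower ones. It has six first integrals, which are the
constants `c₁, …, c₆`, and on a connected set they determine `g`
(`existsUnique_param_of_compatible`).

For the metric `g_c` the coefficients `Γ` are an explicit connection `Param.conn`, linear in `c`,
with `Γ^{ij}_k + Γ^{ji}_k = ∂_k g^{ij}`, and its torsion is a combination of the three quadratic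
expressions in `c`, with functions of the point as coefficients which are independent enough to
separate them (`torsion_conn`, `quadrics_of_torsionFree`). Moreover each form `Γ^{ij}_k du^k` is
closed, so that when the torsion vanishes the curvature is an expression quadratic in `Γ`
(`riemann_of_leviCivita`). In dimension two it has one component, and this lies in the ideal
generated by the same quadratic expressions: `g_c` is flat (`flat_metric`).

Since `g_c` and its connection are linear in `c`, the pencil `g_c - λ g_d` is the metric with
parameters `c - λ d`, and its candidate Christoffel symbols are `Param.conn` at `c - λ d`. It is a
flat pencil if and only if `c - λ d` satisfies the quadratic conditions for all `λ`, that is, if the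
polarization of the conditions vanishes on `(c, d)` (`isFlatPencil_iff_polar`). A single small
non-zero `λ`, for which the pencil is still non-degenerate near some point, suffices for one of the
implications. What remains is elementary algebra in each pair of cases.
-/

namespace Trios

open MeasureTheory

/-! ### Calculus of smooth functions on the line -/

@[fun_prop]
theorem contDiff_top_deriv {f : ℝ → ℝ} (hf : ContDiff ℝ (⊤ : ℕ∞) f) :
    ContDiff ℝ (⊤ : ℕ∞) (deriv f) :=
  (contDiff_infty_iff_deriv.mp hf).2

theorem deriv_mul_of_smooth {f g : ℝ → ℝ} (hf : ContDiff ℝ (⊤ : ℕ∞) f)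
    (hg : ContDiff ℝ (⊤ : ℕ∞) g) :
    deriv (fun x => f x * g x) = fun x => deriv f x * g x + f x * deriv g x := by
  funext x
  exact deriv_fun_mul (hf.differentiable (by simp) x) (hg.differentiable (by simp) x)

theorem deriv_add_of_smooth {f g : ℝ → ℝ} (hf : ContDiff ℝ (⊤ : ℕ∞) f)
    (hg : ContDiff ℝ (⊤ : ℕ∞) g) :
    deriv (fun x => f x + g x) = fun x => deriv f x + deriv g x := by
  funext x
  exact deriv_fun_add (hf.differentiable (by simp) x) (hg.differentiable (by simp) x)

theorem deriv_sub_of_smooth {f g : ℝ → ℝ} (hf : ContDiff ℝ (⊤ : ℕ∞) f)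
    (hg : ContDiff ℝ (⊤ : ℕ∞) g) :
    deriv (fun x => f x - g x) = fun x => deriv f x - deriv g x := by
  funext x
  exact deriv_fun_sub (hf.differentiable (by simp) x) (hg.differentiable (by simp) x)

theorem integral_mul_deriv_of_smooth {f g : ℝ → ℝ} (hf : ContDiff ℝ (⊤ : ℕ∞) f)
    (hg : ContDiff ℝ (⊤ : ℕ∞) g) (hc : HasCompactSupport g) :
    ∫ x, f x * deriv g x = -∫ x, deriv f x * g x := by
  have hf' := contDiff_top_deriv hf
  have hg' := contDiff_top_deriv hg
  refine integral_mul_deriv_eq_deriv_mul_of_integrable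
    (fun x _ => (hf.differentiable (by simp) x).hasDerivAt)
    (fun x _ => (hg.differentiable (by simp) x).hasDerivAt) ?_ ?_ ?_
  · exact (hf.continuous.mul hg'.continuous).integrable_of_hasCompactSupport hc.deriv.mul_left
  · exact (hf'.continuous.mul hg.continuous).integrable_of_hasCompactSupport hc.mul_left
  · exact (hf.continuous.mul hg.continuous).integrable_of_hasCompactSupport hc.mul_left

/-- The scalar third-order operator `∂ K ∂² + ∂² L ∂`. -/
noncomputable def opB (K L f : ℝ → ℝ) : ℝ → ℝ :=
  deriv (fun y => K y * deriv (deriv f) y + deriv (fun z => L z * deriv f z) y)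

@[fun_prop]
theorem contDiff_opB {K L f : ℝ → ℝ} (hK : ContDiff ℝ (⊤ : ℕ∞) K) (hL : ContDiff ℝ (⊤ : ℕ∞) L)
    (hf : ContDiff ℝ (⊤ : ℕ∞) f) : ContDiff ℝ (⊤ : ℕ∞) (opB K L f) := by
  unfold opB; fun_prop

theorem opB_apply {K L f : ℝ → ℝ} (hK : ContDiff ℝ (⊤ : ℕ∞) K) (hL : ContDiff ℝ (⊤ : ℕ∞) L)
    (hf : ContDiff ℝ (⊤ : ℕ∞) f) : opB K L f = fun x =>
      (K x + L x) * deriv (deriv (deriv f)) x + (deriv K x + 2 * deriv L x) * deriv (deriv f) x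
        + deriv (deriv L) x * deriv f x := by
  unfold opB
  rw [deriv_mul_of_smooth (by fun_prop) (by fun_prop),
    deriv_add_of_smooth (by fun_prop) (by fun_prop),
    deriv_mul_of_smooth (by fun_prop) (by fun_prop),
    deriv_add_of_smooth (by fun_prop) (by fun_prop),
    deriv_mul_of_smooth (by fun_prop) (by fun_prop),
    deriv_mul_of_smooth (by fun_prop) (by fun_prop)]
  funext x; ring

/-- The formal adjoint of `∂ K ∂² + ∂² L ∂` is `-(∂ L ∂² + ∂² K ∂)`. -/
theorem integral_mul_opB {K L f g : ℝ → ℝ} (hK : ContDiff ℝ (⊤ : ℕ∞) K)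
    (hL : ContDiff ℝ (⊤ : ℕ∞) L) (hf : ContDiff ℝ (⊤ : ℕ∞) f) (hg : ContDiff ℝ (⊤ : ℕ∞) g)
    (hc : HasCompactSupport g) :
    ∫ x, f x * opB K L g x = -∫ x, opB L K f x * g x := by
  have i1 : ∀ s : ℝ → ℝ, ContDiff ℝ (⊤ : ℕ∞) s → Integrable (fun x => s x * g x) :=
    fun s hs => (hs.continuous.mul hg.continuous).integrable_of_hasCompactSupport hc.mul_left
  have c1 : HasCompactSupport (fun x => L x * deriv g x) := hc.deriv.mul_left
  have c2 : HasCompactSupport (fun x => K x * deriv (deriv g) x) := hc.deriv.deriv.mul_left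
  unfold opB
  rw [integral_mul_deriv_of_smooth
    (g := fun y => K y * deriv (deriv g) y + deriv (fun z => L z * deriv g z) y)
    hf (by fun_prop) (c2.add c1.deriv)]
  have e1 : ∫ x, deriv f x * (K x * deriv (deriv g) x)
      = ∫ x, deriv (deriv (fun y => K y * deriv f y)) x * g x := by
    have : ∀ x, deriv f x * (K x * deriv (deriv g) x)
      = (fun y => K y * deriv f y) x * deriv (deriv g) x := fun x => by ring
    simp_rw [this]
    rw [integral_mul_deriv_of_smooth (by fun_prop) (by fun_prop) hc.deriv,
      integral_mul_deriv_of_smooth (by fun_prop) (by fun_prop) hc, neg_neg]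
  have e2 : ∫ x, deriv f x * deriv (fun z => L z * deriv g z) x
      = ∫ x, deriv (fun y => L y * deriv (deriv f) y) x * g x := by
    rw [integral_mul_deriv_of_smooth (by fun_prop) (by fun_prop) c1]
    have : ∀ x, deriv (deriv f) x * (L x * deriv g x)
      = (fun y => L y * deriv (deriv f) y) x * deriv g x := fun x => by ring
    simp_rw [this]
    rw [integral_mul_deriv_of_smooth (by fun_prop) (by fun_prop) hc, neg_neg]
  have i2 : Integrable (fun x => deriv f x * (K x * deriv (deriv g) x)) := by
    refine Continuous.integrable_of_hasCompactSupport ?_ c2.mul_left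
    exact ((show ContDiff ℝ (⊤ : ℕ∞) (fun x => deriv f x * (K x * deriv (deriv g) x)) by
      fun_prop)).continuous
  have i3 : Integrable (fun x => deriv f x * deriv (fun z => L z * deriv g z) x) := by
    refine Continuous.integrable_of_hasCompactSupport ?_ c1.deriv.mul_left
    exact ((show ContDiff ℝ (⊤ : ℕ∞) (fun x => deriv f x * deriv (fun z => L z * deriv g z) x) by
      fun_prop)).continuous
  congr 1
  simp_rw [mul_add]
  rw [integral_add i2 i3, e1, e2, ← integral_add (i1 _ (by fun_prop)) (i1 _ (by fun_prop))]
  congr 1; funext x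
  rw [deriv_add_of_smooth (by fun_prop) (by fun_prop)]
  ring

/-- The bilinear pairing of `∂ K ∂² + ∂² L ∂`, with all derivatives moved off the coefficients. -/
theorem integral_mul_opB_eq_coeff {K L f g : ℝ → ℝ} (hK : ContDiff ℝ (⊤ : ℕ∞) K)
    (hL : ContDiff ℝ (⊤ : ℕ∞) L) (hf : ContDiff ℝ (⊤ : ℕ∞) f) (hg : ContDiff ℝ (⊤ : ℕ∞) g)
    (hc : HasCompactSupport g) :
    ∫ x, f x * opB K L g x
      = ∫ x, (L x * (deriv (deriv f) x * deriv g x) - K x * (deriv f x * deriv (deriv g) x)) := by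
  have c1 : HasCompactSupport (fun x => L x * deriv g x) := hc.deriv.mul_left
  have c2 : HasCompactSupport (fun x => K x * deriv (deriv g) x) := hc.deriv.deriv.mul_left
  have i2 : Integrable (fun x => deriv f x * (K x * deriv (deriv g) x)) := by
    refine Continuous.integrable_of_hasCompactSupport ?_ c2.mul_left
    exact ((show ContDiff ℝ (⊤ : ℕ∞) (fun x => deriv f x * (K x * deriv (deriv g) x)) by
      fun_prop)).continuous
  have i3 : Integrable (fun x => deriv f x * deriv (fun z => L z * deriv g z) x) := by
    refine Continuous.integrable_of_hasCompactSupport ?_ c1.deriv.mul_left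
    exact ((show ContDiff ℝ (⊤ : ℕ∞) (fun x => deriv f x * deriv (fun z => L z * deriv g z) x) by
      fun_prop)).continuous
  have i4 : Integrable (fun x => deriv (deriv f) x * (L x * deriv g x)) := by
    refine Continuous.integrable_of_hasCompactSupport ?_ c1.mul_left
    exact ((show ContDiff ℝ (⊤ : ℕ∞) (fun x => deriv (deriv f) x * (L x * deriv g x)) by
      fun_prop)).continuous
  unfold opB
  rw [integral_mul_deriv_of_smooth
    (g := fun y => K y * deriv (deriv g) y + deriv (fun z => L z * deriv g z) y)
    hf (by fun_prop) (c2.add c1.deriv)]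
  simp_rw [mul_add]
  rw [integral_add i2 i3, integral_mul_deriv_of_smooth (by fun_prop) (by fun_prop) c1,
    neg_add, neg_neg, add_comm, ← sub_eq_add_neg, ← integral_sub i4 i2]
  congr 1; funext x; ring

/-- The fundamental lemma of the calculus of variations for continuous functions. -/
theorem eq_zero_of_integral_test {f : ℝ → ℝ} (hf : Continuous f)
    (h : ∀ θ : ℝ → ℝ, ContDiff ℝ (⊤ : ℕ∞) θ → HasCompactSupport θ → ∫ x, f x * θ x = 0) (x : ℝ) :
    f x = 0 := by
  have := ae_eq_zero_of_integral_contDiff_smul_eq_zero (μ := volume) hf.locallyIntegrable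
    (fun g hg hc => by simpa [mul_comm] using h g hg hc)
  have := (Continuous.ae_eq_iff_eq volume hf continuous_const).1
    (show f =ᵐ[volume] (fun _ => (0:ℝ)) from this)
  exact congrFun this x

/-- Symmetry of mixed partial derivatives, with the partial derivatives taken as iterated
one-variable derivatives. -/
theorem deriv_deriv_comm_of_contDiffOn {O : Set (ℝ × ℝ)} (hO : IsOpen O) {H : ℝ → ℝ → ℝ}
    (hH : ContDiffOn ℝ (⊤ : ℕ∞) (fun q : ℝ × ℝ => H q.1 q.2) O) {t x : ℝ} (hx : (t, x) ∈ O) :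
    ContDiffOn ℝ (⊤ : ℕ∞) (fun q : ℝ × ℝ => deriv (H q.1) q.2) O ∧
    HasDerivAt (fun y => H t y) (deriv (H t) x) x ∧
    HasDerivAt (fun s => deriv (H s) x) (deriv (fun y => deriv (fun s => H s y) t) x) t ∧
    DifferentiableAt ℝ (fun s => H s x) t := by
  set F : ℝ × ℝ → ℝ := fun q => H q.1 q.2 with hF
  have hd : ∀ q ∈ O, HasFDerivAt F (fderiv ℝ F q) q := fun q hq =>
    ((hH.contDiffAt (hO.mem_nhds hq)).differentiableAt (by simp)).hasFDerivAt
  have hy : ∀ q ∈ O, HasDerivAt (H q.1) (fderiv ℝ F q (0, 1)) q.2 := fun q hq =>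
    HasFDerivAt.comp_hasDerivAt q.2 (f := fun y : ℝ => (q.1, y)) (hd q hq)
      ((hasDerivAt_const _ _).prodMk (hasDerivAt_id _))
  have hs : ∀ q ∈ O, HasDerivAt (fun s => H s q.2) (fderiv ℝ F q (1, 0)) q.1 := fun q hq =>
    HasFDerivAt.comp_hasDerivAt q.1 (f := fun y : ℝ => (y, q.2)) (hd q hq)
      ((hasDerivAt_id _).prodMk (hasDerivAt_const _ _))
  have hF' : ContDiffOn ℝ (⊤ : ℕ∞) (fderiv ℝ F) O := hH.fderiv_of_isOpen hO (by simp)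
  have hF'd : HasFDerivAt (fderiv ℝ F) (fderiv ℝ (fderiv ℝ F) (t, x)) (t, x) :=
    ((hF'.contDiffAt (hO.mem_nhds hx)).differentiableAt (by simp)).hasFDerivAt
  have hsymm : IsSymmSndFDerivAt ℝ F (t, x) :=
    (hH.contDiffAt (hO.mem_nhds hx)).isSymmSndFDerivAt
      (by simp only [minSmoothness_of_isRCLikeNormedField]
          exact WithTop.coe_le_coe.2 (le_top (a := (2 : ℕ∞))))
  refine ⟨?_, ?_, ?_, ?_⟩
  · refine (hF'.clm_apply (contDiffOn_const (c := ((0, 1) : ℝ × ℝ)))).congr ?_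
    intro q hq; exact (hy q hq).deriv
  · have := hy _ hx; rwa [← this.deriv] at this
  · have e1 : (fun s => deriv (H s) x) =ᶠ[nhds t] fun s => fderiv ℝ F (s, x) (0, 1) := by
      have : ∀ᶠ s in nhds t, (s, x) ∈ O :=
        (Continuous.prodMk continuous_id continuous_const).continuousAt.eventually
          (hO.mem_nhds hx)
      filter_upwards [this] with s hs' using (hy _ hs').deriv
    have e2 : (fun y => deriv (fun s => H s y) t) =ᶠ[nhds x] fun y => fderiv ℝ F (t, y) (1, 0) := by
      have : ∀ᶠ y in nhds x, (t, y) ∈ O :=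
        (Continuous.prodMk continuous_const continuous_id).continuousAt.eventually
          (hO.mem_nhds hx)
      filter_upwards [this] with y hy' using (hs _ hy').deriv
    have d2 : HasDerivAt (fun y => fderiv ℝ F (t, y) (1, 0))
        (fderiv ℝ (fderiv ℝ F) (t, x) (0, 1) (1, 0)) x := by
      have := HasFDerivAt.comp_hasDerivAt x (f := fun y : ℝ => (t, y)) hF'd
        ((hasDerivAt_const _ _).prodMk (hasDerivAt_id _))
      exact this.clm_apply (hasDerivAt_const _ _) |>.congr_deriv (by simp)
    have d1 : HasDerivAt (fun s => fderiv ℝ F (s, x) (0, 1))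
        (fderiv ℝ (fderiv ℝ F) (t, x) (1, 0) (0, 1)) t := by
      have := HasFDerivAt.comp_hasDerivAt t (f := fun y : ℝ => (y, x)) hF'd
        ((hasDerivAt_id _).prodMk (hasDerivAt_const _ _))
      exact this.clm_apply (hasDerivAt_const _ _) |>.congr_deriv (by simp)
    rw [e2.deriv_eq, d2.deriv, hsymm.eq (0, 1) (1, 0)]
    exact d1.congr_of_eventuallyEq e1
  · exact (hs _ hx).differentiableAt

/-! ### Partial derivatives along curves -/

theorem pd_eq_fderiv {s : Pt → ℝ} {p : Pt} (hs : DifferentiableAt ℝ s p) (k : Fin 2) :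
    pd k s p = fderiv ℝ s p (Pi.single k 1) := hs.lineDeriv_eq_fderiv

theorem hasDerivAt_comp_curve {s : Pt → ℝ} {c : ℝ → Pt} {c' : Pt} {t : ℝ}
    (hs : DifferentiableAt ℝ s (c t)) (hc : HasDerivAt c c' t) :
    HasDerivAt (fun x => s (c x)) (∑ k, pd k s (c t) * c' k) t := by
  have h := hs.hasFDerivAt.comp_hasDerivAt t hc
  refine h.congr_deriv ?_
  have : c' = ∑ k, c' k • (Pi.single k 1 : Pt) := by
    ext i; simp [Finset.sum_apply, Pi.single_apply]
  conv_lhs => rw [this]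
  simp [pd_eq_fderiv hs, mul_comm]

theorem contDiffOn_pd {U : Set Pt} (hU : IsOpen U) {s : Pt → ℝ}
    (hs : ContDiffOn ℝ (⊤ : ℕ∞) s U) (k : Fin 2) : ContDiffOn ℝ (⊤ : ℕ∞) (pd k s) U := by
  have h : ContDiffOn ℝ (⊤ : ℕ∞) (fderiv ℝ s) U := hs.fderiv_of_isOpen hU (by simp)
  refine (h.clm_apply (contDiffOn_const (c := (Pi.single k 1 : Pt)))).congr ?_
  intro p hp
  exact pd_eq_fderiv ((hs.contDiffAt (hU.mem_nhds hp)).differentiableAt (by simp)) k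

theorem contDiff_comp_curve {U : Set Pt} {s : Pt → ℝ} (hs : ContDiffOn ℝ (⊤ : ℕ∞) s U)
    {u : ℝ → Pt} (hu : ContDiff ℝ (⊤ : ℕ∞) u) (hm : ∀ x, u x ∈ U) :
    ContDiff ℝ (⊤ : ℕ∞) (fun x => s (u x)) := by
  rw [← contDiffOn_univ] at hu ⊢
  exact hs.comp hu fun x _ => hm x

theorem contDiff_coord {u : ℝ → Pt} (hu : ContDiff ℝ (⊤ : ℕ∞) u) (k : Fin 2) :
    ContDiff ℝ (⊤ : ℕ∞) (fun x => u x k) := contDiff_pi.1 hu k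

theorem deriv_comp_curve {U : Set Pt} (hU : IsOpen U) {s : Pt → ℝ}
    (hs : ContDiffOn ℝ (⊤ : ℕ∞) s U) {u : ℝ → Pt} (hu : ContDiff ℝ (⊤ : ℕ∞) u)
    (hm : ∀ x, u x ∈ U) :
    deriv (fun x => s (u x)) = fun x => ∑ k, pd k s (u x) * deriv (fun y => u y k) x := by
  funext x
  have h1 : HasDerivAt u (fun k => deriv (fun y => u y k) x) x := by
    rw [hasDerivAt_pi]; intro k
    exact ((contDiff_coord hu k).differentiable (by simp) x).hasDerivAt
  exact (hasDerivAt_comp_curve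
    ((hs.contDiffAt (hU.mem_nhds (hm x))).differentiableAt (by simp)) h1).deriv

/-! ### Variations of the two operators with respect to the field -/

theorem opDeriv_firstOrderOp {U : Set Pt} (hU : IsOpen U) {g : Contra} {Γ : Conn}
    (hg : ∀ i j, ContDiffOn ℝ (⊤ : ℕ∞) (fun u => g u i j) U)
    (hΓ : ∀ i j k, ContDiffOn ℝ (⊤ : ℕ∞) (fun u => Γ u i j k) U)
    {u w : ℝ → Pt} (hu : ContDiff ℝ (⊤ : ℕ∞) u) (hm : ∀ x, u x ∈ U)
    (hw : ContDiff ℝ (⊤ : ℕ∞) w) (ψ : ℝ → Pt) (x : ℝ) (i : Fin 2) :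
    opDeriv (firstOrderOp g Γ) u w ψ x i =
      ∑ j, ((∑ l, pd l (fun v => g v i j) (u x) * w x l) * deriv (fun y => ψ y j) x
        + (∑ k, ((∑ l, pd l (fun v => Γ v i j k) (u x) * w x l) * deriv (fun y => u y k) x
          + Γ (u x) i j k * deriv (fun y => w y k) x)) * ψ x j) := by
  have hline : HasDerivAt (fun ε : ℝ => u x + ε • w x) (w x) 0 := by
    simpa using ((hasDerivAt_id (0 : ℝ)).smul_const (w x)).const_add (u x)
  have hcomp : ∀ s : Pt → ℝ, ContDiffOn ℝ (⊤ : ℕ∞) s U →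
      HasDerivAt (fun ε : ℝ => s (u x + ε • w x)) (∑ l, pd l s (u x) * w x l) 0 := by
    intro s hs
    have := hasDerivAt_comp_curve (s := s) (c := fun ε : ℝ => u x + ε • w x) (c' := w x) (t := 0)
      (by simpa using (hs.contDiffAt (hU.mem_nhds (hm x))).differentiableAt (by simp)) hline
    simpa using this
  have hd : ∀ (k : Fin 2) (ε : ℝ), deriv (fun y => (u y + ε • w y) k) x
      = deriv (fun y => u y k) x + ε * deriv (fun y => w y k) x := by
    intro k ε
    have h1 := ((contDiff_coord hu k).differentiable (by simp) x).hasDerivAt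
    have h2 := ((contDiff_coord hw k).differentiable (by simp) x).hasDerivAt
    exact (h1.add (h2.const_mul ε)).deriv
  have hd' : ∀ k : Fin 2, HasDerivAt (fun ε : ℝ => deriv (fun y => (u y + ε • w y) k) x)
      (deriv (fun y => w y k) x) 0 := by
    intro k
    simp_rw [hd]
    simpa using ((hasDerivAt_id (0 : ℝ)).mul_const (deriv (fun y => w y k) x)).const_add
      (deriv (fun y => u y k) x)
  unfold opDeriv firstOrderOp
  refine HasDerivAt.deriv ?_
  refine HasDerivAt.fun_sum fun j _ => ?_
  refine ((hcomp _ (hg i j)).mul_const _).add ?_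
  refine HasDerivAt.mul_const ?_ _
  refine HasDerivAt.fun_sum fun k _ => ?_
  have := (hcomp _ (hΓ i j k)).fun_mul (hd' k)
  simpa using this

/-- The coefficient matrix `S` in `R₃⁽³⁾ = ∂ (E ∂ + Sᵀ ∂ + ∂ S) ∂`, `E = diag(1, 0)`. -/
noncomputable def coeffS (l i : Fin 2) : Pt → ℝ := fun u =>
  if i = 0 then 0 else if l = 0 then u 1 / u 0 else ((u 1) ^ 2 + 1) / (2 * (u 0) ^ 2)

/-- The matrix `E = diag(1, 0)` in `R₃⁽³⁾ = ∂ (E ∂ + Sᵀ ∂ + ∂ S) ∂`. -/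
def coeffE (l i : Fin 2) : ℝ := if l = 0 ∧ i = 0 then 1 else 0

theorem contDiffOn_coeffS (l i : Fin 2) :
    ContDiffOn ℝ (⊤ : ℕ∞) (coeffS l i) {u : Pt | u 0 ≠ 0} := by
  unfold coeffS
  split_ifs
  · exact contDiffOn_const
  · exact ContDiffOn.div (by fun_prop) (by fun_prop) fun u hu => hu
  · exact ContDiffOn.div (by fun_prop) (by fun_prop) fun u hu =>
      mul_ne_zero two_ne_zero (pow_ne_zero 2 hu)

/-- A covector field with a single non-zero component. -/
noncomputable def oneComp (i : Fin 2) (f : ℝ → ℝ) : ℝ → Pt := fun x => Pi.single i (f x)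

theorem oneComp_coord (i j : Fin 2) (f : ℝ → ℝ) :
    (fun x => oneComp i f x j) = if j = i then f else fun _ => 0 := by
  funext x; unfold oneComp; by_cases h : j = i <;> simp [h]

theorem deriv_oneComp (i j : Fin 2) (f : ℝ → ℝ) (x : ℝ) :
    deriv (fun y => oneComp i f y j) x = if j = i then deriv f x else 0 := by
  rw [oneComp_coord]; split_ifs <;> simp

theorem isTest_oneComp (i : Fin 2) {f : ℝ → ℝ} (hf : ContDiff ℝ (⊤ : ℕ∞) f)
    (hc : HasCompactSupport f) : IsTest (oneComp i f) := by
  refine ⟨?_, ?_⟩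
  · rw [contDiff_pi]; intro j; rw [oneComp_coord]; split_ifs
    · exact hf
    · exact contDiff_const
  · refine hc.mono ?_
    intro x hx hx'
    exact hx (by simp [oneComp, hx'])

theorem R33_oneComp {u : ℝ → Pt} {f : ℝ → ℝ} (i l : Fin 2) :
    (fun x => R33 u (oneComp i f) x l) =
      opB (fun x => coeffE l i + coeffS i l (u x)) (fun x => coeffS l i (u x)) f := by
  funext x
  unfold R33 opB
  simp only [oneComp_coord]
  fin_cases i <;> fin_cases l <;> simp [coeffE, coeffS]

/-- The variation of `R₃⁽³⁾` is obtained by varying its coefficients. -/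
theorem opDeriv_R33_oneComp {u w : ℝ → Pt} (hu : ContDiff ℝ (⊤ : ℕ∞) u) (hm : ∀ x, u x 0 ≠ 0)
    (hw : ContDiff ℝ (⊤ : ℕ∞) w) {f : ℝ → ℝ} (hf : ContDiff ℝ (⊤ : ℕ∞) f) (i l : Fin 2) (x : ℝ) :
    opDeriv R33 u w (oneComp i f) x l =
      opB (fun x => ∑ k, pd k (coeffS i l) (u x) * w x k)
        (fun x => ∑ k, pd k (coeffS l i) (u x) * w x k) f x := by
  unfold opDeriv
  simp only [fun ε : ℝ => congrFun (R33_oneComp (u := fun y => u y + ε • w y) (f := f) i l) x]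
  unfold opB
  set O : Set (ℝ × ℝ) := {q | (u q.2 + q.1 • w q.2) 0 ≠ 0} with hO
  have hcurve : ContDiff ℝ (⊤ : ℕ∞) (fun q : ℝ × ℝ => u q.2 + q.1 • w q.2) := by fun_prop
  have hOo : IsOpen O := isOpen_ne_fun
    ((continuous_apply 0).comp hcurve.continuous) continuous_const
  have hO0 : ∀ y, ((0 : ℝ), y) ∈ O := fun y => by simpa [hO] using hm y
  have hS : ∀ a b, ContDiffOn ℝ (⊤ : ℕ∞)
      (fun q : ℝ × ℝ => coeffS a b (u q.2 + q.1 • w q.2)) O := fun a b =>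
    (contDiffOn_coeffS a b).comp hcurve.contDiffOn fun q hq => hq
  have hSd : ∀ a b y, HasDerivAt (fun ε : ℝ => coeffS a b (u y + ε • w y))
      (∑ k, pd k (coeffS a b) (u y) * w y k) 0 := by
    intro a b y
    have hline : HasDerivAt (fun ε : ℝ => u y + ε • w y) (w y) 0 := by
      simpa using ((hasDerivAt_id (0 : ℝ)).smul_const (w y)).const_add (u y)
    have hop : IsOpen {p : Pt | p 0 ≠ 0} := isOpen_ne_fun (continuous_apply 0) continuous_const
    have := hasDerivAt_comp_curve (s := coeffS a b) (t := 0)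
      (by simpa using ((contDiffOn_coeffS a b).contDiffAt
        (hop.mem_nhds (hm y))).differentiableAt (by simp)) hline
    simpa using this
  have hf1 : ContDiffOn ℝ (⊤ : ℕ∞) (fun q : ℝ × ℝ => deriv f q.2) O :=
    ((contDiff_top_deriv hf).comp contDiff_snd).contDiffOn
  have hf2 : ContDiffOn ℝ (⊤ : ℕ∞) (fun q : ℝ × ℝ => deriv (deriv f) q.2) O :=
    ((contDiff_top_deriv (contDiff_top_deriv hf)).comp contDiff_snd).contDiffOn
  have A : ∀ y, _ := fun y => deriv_deriv_comm_of_contDiffOn hOo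
    (H := fun ε z => coeffS l i (u z + ε • w z) * deriv f z) ((hS l i).mul hf1) (hO0 y)
  have K : ContDiffOn ℝ (⊤ : ℕ∞) (fun q : ℝ × ℝ =>
      (fun ε y => (coeffE l i + coeffS i l (u y + ε • w y)) * deriv (deriv f) y
        + deriv (fun z => coeffS l i (u z + ε • w z) * deriv f z) y) q.1 q.2) O :=
    ((contDiffOn_const.add (hS i l)).mul hf2).add (A 0).1
  have B := deriv_deriv_comm_of_contDiffOn hOo
    (H := fun ε y => (coeffE l i + coeffS i l (u y + ε • w y)) * deriv (deriv f) y
        + deriv (fun z => coeffS l i (u z + ε • w z) * deriv f z) y) K (hO0 x)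
  rw [B.2.2.1.deriv]
  congr 1
  funext y
  refine HasDerivAt.deriv ?_
  refine HasDerivAt.add ?_ ?_
  · exact ((hSd i l y).const_add _).mul_const _
  · refine (A y).2.2.1.congr_deriv ?_
    congr 1
    funext z
    exact ((hSd l i z).mul_const _).deriv

/-! ### The Euler–Lagrange form of the Schouten bracket -/

/-- The operator entry `(R₃⁽³⁾)_{li}` along the field `u`. -/
noncomputable def entryR (u : ℝ → Pt) (l i : Fin 2) (f : ℝ → ℝ) : ℝ → ℝ :=
  opB (fun x => coeffE l i + coeffS i l (u x)) (fun x => coeffS l i (u x)) f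

/-- The operator entry `g^{ki} ∂ₓ + Γ^{ki}_n u^n_x` along the field `u`. -/
noncomputable def entryP (g : Contra) (Γ : Conn) (u : ℝ → Pt) (k i : Fin 2) (f : ℝ → ℝ) : ℝ → ℝ :=
  fun x => g (u x) k i * deriv f x + (∑ n, Γ (u x) k i n * deriv (fun y => u y n) x) * f x

/-- The entry `(i, j)` of the variation of `g^{ij} ∂ₓ + Γ^{ij}_k u^k_x` in the direction `β`,
applied to `h`. -/
noncomputable def varP (g : Contra) (Γ : Conn) (u : ℝ → Pt) (i j : Fin 2) (β : Fin 2 → ℝ → ℝ)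
    (h : ℝ → ℝ) : ℝ → ℝ := fun x =>
  (∑ l, pd l (fun v => g v i j) (u x) * β l x) * deriv h x
    + (∑ k, ((∑ l, pd l (fun v => Γ v i j k) (u x) * β l x) * deriv (fun y => u y k) x
      + Γ (u x) i j k * deriv (β k) x)) * h x

/-- The entry `(l, i)` of the variation of `R₃⁽³⁾` in the direction `w`, applied to `f`. -/
noncomputable def varR (u : ℝ → Pt) (l i : Fin 2) (w : Fin 2 → ℝ → ℝ) (f : ℝ → ℝ) : ℝ → ℝ :=
  opB (fun x => ∑ k, pd k (coeffS i l) (u x) * w k x)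
    (fun x => ∑ k, pd k (coeffS l i) (u x) * w k x) f

/-- The `l`-th component of the variational derivative of `∫ f · varP i j β h` in `β`. -/
noncomputable def adjDir (g : Contra) (Γ : Conn) (u : ℝ → Pt) (i j : Fin 2) (f h : ℝ → ℝ)
    (l : Fin 2) : ℝ → ℝ := fun x =>
  f x * (pd l (fun v => g v i j) (u x) * deriv h x
      + (∑ k, pd l (fun v => Γ v i j k) (u x) * deriv (fun y => u y k) x) * h x)
    - deriv (fun y => f y * (h y * Γ (u y) i j l)) x

/-- The variational derivative of `∫ h · varP j m γ θ` in `θ`. -/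
noncomputable def adjArg (g : Contra) (Γ : Conn) (u : ℝ → Pt) (j m : Fin 2) (h : ℝ → ℝ)
    (γ : Fin 2 → ℝ → ℝ) : ℝ → ℝ := fun x =>
  -deriv (fun y => ∑ l, h y * (pd l (fun v => g v j m) (u y) * γ l y)) x
    + h x * ∑ k, ((∑ l, pd l (fun v => Γ v j m k) (u x) * γ l x) * deriv (fun y => u y k) x
      + Γ (u x) j m k * deriv (γ k) x)

/-- The variational derivative of `∫ f · varR i j w h` in `w^k`. -/
noncomputable def adjCoeff (u : ℝ → Pt) (i j : Fin 2) (f h : ℝ → ℝ) (k : Fin 2) : ℝ → ℝ := fun x =>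
  pd k (coeffS i j) (u x) * (deriv (deriv f) x * deriv h x)
    - pd k (coeffS j i) (u x) * (deriv f x * deriv (deriv h) x)

/-- The variational derivative in `θ` of `∑_k ∫ Z_k · entryP k m θ`. -/
noncomputable def adjP (g : Contra) (Γ : Conn) (u : ℝ → Pt) (m : Fin 2) (Z : Fin 2 → ℝ → ℝ) :
    ℝ → ℝ := fun x =>
  -deriv (fun y => ∑ k, g (u y) k m * Z k y) x
    + ∑ k, (∑ n, Γ (u x) k m n * deriv (fun y => u y n) x) * Z k x

/-- The variational derivative in `θ` of the Schouten bracket of `g ∂ₓ + Γ uₓ` and `R₃⁽³⁾`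
evaluated on the covectors `f e_i`, `h e_j`, `θ e_m`. -/
noncomputable def eulerLagrange (g : Contra) (Γ : Conn) (u : ℝ → Pt) (i j m : Fin 2)
    (f h : ℝ → ℝ) : ℝ → ℝ := fun x =>
  -(∑ l, opB (fun x => coeffS l m (u x)) (fun x => coeffE l m + coeffS m l (u x))
      (adjDir g Γ u i j f h l) x)
  + adjArg g Γ u j m h (fun l => entryR u l i f) x
  + varP g Γ u m i (fun l => entryR u l j h) f x
  + adjP g Γ u m (adjCoeff u i j f h) x
  - opB (fun x => ∑ k, pd k (coeffS j m) (u x) * entryP g Γ u k i f x)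
      (fun x => ∑ k, pd k (coeffS m j) (u x) * entryP g Γ u k i f x) h x
  + varR u m i (fun k => entryP g Γ u k j h) f x

theorem firstOrderOp_oneComp (g : Contra) (Γ : Conn) (u : ℝ → Pt) (i k : Fin 2) (f : ℝ → ℝ)
    (x : ℝ) : firstOrderOp g Γ u (oneComp i f) x k = entryP g Γ u k i f x := by
  unfold firstOrderOp entryP
  simp only [deriv_oneComp]
  fin_cases i <;> simp [oneComp]

theorem sum_oneComp_mul (i : Fin 2) (f : ℝ → ℝ) (x : ℝ) (a : Fin 2 → ℝ) :
    ∑ l, oneComp i f x l * a l = f x * a i := by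
  fin_cases i <;> simp [oneComp]

section

variable {U : Set Pt} {g : Contra} {Γ : Conn} {u : ℝ → Pt}

/-- Smoothness of the coefficients along a field, packaged for functions of one variable. -/
theorem exists_coeff_along
    (hg : ∀ i j, ContDiffOn ℝ (⊤ : ℕ∞) (fun u => g u i j) U)
    (hΓ : ∀ i j k, ContDiffOn ℝ (⊤ : ℕ∞) (fun u => Γ u i j k) U)
    (hu : ContDiff ℝ (⊤ : ℕ∞) u) (hm : ∀ x, u x ∈ U) :
    ∃ (G : Fin 2 → Fin 2 → ℝ → ℝ) (C : Fin 2 → Fin 2 → Fin 2 → ℝ → ℝ),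
      (∀ i j x, g (u x) i j = G i j x) ∧ (∀ i j k x, Γ (u x) i j k = C i j k x) ∧
      (∀ i j, ContDiff ℝ (⊤ : ℕ∞) (G i j)) ∧ ∀ i j k, ContDiff ℝ (⊤ : ℕ∞) (C i j k) :=
  ⟨fun i j x => g (u x) i j, fun i j k x => Γ (u x) i j k, fun _ _ _ => rfl, fun _ _ _ _ => rfl,
    fun i j => contDiff_comp_curve (hg i j) hu hm,
    fun i j k => contDiff_comp_curve (hΓ i j k) hu hm⟩

theorem contDiff_entryP
    (hg : ∀ i j, ContDiffOn ℝ (⊤ : ℕ∞) (fun u => g u i j) U)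
    (hΓ : ∀ i j k, ContDiffOn ℝ (⊤ : ℕ∞) (fun u => Γ u i j k) U)
    (hu : ContDiff ℝ (⊤ : ℕ∞) u) (hm : ∀ x, u x ∈ U) (k i : Fin 2) {f : ℝ → ℝ}
    (hf : ContDiff ℝ (⊤ : ℕ∞) f) : ContDiff ℝ (⊤ : ℕ∞) (entryP g Γ u k i f) := by
  obtain ⟨G, C, eG, eC, sG, sC⟩ := exists_coeff_along hg hΓ hu hm
  have h3 := fun n => contDiff_top_deriv (contDiff_coord hu n)
  unfold entryP
  simp only [eG, eC]
  fun_prop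

theorem bracketTerm_firstOrderOp_R33 (hU : IsOpen U) (hU0 : ∀ p ∈ U, p 0 ≠ 0)
    (hg : ∀ i j, ContDiffOn ℝ (⊤ : ℕ∞) (fun u => g u i j) U)
    (hΓ : ∀ i j k, ContDiffOn ℝ (⊤ : ℕ∞) (fun u => Γ u i j k) U)
    (hu : ContDiff ℝ (⊤ : ℕ∞) u) (hm : ∀ x, u x ∈ U) (i j m : Fin 2) (f h : ℝ → ℝ) {θ : ℝ → ℝ}
    (hθ : ContDiff ℝ (⊤ : ℕ∞) θ) (x : ℝ) :
    bracketTerm (firstOrderOp g Γ) R33 u (oneComp i f) (oneComp j h) (oneComp m θ) x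
      = f x * varP g Γ u i j (fun l => entryR u l m θ) h x := by
  have hS : ∀ a b, ContDiff ℝ (⊤ : ℕ∞) (fun x => coeffS a b (u x)) := fun a b =>
    contDiff_comp_curve (contDiffOn_coeffS a b) hu fun x => hU0 _ (hm x)
  have hw : ContDiff ℝ (⊤ : ℕ∞) (R33 u (oneComp m θ)) := by
    rw [contDiff_pi]; intro l
    rw [R33_oneComp]
    exact contDiff_opB (contDiff_const.add (hS m l)) (hS l m) hθ
  have e : ∀ l y, R33 u (oneComp m θ) y l = entryR u l m θ y := fun l y =>
    congrFun (R33_oneComp m l) y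
  unfold bracketTerm
  rw [sum_oneComp_mul, opDeriv_firstOrderOp hU hg hΓ hu hm hw]
  congr 1
  simp only [deriv_oneComp, e]
  unfold varP
  fin_cases j <;> simp [oneComp]

theorem bracketTerm_R33_firstOrderOp (hU0 : ∀ p ∈ U, p 0 ≠ 0)
    (hg : ∀ i j, ContDiffOn ℝ (⊤ : ℕ∞) (fun u => g u i j) U)
    (hΓ : ∀ i j k, ContDiffOn ℝ (⊤ : ℕ∞) (fun u => Γ u i j k) U)
    (hu : ContDiff ℝ (⊤ : ℕ∞) u) (hm : ∀ x, u x ∈ U) (i j m : Fin 2) (f : ℝ → ℝ) {h θ : ℝ → ℝ}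
    (hh : ContDiff ℝ (⊤ : ℕ∞) h) (hθ : ContDiff ℝ (⊤ : ℕ∞) θ) (x : ℝ) :
    bracketTerm R33 (firstOrderOp g Γ) u (oneComp i f) (oneComp j h) (oneComp m θ) x
      = f x * varR u i j (fun k => entryP g Γ u k m θ) h x := by
  have e : ∀ y k, firstOrderOp g Γ u (oneComp m θ) y k = entryP g Γ u k m θ y := fun y k =>
    firstOrderOp_oneComp g Γ u m k θ y
  have hw : ContDiff ℝ (⊤ : ℕ∞) (firstOrderOp g Γ u (oneComp m θ)) := by
    rw [contDiff_pi]; intro l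
    simp only [e]
    exact contDiff_entryP hg hΓ hu hm l m hθ
  unfold bracketTerm
  rw [sum_oneComp_mul, opDeriv_R33_oneComp hu (fun x => hU0 _ (hm x)) hw hh]
  simp only [e]
  rfl

theorem integrable_of_smooth {f : ℝ → ℝ} (hf : ContDiff ℝ (⊤ : ℕ∞) f)
    (hc : HasCompactSupport f) : Integrable f :=
  hf.continuous.integrable_of_hasCompactSupport hc

theorem integral_mul_varP_dir (hU : IsOpen U)
    (hg : ∀ i j, ContDiffOn ℝ (⊤ : ℕ∞) (fun u => g u i j) U)
    (hΓ : ∀ i j k, ContDiffOn ℝ (⊤ : ℕ∞) (fun u => Γ u i j k) U)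
    (hu : ContDiff ℝ (⊤ : ℕ∞) u) (hm : ∀ x, u x ∈ U) (i j : Fin 2) {f h : ℝ → ℝ}
    (hf : ContDiff ℝ (⊤ : ℕ∞) f) (hh : ContDiff ℝ (⊤ : ℕ∞) h) {β : Fin 2 → ℝ → ℝ}
    (hβ : ∀ l, ContDiff ℝ (⊤ : ℕ∞) (β l)) (hc : ∀ l, HasCompactSupport (β l)) :
    ∫ x, f x * varP g Γ u i j β h x = ∑ l, ∫ x, adjDir g Γ u i j f h l x * β l x := by
  have h1 := fun l => contDiff_comp_curve (contDiffOn_pd hU (hg i j) l) hu hm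
  obtain ⟨G, C, eG, eC, sG, sC⟩ := exists_coeff_along hg hΓ hu hm
  have h3 := fun n => contDiff_top_deriv (contDiff_coord hu n)
  have h4 := fun l n => contDiff_comp_curve (contDiffOn_pd hU (hΓ i j n) l) hu hm
  set N : Fin 2 → ℝ → ℝ := fun l x => f x * (pd l (fun v => g v i j) (u x) * deriv h x
      + (∑ k, pd l (fun v => Γ v i j k) (u x) * deriv (fun y => u y k) x) * h x) with hN
  set Q : Fin 2 → ℝ → ℝ := fun l x => f x * (h x * Γ (u x) i j l) with hQ
  have sN : ∀ l, ContDiff ℝ (⊤ : ℕ∞) (N l) := fun l => by simp only [hN]; fun_prop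
  have sQ : ∀ l, ContDiff ℝ (⊤ : ℕ∞) (Q l) := fun l => by simp only [hQ, eC]; fun_prop
  have iN : ∀ l, Integrable (fun x => N l x * β l x) := fun l =>
    integrable_of_smooth (by fun_prop) (hc l).mul_left
  have iQ : ∀ l, Integrable (fun x => Q l x * deriv (β l) x) := fun l =>
    integrable_of_smooth (by fun_prop) (hc l).deriv.mul_left
  have iQ' : ∀ l, Integrable (fun x => deriv (Q l) x * β l x) := fun l =>
    integrable_of_smooth (by fun_prop) (hc l).mul_left
  have e : ∀ x, f x * varP g Γ u i j β h x
      = ∑ l, (N l x * β l x + Q l x * deriv (β l) x) := by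
    intro x
    simp only [hN, hQ, varP, Fin.sum_univ_two]; ring
  simp_rw [e]
  rw [integral_finsetSum Finset.univ (f := fun l x => N l x * β l x + Q l x * deriv (β l) x)
    fun l _ => (iN l).add (iQ l)]
  refine Finset.sum_congr rfl fun l _ => ?_
  rw [integral_add (iN l) (iQ l), integral_mul_deriv_of_smooth (sQ l) (hβ l) (hc l),
    ← sub_eq_add_neg, ← integral_sub (iN l) (iQ' l)]
  congr 1; funext x
  simp only [adjDir, hN, hQ]; ring

theorem integral_mul_varP_arg (hU : IsOpen U)
    (hg : ∀ i j, ContDiffOn ℝ (⊤ : ℕ∞) (fun u => g u i j) U)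
    (hΓ : ∀ i j k, ContDiffOn ℝ (⊤ : ℕ∞) (fun u => Γ u i j k) U)
    (hu : ContDiff ℝ (⊤ : ℕ∞) u) (hm : ∀ x, u x ∈ U) (j m : Fin 2) {h θ : ℝ → ℝ}
    (hh : ContDiff ℝ (⊤ : ℕ∞) h) {γ : Fin 2 → ℝ → ℝ} (hγ : ∀ l, ContDiff ℝ (⊤ : ℕ∞) (γ l))
    (hθ : ContDiff ℝ (⊤ : ℕ∞) θ) (hc : HasCompactSupport θ) :
    ∫ x, h x * varP g Γ u j m γ θ x = ∫ x, adjArg g Γ u j m h γ x * θ x := by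
  have h1 := fun l => contDiff_comp_curve (contDiffOn_pd hU (hg j m) l) hu hm
  obtain ⟨G, C, eG, eC, sG, sC⟩ := exists_coeff_along hg hΓ hu hm
  have h3 := fun n => contDiff_top_deriv (contDiff_coord hu n)
  have h4 := fun l n => contDiff_comp_curve (contDiffOn_pd hU (hΓ j m n) l) hu hm
  set Q : ℝ → ℝ := fun y => ∑ l, h y * (pd l (fun v => g v j m) (u y) * γ l y) with hQ
  set N : ℝ → ℝ := fun x => h x * ∑ k, ((∑ l, pd l (fun v => Γ v j m k) (u x) * γ l x)
      * deriv (fun y => u y k) x + Γ (u x) j m k * deriv (γ k) x) with hN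
  have sN : ContDiff ℝ (⊤ : ℕ∞) N := by simp only [hN, eC]; fun_prop
  have sQ : ContDiff ℝ (⊤ : ℕ∞) Q := by simp only [hQ]; fun_prop
  have e : ∀ x, h x * varP g Γ u j m γ θ x = Q x * deriv θ x + N x * θ x := by
    intro x
    simp only [hN, hQ, varP, Fin.sum_univ_two]; ring
  have iN : Integrable (fun x => N x * θ x) := integrable_of_smooth (by fun_prop) hc.mul_left
  have iQ : Integrable (fun x => Q x * deriv θ x) :=
    integrable_of_smooth (by fun_prop) hc.deriv.mul_left
  have iQ' : Integrable (fun x => deriv Q x * θ x) :=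
    integrable_of_smooth (by fun_prop) hc.mul_left
  simp_rw [e]
  rw [integral_add iQ iN, integral_mul_deriv_of_smooth sQ hθ hc, neg_add_eq_sub,
    ← integral_sub iN iQ']
  congr 1; funext x
  simp only [adjArg, hN, hQ]; ring

theorem integral_mul_varR_dir (hU : IsOpen U) (hU0 : ∀ p ∈ U, p 0 ≠ 0)
    (hg : ∀ i j, ContDiffOn ℝ (⊤ : ℕ∞) (fun u => g u i j) U)
    (hΓ : ∀ i j k, ContDiffOn ℝ (⊤ : ℕ∞) (fun u => Γ u i j k) U)
    (hu : ContDiff ℝ (⊤ : ℕ∞) u) (hm : ∀ x, u x ∈ U) (i j m : Fin 2) {f h θ : ℝ → ℝ}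
    (hf : ContDiff ℝ (⊤ : ℕ∞) f) (hh : ContDiff ℝ (⊤ : ℕ∞) h) (hhc : HasCompactSupport h)
    (hθ : ContDiff ℝ (⊤ : ℕ∞) θ) (hc : HasCompactSupport θ) :
    ∫ x, f x * varR u i j (fun k => entryP g Γ u k m θ) h x
      = ∫ x, adjP g Γ u m (adjCoeff u i j f h) x * θ x := by
  obtain ⟨G, C, eG, eC, sG, sC⟩ := exists_coeff_along hg hΓ hu hm
  have h3 := fun n => contDiff_top_deriv (contDiff_coord hu n)
  have h4 : ∀ a b k, ContDiff ℝ (⊤ : ℕ∞) (fun x => pd k (coeffS a b) (u x)) := fun a b k =>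
    contDiff_comp_curve
      (contDiffOn_pd hU ((contDiffOn_coeffS a b).mono fun p hp => hU0 p hp) k) hu hm
  set Q : ℝ → ℝ := fun y => ∑ k, g (u y) k m * adjCoeff u i j f h k y with hQ
  set N : ℝ → ℝ := fun x => ∑ k, (∑ n, Γ (u x) k m n * deriv (fun y => u y n) x)
    * adjCoeff u i j f h k x with hN
  have sN : ContDiff ℝ (⊤ : ℕ∞) N := by simp only [hN, adjCoeff, eC]; fun_prop
  have sQ : ContDiff ℝ (⊤ : ℕ∞) Q := by simp only [hQ, adjCoeff, eG]; fun_prop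
  have iN : Integrable (fun x => N x * θ x) := integrable_of_smooth (by fun_prop) hc.mul_left
  have iQ : Integrable (fun x => Q x * deriv θ x) :=
    integrable_of_smooth (by fun_prop) hc.deriv.mul_left
  have iQ' : Integrable (fun x => deriv Q x * θ x) :=
    integrable_of_smooth (by fun_prop) hc.mul_left
  have hP : ∀ k, ContDiff ℝ (⊤ : ℕ∞) (entryP g Γ u k m θ) := fun k =>
    contDiff_entryP hg hΓ hu hm k m hθ
  unfold varR
  rw [integral_mul_opB_eq_coeff (by fun_prop) (by fun_prop) hf hh hhc]
  have e : ∀ x, (∑ k, pd k (coeffS i j) (u x) * entryP g Γ u k m θ x)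
        * (deriv (deriv f) x * deriv h x)
      - (∑ k, pd k (coeffS j i) (u x) * entryP g Γ u k m θ x)
        * (deriv f x * deriv (deriv h) x) = Q x * deriv θ x + N x * θ x := by
    intro x
    simp only [hN, hQ, entryP, adjCoeff, Fin.sum_univ_two]; ring
  simp_rw [e]
  rw [integral_add iQ iN, integral_mul_deriv_of_smooth sQ hθ hc, neg_add_eq_sub,
    ← integral_sub iN iQ']
  congr 1; funext x
  simp only [adjP, hN, hQ]; ring

end

section

variable {U : Set Pt} {g : Contra} {Γ : Conn} {u : ℝ → Pt}

theorem contDiff_varP (hU : IsOpen U)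
    (hg : ∀ i j, ContDiffOn ℝ (⊤ : ℕ∞) (fun u => g u i j) U)
    (hΓ : ∀ i j k, ContDiffOn ℝ (⊤ : ℕ∞) (fun u => Γ u i j k) U)
    (hu : ContDiff ℝ (⊤ : ℕ∞) u) (hm : ∀ x, u x ∈ U) (i j : Fin 2) {β : Fin 2 → ℝ → ℝ}
    {h : ℝ → ℝ} (hβ : ∀ l, ContDiff ℝ (⊤ : ℕ∞) (β l)) (hh : ContDiff ℝ (⊤ : ℕ∞) h) :
    ContDiff ℝ (⊤ : ℕ∞) (varP g Γ u i j β h) := by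
  have h1 := fun l => contDiff_comp_curve (contDiffOn_pd hU (hg i j) l) hu hm
  obtain ⟨G, C, eG, eC, sG, sC⟩ := exists_coeff_along hg hΓ hu hm
  have h3 := fun n => contDiff_top_deriv (contDiff_coord hu n)
  have h4 := fun l n => contDiff_comp_curve (contDiffOn_pd hU (hΓ i j n) l) hu hm
  unfold varP
  simp only [eC]
  fun_prop

theorem contDiff_pd_coeffS (hU : IsOpen U) (hU0 : ∀ p ∈ U, p 0 ≠ 0)
    (hu : ContDiff ℝ (⊤ : ℕ∞) u) (hm : ∀ x, u x ∈ U) (a b k : Fin 2) :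
    ContDiff ℝ (⊤ : ℕ∞) (fun x => pd k (coeffS a b) (u x)) :=
  contDiff_comp_curve
    (contDiffOn_pd hU ((contDiffOn_coeffS a b).mono fun p hp => hU0 p hp) k) hu hm

theorem contDiff_coeffS_along (hU0 : ∀ p ∈ U, p 0 ≠ 0)
    (hu : ContDiff ℝ (⊤ : ℕ∞) u) (hm : ∀ x, u x ∈ U) (a b : Fin 2) :
    ContDiff ℝ (⊤ : ℕ∞) (fun x => coeffS a b (u x)) :=
  contDiff_comp_curve (contDiffOn_coeffS a b) hu fun x => hU0 _ (hm x)

theorem contDiff_entryR (hU0 : ∀ p ∈ U, p 0 ≠ 0)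
    (hu : ContDiff ℝ (⊤ : ℕ∞) u) (hm : ∀ x, u x ∈ U) (l i : Fin 2) {f : ℝ → ℝ}
    (hf : ContDiff ℝ (⊤ : ℕ∞) f) : ContDiff ℝ (⊤ : ℕ∞) (entryR u l i f) :=
  contDiff_opB (contDiff_const.add (contDiff_coeffS_along hU0 hu hm i l))
    (contDiff_coeffS_along hU0 hu hm l i) hf

theorem contDiff_varR (hU : IsOpen U) (hU0 : ∀ p ∈ U, p 0 ≠ 0)
    (hu : ContDiff ℝ (⊤ : ℕ∞) u) (hm : ∀ x, u x ∈ U) (l i : Fin 2) {w : Fin 2 → ℝ → ℝ}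
    {f : ℝ → ℝ} (hw : ∀ l, ContDiff ℝ (⊤ : ℕ∞) (w l)) (hf : ContDiff ℝ (⊤ : ℕ∞) f) :
    ContDiff ℝ (⊤ : ℕ∞) (varR u l i w f) := by
  have h4 := contDiff_pd_coeffS hU hU0 hu hm
  unfold varR
  fun_prop

theorem contDiff_adjDir (hU : IsOpen U)
    (hg : ∀ i j, ContDiffOn ℝ (⊤ : ℕ∞) (fun u => g u i j) U)
    (hΓ : ∀ i j k, ContDiffOn ℝ (⊤ : ℕ∞) (fun u => Γ u i j k) U)
    (hu : ContDiff ℝ (⊤ : ℕ∞) u) (hm : ∀ x, u x ∈ U) (i j : Fin 2) {f h : ℝ → ℝ}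
    (hf : ContDiff ℝ (⊤ : ℕ∞) f) (hh : ContDiff ℝ (⊤ : ℕ∞) h) (l : Fin 2) :
    ContDiff ℝ (⊤ : ℕ∞) (adjDir g Γ u i j f h l) := by
  have h1 := fun l => contDiff_comp_curve (contDiffOn_pd hU (hg i j) l) hu hm
  obtain ⟨G, C, eG, eC, sG, sC⟩ := exists_coeff_along hg hΓ hu hm
  have h3 := fun n => contDiff_top_deriv (contDiff_coord hu n)
  have h4 := fun l n => contDiff_comp_curve (contDiffOn_pd hU (hΓ i j n) l) hu hm
  unfold adjDir
  simp only [eC]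
  fun_prop

theorem contDiff_adjArg (hU : IsOpen U)
    (hg : ∀ i j, ContDiffOn ℝ (⊤ : ℕ∞) (fun u => g u i j) U)
    (hΓ : ∀ i j k, ContDiffOn ℝ (⊤ : ℕ∞) (fun u => Γ u i j k) U)
    (hu : ContDiff ℝ (⊤ : ℕ∞) u) (hm : ∀ x, u x ∈ U) (j m : Fin 2) {h : ℝ → ℝ}
    (hh : ContDiff ℝ (⊤ : ℕ∞) h) {γ : Fin 2 → ℝ → ℝ} (hγ : ∀ l, ContDiff ℝ (⊤ : ℕ∞) (γ l)) :
    ContDiff ℝ (⊤ : ℕ∞) (adjArg g Γ u j m h γ) := by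
  have h1 := fun l => contDiff_comp_curve (contDiffOn_pd hU (hg j m) l) hu hm
  obtain ⟨G, C, eG, eC, sG, sC⟩ := exists_coeff_along hg hΓ hu hm
  have h3 := fun n => contDiff_top_deriv (contDiff_coord hu n)
  have h4 := fun l n => contDiff_comp_curve (contDiffOn_pd hU (hΓ j m n) l) hu hm
  unfold adjArg
  simp only [eC]
  fun_prop

theorem contDiff_adjP
    (hg : ∀ i j, ContDiffOn ℝ (⊤ : ℕ∞) (fun u => g u i j) U)
    (hΓ : ∀ i j k, ContDiffOn ℝ (⊤ : ℕ∞) (fun u => Γ u i j k) U)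
    (hu : ContDiff ℝ (⊤ : ℕ∞) u) (hm : ∀ x, u x ∈ U) (m : Fin 2) {Z : Fin 2 → ℝ → ℝ}
    (hZ : ∀ k, ContDiff ℝ (⊤ : ℕ∞) (Z k)) : ContDiff ℝ (⊤ : ℕ∞) (adjP g Γ u m Z) := by
  obtain ⟨G, C, eG, eC, sG, sC⟩ := exists_coeff_along hg hΓ hu hm
  have h3 := fun n => contDiff_top_deriv (contDiff_coord hu n)
  unfold adjP
  simp only [eG, eC]
  fun_prop

theorem integral_add_six {a b c d e k : ℝ → ℝ} (ha : Integrable a) (hb : Integrable b)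
    (hc : Integrable c) (hd : Integrable d) (he : Integrable e) (hk : Integrable k) :
    ∫ x, (a x + b x + c x + (d x + e x + k x))
      = (∫ x, a x) + (∫ x, b x) + (∫ x, c x) + ((∫ x, d x) + (∫ x, e x) + ∫ x, k x) := by
  have h1 : Integrable fun x => a x + b x := ha.add hb
  have h2 : Integrable fun x => a x + b x + c x := h1.add hc
  have h3 : Integrable fun x => d x + e x := hd.add he
  have h4 : Integrable fun x => d x + e x + k x := h3.add hk
  rw [integral_add h2 h4, integral_add h1 hc, integral_add ha hb, integral_add h3 hk,
    integral_add hd he]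

/-- If the Schouten bracket vanishes on all covectors, its Euler–Lagrange expression vanishes
pointwise. -/
theorem eulerLagrange_eq_zero (hU : IsOpen U) (hU0 : ∀ p ∈ U, p 0 ≠ 0)
    (hc : CompatibleR33 U g Γ) (hu : ContDiff ℝ (⊤ : ℕ∞) u) (hm : ∀ x, u x ∈ U)
    (i j m : Fin 2) {f h : ℝ → ℝ} (hf : ContDiff ℝ (⊤ : ℕ∞) f) (hfc : HasCompactSupport f)
    (hh : ContDiff ℝ (⊤ : ℕ∞) h) (hhc : HasCompactSupport h) (x : ℝ) :
    eulerLagrange g Γ u i j m f h x = 0 := by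
  have hg := hc.smooth_g
  have hΓ := hc.smooth_Γ
  have sR : ∀ l i {f : ℝ → ℝ}, ContDiff ℝ (⊤ : ℕ∞) f → ContDiff ℝ (⊤ : ℕ∞) (entryR u l i f) :=
    fun l i _ hf => contDiff_entryR hU0 hu hm l i hf
  have sP : ∀ k i {f : ℝ → ℝ}, ContDiff ℝ (⊤ : ℕ∞) f →
      ContDiff ℝ (⊤ : ℕ∞) (entryP g Γ u k i f) :=
    fun k i _ hf => contDiff_entryP hg hΓ hu hm k i hf
  have sS := contDiff_coeffS_along hU0 hu hm
  have sS' := contDiff_pd_coeffS hU hU0 hu hm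
  have sZ : ∀ k, ContDiff ℝ (⊤ : ℕ∞) (adjCoeff u i j f h k) := fun k => by
    unfold adjCoeff; fun_prop
  have c1 : ∀ l, ContDiff ℝ (⊤ : ℕ∞) (opB (fun x => coeffS l m (u x))
      (fun x => coeffE l m + coeffS m l (u x)) (adjDir g Γ u i j f h l)) := fun l =>
    contDiff_opB (sS l m) (contDiff_const.add (sS m l))
      (contDiff_adjDir hU hg hΓ hu hm i j hf hh l)
  have c2 := contDiff_adjArg hU hg hΓ hu hm j m hh (fun l => sR l i hf)
  have c3 := contDiff_varP hU hg hΓ hu hm m i (fun l => sR l j hh) hf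
  have c4 := contDiff_adjP hg hΓ hu hm m sZ
  have sw : ∀ a b, ContDiff ℝ (⊤ : ℕ∞)
      (fun x => ∑ k, pd k (coeffS a b) (u x) * entryP g Γ u k i f x) := fun a b => by
    have := fun k => sP k i hf
    fun_prop
  have c5 := contDiff_opB (sw j m) (sw m j) hh
  have c6 := contDiff_varR hU hU0 hu hm m i (fun k => sP k j hh) hf
  refine eq_zero_of_integral_test ?_ ?_ x
  · refine ContDiff.continuous (𝕜 := ℝ) (n := (⊤ : ℕ∞)) ?_
    unfold eulerLagrange
    exact ((((((ContDiff.sum fun l _ => c1 l).neg).add c2).add c3).add c4).sub c5).add c6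
  · intro θ hθ hθc
    have H := hc.bracket u hu hm _ _ _ (isTest_oneComp i hf hfc) (isTest_oneComp j hh hhc)
      (isTest_oneComp m hθ hθc)
    unfold schouten at H
    simp only [bracketTerm_firstOrderOp_R33 hU hU0 hg hΓ hu hm _ _ _ _ _ hf,
      bracketTerm_firstOrderOp_R33 hU hU0 hg hΓ hu hm _ _ _ _ _ hh,
      bracketTerm_firstOrderOp_R33 hU hU0 hg hΓ hu hm _ _ _ _ _ hθ,
      bracketTerm_R33_firstOrderOp hU0 hg hΓ hu hm _ _ _ _ hh hθ,
      bracketTerm_R33_firstOrderOp hU0 hg hΓ hu hm _ _ _ _ hθ hf,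
      bracketTerm_R33_firstOrderOp hU0 hg hΓ hu hm _ _ _ _ hf hh] at H
    have i1 : Integrable (fun x => f x * varP g Γ u i j (fun l => entryR u l m θ) h x) :=
      integrable_of_smooth (hf.mul (contDiff_varP hU hg hΓ hu hm i j (fun l => sR l m hθ) hh))
        hfc.mul_right
    have i2 : Integrable (fun x => h x * varP g Γ u j m (fun l => entryR u l i f) θ x) :=
      integrable_of_smooth (hh.mul (contDiff_varP hU hg hΓ hu hm j m (fun l => sR l i hf) hθ))
        hhc.mul_right
    have i3 : Integrable (fun x => θ x * varP g Γ u m i (fun l => entryR u l j h) f x) :=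
      integrable_of_smooth (hθ.mul c3) hθc.mul_right
    have i4 : Integrable (fun x => f x * varR u i j (fun k => entryP g Γ u k m θ) h x) :=
      integrable_of_smooth (hf.mul (contDiff_varR hU hU0 hu hm i j (fun k => sP k m hθ) hh))
        hfc.mul_right
    have i5 : Integrable (fun x => h x * varR u j m (fun k => entryP g Γ u k i f) θ x) :=
      integrable_of_smooth (hh.mul (contDiff_varR hU hU0 hu hm j m (fun k => sP k i hf) hθ))
        hhc.mul_right
    have i6 : Integrable (fun x => θ x * varR u m i (fun k => entryP g Γ u k j h) f x) :=
      integrable_of_smooth (hθ.mul c6) hθc.mul_right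
    rw [integral_add_six i1 i2 i3 i4 i5 i6] at H
    have hRc : ∀ l, HasCompactSupport (entryR u l m θ) := fun l => by
      refine HasCompactSupport.deriv (HasCompactSupport.add ?_ ?_)
      · exact hθc.deriv.deriv.mul_left
      · exact HasCompactSupport.deriv hθc.deriv.mul_left
    have e1 : ∫ x, f x * varP g Γ u i j (fun l => entryR u l m θ) h x
        = ∑ l, -∫ x, opB (fun x => coeffS l m (u x)) (fun x => coeffE l m + coeffS m l (u x))
          (adjDir g Γ u i j f h l) x * θ x := by
      rw [integral_mul_varP_dir hU hg hΓ hu hm i j hf hh (fun l => sR l m hθ) hRc]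
      refine Finset.sum_congr rfl fun l _ => ?_
      exact integral_mul_opB (contDiff_const.add (sS m l)) (sS l m)
        (contDiff_adjDir hU hg hΓ hu hm i j hf hh l) hθ hθc
    have e5 : ∫ x, h x * varR u j m (fun k => entryP g Γ u k i f) θ x = -∫ x,
        opB (fun x => ∑ k, pd k (coeffS j m) (u x) * entryP g Γ u k i f x)
          (fun x => ∑ k, pd k (coeffS m j) (u x) * entryP g Γ u k i f x) h x * θ x :=
      integral_mul_opB (sw m j) (sw j m) hh hθ hθc
    rw [e1, e5, integral_mul_varP_arg hU hg hΓ hu hm j m hh (fun l => sR l i hf) hθ hθc,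
      integral_mul_varR_dir hU hU0 hg hΓ hu hm i j m hf hh hhc hθ hθc] at H
    have I : ∀ s : ℝ → ℝ, ContDiff ℝ (⊤ : ℕ∞) s → Integrable (fun x => s x * θ x) := fun s hs =>
      integrable_of_smooth (hs.mul hθ) hθc.mul_left
    have J3 : ∫ x, θ x * varP g Γ u m i (fun l => entryR u l j h) f x
        = ∫ x, varP g Γ u m i (fun l => entryR u l j h) f x * θ x := by
      simp_rw [mul_comm]
    have J6 : ∫ x, θ x * varR u m i (fun k => entryP g Γ u k j h) f x
        = ∫ x, varR u m i (fun k => entryP g Γ u k j h) f x * θ x := by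
      simp_rw [mul_comm]
    rw [J3, J6] at H
    set s1 : ℝ → ℝ := fun x => ∑ l, opB (fun x => coeffS l m (u x))
      (fun x => coeffE l m + coeffS m l (u x)) (adjDir g Γ u i j f h l) x with hs1
    have q1 : ContDiff ℝ (⊤ : ℕ∞) s1 := ContDiff.sum fun l _ => c1 l
    have e1' : ∑ l, -∫ x, opB (fun x => coeffS l m (u x))
        (fun x => coeffE l m + coeffS m l (u x)) (adjDir g Γ u i j f h l) x * θ x
        = ∫ x, (-s1 x) * θ x := by
      simp only [hs1, neg_mul, Finset.sum_mul, integral_neg, Finset.sum_neg_distrib]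
      rw [integral_finsetSum _ fun l _ => I _ (c1 l)]
    rw [e1', ← integral_neg] at H
    simp only [← neg_mul] at H
    rw [← integral_add_six (I _ q1.neg) (I _ c2) (I _ c3) (I _ c4) (I _ c5.neg) (I _ c6)] at H
    rw [← H]
    congr 1
    funext x
    unfold eulerLagrange
    simp only [hs1]
    ring

end

/-! ### Evaluation of the Euler–Lagrange expression on jets -/

/-- The leading coefficient matrix `E + S + Sᵀ` of `R₃⁽³⁾`. -/
noncomputable def coeffA (l i : Fin 2) : Pt → ℝ := fun p =>
  coeffE l i + coeffS i l p + coeffS l i p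

section

variable {U : Set Pt} {g : Contra} {Γ : Conn} {u : ℝ → Pt}

/-- The derivatives up to order four, at a zero of order three of `f`, of a product `f c`. -/
theorem jet_mul_of_triple_zero {f c : ℝ → ℝ} (hf : ContDiff ℝ (⊤ : ℕ∞) f)
    (hc : ContDiff ℝ (⊤ : ℕ∞) c) (h0 : f 0 = 0) (h1 : deriv f 0 = 0)
    (h2 : deriv (deriv f) 0 = 0) :
    deriv (fun x => f x * c x) 0 = 0 ∧ deriv (deriv (fun x => f x * c x)) 0 = 0 ∧
    deriv (deriv (deriv (fun x => f x * c x))) 0 = deriv (deriv (deriv f)) 0 * c 0 ∧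
    deriv (deriv (deriv (deriv (fun x => f x * c x)))) 0
      = deriv (deriv (deriv (deriv f))) 0 * c 0 + 4 * (deriv (deriv (deriv f)) 0 * deriv c 0) := by
  have e1 := deriv_mul_of_smooth hf hc
  have e2 : deriv (deriv (fun x => f x * c x)) = fun x =>
      deriv (deriv f) x * c x + deriv f x * deriv c x
        + (deriv f x * deriv c x + f x * deriv (deriv c) x) := by
    rw [e1, deriv_add_of_smooth (by fun_prop) (by fun_prop),
      deriv_mul_of_smooth (by fun_prop) hc, deriv_mul_of_smooth hf (by fun_prop)]
  have e3 : deriv (deriv (deriv (fun x => f x * c x))) = fun x =>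
      deriv (deriv (deriv f)) x * c x + 3 * (deriv (deriv f) x * deriv c x)
        + (3 * (deriv f x * deriv (deriv c) x) + f x * deriv (deriv (deriv c)) x) := by
    rw [e2, deriv_add_of_smooth (by fun_prop) (by fun_prop),
      deriv_add_of_smooth (by fun_prop) (by fun_prop),
      deriv_add_of_smooth (by fun_prop) (by fun_prop),
      deriv_mul_of_smooth (by fun_prop) hc, deriv_mul_of_smooth hf (by fun_prop),
      deriv_mul_of_smooth (by fun_prop) (by fun_prop)]
    funext x; ring
  have e4 : deriv (deriv (deriv (deriv (fun x => f x * c x)))) = fun x =>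
      deriv (deriv (deriv (deriv f))) x * c x + 4 * (deriv (deriv (deriv f)) x * deriv c x)
        + (6 * (deriv (deriv f) x * deriv (deriv c) x)
          + (4 * (deriv f x * deriv (deriv (deriv c)) x)
            + f x * deriv (deriv (deriv (deriv c))) x)) := by
    rw [e3, deriv_add_of_smooth (by fun_prop) (by fun_prop),
      deriv_add_of_smooth (by fun_prop) (by fun_prop),
      deriv_add_of_smooth (by fun_prop) (by fun_prop),
      deriv_mul_of_smooth (by fun_prop) hc, deriv_mul_of_smooth hf (by fun_prop),
      deriv_mul_of_smooth contDiff_const (by fun_prop),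
      deriv_mul_of_smooth contDiff_const (by fun_prop),
      deriv_mul_of_smooth (by fun_prop) (by fun_prop),
      deriv_mul_of_smooth (by fun_prop) (by fun_prop)]
    funext x; simp only [deriv_const]; ring
  refine ⟨?_, ?_, ?_, ?_⟩
  · rw [e1]; simp [h0, h1]
  · rw [e2]; simp [h0, h1, h2]
  · rw [e3]; simp [h0, h1, h2]
  · rw [e4]; simp [h0, h1, h2]

/-- The identities in the coefficients `g`, `Γ` and their first derivatives at a point which hold
when `g ∂ₓ + Γ uₓ` is compatible with `R₃⁽³⁾`. The numbers `f₃, f₄, h₀, h₁` and the vector `w` are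
the jets of the covectors and of the field at `0`. -/
theorem jet_identity_of_curve (hU : IsOpen U) (hU0 : ∀ p ∈ U, p 0 ≠ 0)
    (hc : CompatibleR33 U g Γ) (hu : ContDiff ℝ (⊤ : ℕ∞) u) (hm : ∀ x, u x ∈ U)
    {f h : ℝ → ℝ} (hf : ContDiff ℝ (⊤ : ℕ∞) f) (hfc : HasCompactSupport f)
    (hh : ContDiff ℝ (⊤ : ℕ∞) h) (hhc : HasCompactSupport h)
    (jf0 : f 0 = 0) (jf1 : deriv f 0 = 0) (jf2 : deriv (deriv f) 0 = 0) {f3 f4 h0 h1 : ℝ}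
    (jf3 : deriv (deriv (deriv f)) 0 = f3) (jf4 : deriv (deriv (deriv (deriv f))) 0 = f4)
    (jh0 : h 0 = h0) (jh1 : deriv h 0 = h1) (jh2 : deriv (deriv h) 0 = 0)
    (jh3 : deriv (deriv (deriv h)) 0 = 0) {p : Pt} (ju0 : u 0 = p) {w : Fin 2 → ℝ}
    (ju1 : ∀ k, deriv (fun y => u y k) 0 = w k) (i j m : Fin 2) :
    -(∑ l, (coeffA l m p * (f3 * (pd l (fun v => g v i j) p * h1
            + (∑ k, pd l (fun v => Γ v i j k) p * w k) * h0)
          - (f4 * (h0 * Γ p i j l)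
            + 4 * (f3 * (h1 * Γ p i j l + h0 * ∑ k, pd k (fun v => Γ v i j l) p * w k))))
        - ((∑ k, pd k (coeffS l m) p * w k) + 2 * ∑ k, pd k (coeffS m l) p * w k)
          * (f3 * (h0 * Γ p i j l))))
    + (-(∑ l, (h1 * (pd l (fun v => g v j m) p * (coeffA l i p * f3))
          + h0 * ((∑ k, pd k (pd l (fun v => g v j m)) p * w k) * (coeffA l i p * f3)
            + pd l (fun v => g v j m) p * (coeffA l i p * f4
              + (2 * (∑ k, pd k (coeffS i l) p * w k) + 3 * ∑ k, pd k (coeffS l i) p * w k) * f3))))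
      + h0 * ∑ k, ((∑ l, pd l (fun v => Γ v j m k) p * (coeffA l i p * f3)) * w k
        + Γ p j m k * (coeffA k i p * f4
              + (2 * (∑ n, pd n (coeffS i k) p * w n) + 3 * ∑ n, pd n (coeffS k i) p * w n) * f3)))
    - (∑ k, g p k m * (pd k (coeffS i j) p * (f3 * h1)))
    - (∑ k, pd k (coeffS m j) p * (g p k i * f3)) * h1
    + (∑ k, (pd k (coeffS i m) p + pd k (coeffS m i) p)
        * (g p k j * h1 + (∑ n, Γ p k j n * w n) * h0)) * f3 = 0 := by
  have hg := hc.smooth_g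
  have hΓ := hc.smooth_Γ
  obtain ⟨G, C, eG, eC, sG, sC⟩ := exists_coeff_along hg hΓ hu hm
  have sg' := fun l i j => contDiff_comp_curve (contDiffOn_pd hU (hg i j) l) hu hm
  have su := fun n => contDiff_top_deriv (contDiff_coord hu n)
  have sC' := fun l i j n => contDiff_comp_curve (contDiffOn_pd hU (hΓ i j n) l) hu hm
  have sS := contDiff_coeffS_along hU0 hu hm
  have sS' := contDiff_pd_coeffS hU hU0 hu hm
  have dS : ∀ a b, deriv (fun x => coeffS a b (u x)) 0 = ∑ k, pd k (coeffS a b) p * w k := by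
    intro a b
    rw [deriv_comp_curve (U := U) hU ((contDiffOn_coeffS a b).mono fun p hp => hU0 p hp) hu hm]
    simp only [ju0, ju1]
  have dC : ∀ i j k, deriv (C i j k) 0 = ∑ n, pd n (fun v => Γ v i j k) p * w n := by
    intro i j k
    have : C i j k = fun x => (fun v => Γ v i j k) (u x) := funext fun x => (eC i j k x).symm
    rw [this, deriv_comp_curve hU (hΓ i j k) hu hm]
    simp only [ju0, ju1]
  have dg : ∀ i j l, deriv (fun x => pd l (fun v => g v i j) (u x)) 0
      = ∑ k, pd k (pd l (fun v => g v i j)) p * w k := by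
    intro i j l
    rw [deriv_comp_curve hU (contDiffOn_pd hU (hg i j) l) hu hm]
    simp only [ju0, ju1]
  have C0 : ∀ i j k, C i j k 0 = Γ p i j k := fun i j k => by rw [← eC, ju0]
  have G0 : ∀ i j, G i j 0 = g p i j := fun i j => by rw [← eG, ju0]
  -- the jets of the components of `R₃⁽³⁾ (f e_i)`
  have r0 : ∀ l, entryR u l i f 0 = coeffA l i p * f3 := by
    intro l
    unfold entryR
    rw [opB_apply (contDiff_const.add (sS i l)) (sS l i) hf]
    simp only [jf1, jf2, jf3, ju0, coeffA]; ring
  have r1 : ∀ l, deriv (entryR u l i f) 0 = coeffA l i p * f4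
      + (2 * (∑ k, pd k (coeffS i l) p * w k) + 3 * ∑ k, pd k (coeffS l i) p * w k) * f3 := by
    intro l
    have a1 := sS i l
    have a2 := sS l i
    unfold entryR
    rw [opB_apply (contDiff_const.add (sS i l)) (sS l i) hf,
      deriv_add_of_smooth (by fun_prop) (by fun_prop),
      deriv_add_of_smooth (by fun_prop) (by fun_prop),
      deriv_mul_of_smooth (by fun_prop) (by fun_prop),
      deriv_mul_of_smooth (by fun_prop) (by fun_prop),
      deriv_mul_of_smooth (by fun_prop) (by fun_prop),
      deriv_add_of_smooth (by fun_prop) (by fun_prop),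
      deriv_add_of_smooth contDiff_const (by fun_prop)]
    simp only [jf1, jf2, jf3, jf4, ju0, coeffA, dS, deriv_const]; ring
  -- the jets of the variational derivative in the direction of the variation
  have X : ∀ l, deriv (adjDir g Γ u i j f h l) 0 = 0 ∧
      deriv (deriv (adjDir g Γ u i j f h l)) 0 = -(f3 * (h0 * Γ p i j l)) ∧
      deriv (deriv (deriv (adjDir g Γ u i j f h l))) 0
        = f3 * (pd l (fun v => g v i j) p * h1
            + (∑ k, pd l (fun v => Γ v i j k) p * w k) * h0)
          - (f4 * (h0 * Γ p i j l)
            + 4 * (f3 * (h1 * Γ p i j l + h0 * ∑ k, pd k (fun v => Γ v i j l) p * w k))) := by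
    intro l
    have sN : ContDiff ℝ (⊤ : ℕ∞) (fun x => pd l (fun v => g v i j) (u x) * deriv h x
      + (∑ k, pd l (fun v => Γ v i j k) (u x) * deriv (fun y => u y k) x) * h x) := by
      fun_prop
    have sQ : ContDiff ℝ (⊤ : ℕ∞) (fun x => h x * C i j l x) := by fun_prop
    obtain ⟨n1, n2, n3, -⟩ := jet_mul_of_triple_zero hf sN jf0 jf1 jf2
    obtain ⟨-, q2, q3, q4⟩ := jet_mul_of_triple_zero hf sQ jf0 jf1 jf2
    have e : adjDir g Γ u i j f h l = fun x => f x * (pd l (fun v => g v i j) (u x) * deriv h x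
      + (∑ k, pd l (fun v => Γ v i j k) (u x) * deriv (fun y => u y k) x) * h x)
        - deriv (fun y => f y * (h y * C i j l y)) x := by
      unfold adjDir; simp only [eC]
    rw [e, deriv_sub_of_smooth (by fun_prop) (by fun_prop),
      deriv_sub_of_smooth (by fun_prop) (by fun_prop),
      deriv_sub_of_smooth (by fun_prop) (by fun_prop)]
    refine ⟨?_, ?_, ?_⟩
    · simp only [n1, q2]; ring
    · simp only [n2, q3, jf3, jh0, C0]; ring
    · simp only [n3, q4, jf3, jf4, jh0, jh1, C0, ju0, ju1]
      rw [deriv_mul_of_smooth hh (sC i j l)]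
      simp only [jh0, jh1, C0, dC]
  have sX := fun l => contDiff_adjDir hU hg hΓ hu hm i j hf hh l
  have t1 : ∀ l, opB (fun x => coeffS l m (u x)) (fun x => coeffE l m + coeffS m l (u x))
      (adjDir g Γ u i j f h l) 0 = coeffA l m p * (f3 * (pd l (fun v => g v i j) p * h1
            + (∑ k, pd l (fun v => Γ v i j k) p * w k) * h0)
          - (f4 * (h0 * Γ p i j l)
            + 4 * (f3 * (h1 * Γ p i j l + h0 * ∑ k, pd k (fun v => Γ v i j l) p * w k))))
        - ((∑ k, pd k (coeffS l m) p * w k) + 2 * ∑ k, pd k (coeffS m l) p * w k)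
          * (f3 * (h0 * Γ p i j l)) := by
    intro l
    obtain ⟨x1, x2, x3⟩ := X l
    rw [opB_apply (sS l m) (contDiff_const.add (sS m l)) (sX l),
      deriv_add_of_smooth contDiff_const (sS m l)]
    simp only [x1, x2, x3, dS, ju0, coeffA, deriv_const]; ring
  have sr := fun l => contDiff_entryR hU0 hu hm l i hf
  have t2 : adjArg g Γ u j m h (fun l => entryR u l i f) 0 =
      -(∑ l, (h1 * (pd l (fun v => g v j m) p * (coeffA l i p * f3))
          + h0 * ((∑ k, pd k (pd l (fun v => g v j m)) p * w k) * (coeffA l i p * f3)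
            + pd l (fun v => g v j m) p * (coeffA l i p * f4
              + (2 * (∑ k, pd k (coeffS i l) p * w k) + 3 * ∑ k, pd k (coeffS l i) p * w k) * f3))))
      + h0 * ∑ k, ((∑ l, pd l (fun v => Γ v j m k) p * (coeffA l i p * f3)) * w k
        + Γ p j m k * (coeffA k i p * f4
              + (2 * (∑ n, pd n (coeffS i k) p * w n)
                + 3 * ∑ n, pd n (coeffS k i) p * w n) * f3)) := by
    unfold adjArg
    rw [deriv_fun_sum fun l _ => by
      have : ContDiff ℝ (⊤ : ℕ∞)
          (fun y => h y * (pd l (fun v => g v j m) (u y) * entryR u l i f y)) := by fun_prop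
      exact this.differentiable (by simp) 0]
    congr 1
    · congr 1
      refine Finset.sum_congr rfl fun l _ => ?_
      rw [deriv_mul_of_smooth hh (by fun_prop), deriv_mul_of_smooth (sg' l j m) (sr l)]
      simp only [jh0, jh1, r0, r1, dg, ju0]
    · simp only [jh0, r0, r1, ju0, ju1]
  have t3 : varP g Γ u m i (fun l => entryR u l j h) f 0 = 0 := by
    unfold varP; simp only [jf0, jf1]; ring
  have t4 : adjP g Γ u m (adjCoeff u i j f h) 0
      = -(∑ k, g p k m * (pd k (coeffS i j) p * (f3 * h1))) := by
    have z0 : ∀ k, adjCoeff u i j f h k 0 = 0 := fun k => by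
      unfold adjCoeff; simp only [jf1, jf2]; ring
    have sZ : ∀ k, ContDiff ℝ (⊤ : ℕ∞) (adjCoeff u i j f h k) := fun k => by
      unfold adjCoeff; fun_prop
    have z1 : ∀ k, deriv (adjCoeff u i j f h k) 0 = pd k (coeffS i j) p * (f3 * h1) := by
      intro k
      have a1 := sS' i j k
      have a2 := sS' j i k
      unfold adjCoeff
      rw [deriv_sub_of_smooth (by fun_prop) (by fun_prop),
        deriv_mul_of_smooth a1 (by fun_prop), deriv_mul_of_smooth a2 (by fun_prop),
        deriv_mul_of_smooth (by fun_prop) (by fun_prop),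
        deriv_mul_of_smooth (by fun_prop) (by fun_prop)]
      simp only [jf1, jf2, jf3, jh1, jh2, ju0]; ring
    unfold adjP
    simp only [eG, z0]
    rw [deriv_fun_sum fun k _ => ((sG k m).mul (sZ k)).differentiable (by simp) 0]
    simp only [mul_zero, Finset.sum_const_zero, add_zero, neg_inj]
    refine Finset.sum_congr rfl fun k _ => ?_
    rw [deriv_mul_of_smooth (sG k m) (sZ k)]
    simp only [z0, z1, G0]; ring
  have sw : ∀ a b, ContDiff ℝ (⊤ : ℕ∞)
      (fun x => ∑ k, pd k (coeffS a b) (u x) * entryP g Γ u k i f x) := fun a b => by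
    have := fun k => contDiff_entryP hg hΓ hu hm k i hf
    fun_prop
  have t5 : opB (fun x => ∑ k, pd k (coeffS j m) (u x) * entryP g Γ u k i f x)
      (fun x => ∑ k, pd k (coeffS m j) (u x) * entryP g Γ u k i f x) h 0
      = (∑ k, pd k (coeffS m j) p * (g p k i * f3)) * h1 := by
    rw [opB_apply (sw j m) (sw m j) hh]
    simp only [jh1, jh2, jh3, mul_zero, zero_add]
    congr 1
    have e : (fun x => ∑ k, pd k (coeffS m j) (u x) * entryP g Γ u k i f x) = fun x =>
        deriv f x * (∑ k, pd k (coeffS m j) (u x) * G k i x)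
          + f x * (∑ k, pd k (coeffS m j) (u x)
            * ∑ n, C k i n x * deriv (fun y => u y n) x) := by
      funext x
      unfold entryP
      simp only [eG, eC, Fin.sum_univ_two]; ring
    have b1 : ContDiff ℝ (⊤ : ℕ∞) (fun x => ∑ k, pd k (coeffS m j) (u x) * G k i x) := by
      fun_prop
    have b2 : ContDiff ℝ (⊤ : ℕ∞) (fun x => ∑ k, pd k (coeffS m j) (u x)
            * ∑ n, C k i n x * deriv (fun y => u y n) x) := by fun_prop
    rw [e, deriv_add_of_smooth (by fun_prop) (by fun_prop),
      deriv_add_of_smooth (by fun_prop) (by fun_prop)]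
    beta_reduce
    rw [(jet_mul_of_triple_zero hf b2 jf0 jf1 jf2).2.1,
      deriv_mul_of_smooth (by fun_prop) b1, deriv_add_of_smooth (by fun_prop) (by fun_prop),
      deriv_mul_of_smooth (by fun_prop) b1, deriv_mul_of_smooth (by fun_prop) (by fun_prop)]
    simp only [jf1, jf2, jf3, G0, ju0, Fin.sum_univ_two]; ring
  have t6 : varR u m i (fun k => entryP g Γ u k j h) f 0
      = (∑ k, (pd k (coeffS i m) p + pd k (coeffS m i) p)
        * (g p k j * h1 + (∑ n, Γ p k j n * w n) * h0)) * f3 := by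
    have := fun k => contDiff_entryP hg hΓ hu hm k j hh
    unfold varR
    rw [opB_apply (by fun_prop) (by fun_prop) hf]
    simp only [jf1, jf2, jf3, entryP, jh0, jh1, ju0, ju1, Fin.sum_univ_two]; ring
  have H := eulerLagrange_eq_zero hU hU0 hc hu hm i j m hf hfc hh hhc 0
  unfold eulerLagrange at H
  simp only [t1] at H
  rw [t2, t3, t4, t5, t6] at H
  rw [← H]
  ring

end

theorem deriv_quartic (a b c d e : ℝ) :
    deriv (fun x : ℝ => a + b * x + c * x ^ 2 + d * x ^ 3 + e * x ^ 4)
      = fun x => b + (2 * c) * x + (3 * d) * x ^ 2 + (4 * e) * x ^ 3 + 0 * x ^ 4 := by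
  funext x
  refine HasDerivAt.deriv ?_
  have h := ((((hasDerivAt_const x a).add ((hasDerivAt_id x).const_mul b)).add
    ((hasDerivAt_pow 2 x).const_mul c)).add ((hasDerivAt_pow 3 x).const_mul d)).add
    ((hasDerivAt_pow 4 x).const_mul e)
  refine h.congr_deriv ?_
  push_cast; ring

/-- There are test functions with any prescribed jet of order four at `0`. -/
theorem exists_test_jet (a b c d e : ℝ) : ∃ f : ℝ → ℝ, ContDiff ℝ (⊤ : ℕ∞) f ∧
    HasCompactSupport f ∧ f 0 = a ∧ deriv f 0 = b ∧ deriv (deriv f) 0 = c ∧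
    deriv (deriv (deriv f)) 0 = d ∧ deriv (deriv (deriv (deriv f))) 0 = e := by
  let χ : ContDiffBump (0 : ℝ) := ⟨1, 2, one_pos, one_lt_two⟩
  set q : ℝ → ℝ := fun x => a + b * x + (c / 2) * x ^ 2 + (d / 6) * x ^ 3 + (e / 24) * x ^ 4
    with hq
  have hs : ContDiff ℝ (⊤ : ℕ∞) q := by fun_prop
  have e0 : (fun x => χ x * q x) =ᶠ[nhds 0] q := by
    filter_upwards [χ.eventuallyEq_one] with x hx
    rw [hx]; simp
  have e1 := e0.deriv
  have e2 := e1.deriv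
  have e3 := e2.deriv
  have e4 := e3.deriv
  refine ⟨fun x => χ x * q x, χ.contDiff.mul hs, χ.hasCompactSupport.mul_right, ?_, ?_, ?_, ?_, ?_⟩
  · exact e0.eq_of_nhds.trans (by simp [hq])
  · rw [e1.eq_of_nhds, hq, deriv_quartic]; simp
  · rw [e2.eq_of_nhds, hq, deriv_quartic, deriv_quartic]; simp; ring
  · rw [e3.eq_of_nhds, hq, deriv_quartic, deriv_quartic, deriv_quartic]; simp; ring
  · rw [e4.eq_of_nhds, hq, deriv_quartic, deriv_quartic, deriv_quartic, deriv_quartic]; simp; ring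

/-- There are fields with values in an open set and any prescribed first-order jet at `0`. -/
theorem exists_field_jet {U : Set Pt} (hU : IsOpen U) {p : Pt} (hp : p ∈ U) (w : Pt) :
    ∃ u : ℝ → Pt, ContDiff ℝ (⊤ : ℕ∞) u ∧ (∀ x, u x ∈ U) ∧ u 0 = p ∧
      ∀ k, deriv (fun y => u y k) 0 = w k := by
  obtain ⟨ε, hε, hb⟩ := Metric.isOpen_iff.1 hU p hp
  have hw : 0 < ‖w‖ + 1 := by positivity
  have hr : 0 < ε / (‖w‖ + 1) := by positivity
  let χ : ContDiffBump (0 : ℝ) := ⟨ε / (‖w‖ + 1) / 2, ε / (‖w‖ + 1), by positivity, by linarith⟩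
  have hs : ContDiff ℝ (⊤ : ℕ∞) (fun x : ℝ => χ x * x) := χ.contDiff.mul contDiff_id
  refine ⟨fun x => p + (χ x * x) • w, contDiff_const.add (hs.smul contDiff_const), ?_, by simp, ?_⟩
  · intro x
    apply hb
    rw [Metric.mem_ball, dist_eq_norm, add_sub_cancel_left, norm_smul]
    have hle : ‖χ x * x‖ ≤ ε / (‖w‖ + 1) := by
      by_cases hx : |x| < ε / (‖w‖ + 1)
      · rw [norm_mul, Real.norm_eq_abs, Real.norm_eq_abs, abs_of_nonneg χ.nonneg]
        calc χ x * |x| ≤ 1 * |x| := by gcongr; exact χ.le_one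
          _ ≤ _ := by rw [one_mul]; exact hx.le
      · have : χ x = 0 := χ.zero_of_le_dist (by
          simpa [Real.dist_eq] using not_lt.1 hx)
        rw [this]; simpa using hr.le
    calc ‖χ x * x‖ * ‖w‖ ≤ ε / (‖w‖ + 1) * ‖w‖ := by gcongr
      _ < ε / (‖w‖ + 1) * (‖w‖ + 1) := by gcongr; linarith
      _ = ε := by field_simp
  · intro k
    have e : (fun y => (p + (χ y * y) • w) k) =ᶠ[nhds 0] fun y => p k + y * w k := by
      filter_upwards [χ.eventuallyEq_one] with y hy
      simp [hy]
    rw [e.deriv_eq]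
    simp

/-- `jet_identity_of_curve` with all jets prescribed freely. -/
theorem jet_identity {U : Set Pt} {g : Contra} {Γ : Conn} (hU : IsOpen U)
    (hU0 : ∀ p ∈ U, p 0 ≠ 0) (hc : CompatibleR33 U g Γ) {p : Pt} (hp : p ∈ U)
    (f3 f4 h0 h1 : ℝ) (w : Pt) (i j m : Fin 2) :
    -(∑ l, (coeffA l m p * (f3 * (pd l (fun v => g v i j) p * h1
            + (∑ k, pd l (fun v => Γ v i j k) p * w k) * h0)
          - (f4 * (h0 * Γ p i j l)
            + 4 * (f3 * (h1 * Γ p i j l + h0 * ∑ k, pd k (fun v => Γ v i j l) p * w k))))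
        - ((∑ k, pd k (coeffS l m) p * w k) + 2 * ∑ k, pd k (coeffS m l) p * w k)
          * (f3 * (h0 * Γ p i j l))))
    + (-(∑ l, (h1 * (pd l (fun v => g v j m) p * (coeffA l i p * f3))
          + h0 * ((∑ k, pd k (pd l (fun v => g v j m)) p * w k) * (coeffA l i p * f3)
            + pd l (fun v => g v j m) p * (coeffA l i p * f4
              + (2 * (∑ k, pd k (coeffS i l) p * w k) + 3 * ∑ k, pd k (coeffS l i) p * w k) * f3))))
      + h0 * ∑ k, ((∑ l, pd l (fun v => Γ v j m k) p * (coeffA l i p * f3)) * w k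
        + Γ p j m k * (coeffA k i p * f4
              + (2 * (∑ n, pd n (coeffS i k) p * w n) + 3 * ∑ n, pd n (coeffS k i) p * w n) * f3)))
    - (∑ k, g p k m * (pd k (coeffS i j) p * (f3 * h1)))
    - (∑ k, pd k (coeffS m j) p * (g p k i * f3)) * h1
    + (∑ k, (pd k (coeffS i m) p + pd k (coeffS m i) p)
        * (g p k j * h1 + (∑ n, Γ p k j n * w n) * h0)) * f3 = 0 := by
  obtain ⟨f, sf, cf, a0, a1, a2, a3, a4⟩ := exists_test_jet 0 0 0 f3 f4
  obtain ⟨h, sh, ch, b0, b1, b2, b3, -⟩ := exists_test_jet h0 h1 0 0 0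
  obtain ⟨u, su, mu, u0, u1⟩ := exists_field_jet hU hp w
  exact jet_identity_of_curve hU hU0 hc su mu sf cf sh ch a0 a1 a2 a3 a4 b0 b1 b2 b3 u0 u1 i j m

/-- The identities of order zero in the derivative of the field, with the second covector
constant. -/
theorem compat_zeroth {U : Set Pt} {g : Contra} {Γ : Conn} (hU : IsOpen U)
    (hU0 : ∀ p ∈ U, p 0 ≠ 0) (hc : CompatibleR33 U g Γ) {p : Pt} (hp : p ∈ U) (i j m : Fin 2) :
    ∑ l, coeffA l m p * Γ p i j l
      + ∑ l, coeffA l i p * (Γ p j m l - pd l (fun v => g v j m) p) = 0 := by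
  have h := jet_identity hU hU0 hc hp 0 1 1 0 0 i j m
  simp only [Fin.sum_univ_two] at h ⊢
  linear_combination h

/-- The identities of order zero in the derivative of the field, with the second covector linear.
-/
theorem compat_first {U : Set Pt} {g : Contra} {Γ : Conn} (hU : IsOpen U)
    (hU0 : ∀ p ∈ U, p 0 ≠ 0) (hc : CompatibleR33 U g Γ) {p : Pt} (hp : p ∈ U) (i j m : Fin 2) :
    -∑ l, coeffA l m p * (pd l (fun v => g v i j) p - 4 * Γ p i j l)
      - ∑ l, coeffA l i p * pd l (fun v => g v j m) p
      - ∑ k, g p k m * pd k (coeffS i j) p - ∑ k, pd k (coeffS m j) p * g p k i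
      + ∑ k, (pd k (coeffS i m) p + pd k (coeffS m i) p) * g p k j = 0 := by
  have h := jet_identity hU hU0 hc hp 1 0 0 1 0 i j m
  simp only [Fin.sum_univ_two] at h ⊢
  simp only [Pi.zero_apply] at h
  linear_combination h

/-- The identities of first order in the derivative of the field. -/
theorem compat_second {U : Set Pt} {g : Contra} {Γ : Conn} (hU : IsOpen U)
    (hU0 : ∀ p ∈ U, p 0 ≠ 0) (hc : CompatibleR33 U g Γ) {p : Pt} (hp : p ∈ U)
    (i j m k : Fin 2) :
    -(∑ l, (coeffA l m p * (pd l (fun v => Γ v i j k) p - 4 * pd k (fun v => Γ v i j l) p)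
        - (pd k (coeffS l m) p + 2 * pd k (coeffS m l) p) * Γ p i j l))
    - (∑ l, (pd k (pd l (fun v => g v j m)) p * coeffA l i p
            + pd l (fun v => g v j m) p * (2 * pd k (coeffS i l) p + 3 * pd k (coeffS l i) p)))
    + ∑ l, (pd l (fun v => Γ v j m k) p * coeffA l i p
        + Γ p j m l * (2 * pd k (coeffS i l) p + 3 * pd k (coeffS l i) p))
    + ∑ l, (pd l (coeffS i m) p + pd l (coeffS m i) p) * Γ p l j k = 0 := by
  have h := jet_identity hU hU0 hc hp 1 0 1 0 (Pi.single k 1) i j m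
  simp only [Fin.sum_univ_two] at h ⊢
  fin_cases k <;> simp at h ⊢ <;> linear_combination h

/-! ### A small calculus of partial derivatives -/

theorem pd_congr {U : Set Pt} (hU : IsOpen U) {f h : Pt → ℝ} (e : ∀ p ∈ U, f p = h p) {p : Pt}
    (hp : p ∈ U) (k : Fin 2) : pd k f p = pd k h p := by
  have : f =ᶠ[nhds p] h := by
    filter_upwards [hU.mem_nhds hp] with q hq using e q hq
  exact this.lineDeriv_eq

/-- `f` has partial derivative `f'` in the direction `k` at `p`. -/
def HasPd (k : Fin 2) (f : Pt → ℝ) (f' : ℝ) (p : Pt) : Prop :=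
  HasDerivAt (fun t : ℝ => f (p + t • Pi.single k 1)) f' 0

namespace HasPd

variable {k : Fin 2} {f h : Pt → ℝ} {f' h' : ℝ} {p : Pt}

theorem pd_eq (hf : HasPd k f f' p) : pd k f p = f' := hf.deriv

theorem of_contDiffOn {U : Set Pt} (hU : IsOpen U) (hf : ContDiffOn ℝ (⊤ : ℕ∞) f U) (hp : p ∈ U)
    (k : Fin 2) : HasPd k f (pd k f p) p :=
  (((hf.contDiffAt (hU.mem_nhds hp)).differentiableAt (by simp)).lineDifferentiableAt
    (v := Pi.single k 1)).hasLineDerivAt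

theorem const (c : ℝ) : HasPd k (fun _ => c) 0 p := hasDerivAt_const _ _

theorem coord (k l : Fin 2) (p : Pt) : HasPd k (fun q => q l) (if l = k then 1 else 0) p := by
  have h := ((hasDerivAt_id (0 : ℝ)).mul_const ((Pi.single k 1 : Pt) l)).const_add (p l)
  unfold HasPd
  simpa [Pi.single_apply] using h

theorem add (hf : HasPd k f f' p) (hh : HasPd k h h' p) :
    HasPd k (fun q => f q + h q) (f' + h') p := HasDerivAt.fun_add hf hh

theorem sub (hf : HasPd k f f' p) (hh : HasPd k h h' p) :
    HasPd k (fun q => f q - h q) (f' - h') p := HasDerivAt.fun_sub hf hh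

theorem neg (hf : HasPd k f f' p) : HasPd k (fun q => -f q) (-f') p := HasDerivAt.fun_neg hf

theorem mul (hf : HasPd k f f' p) (hh : HasPd k h h' p) :
    HasPd k (fun q => f q * h q) (f' * h p + f p * h') p := by
  have := HasDerivAt.fun_mul hf hh
  simpa [HasPd] using this

theorem div (hf : HasPd k f f' p) (hh : HasPd k h h' p) (h0 : h p ≠ 0) :
    HasPd k (fun q => f q / h q) ((f' * h p - f p * h') / h p ^ 2) p := by
  have := HasDerivAt.fun_div hf hh (by simpa using h0)
  simpa [HasPd] using this

theorem pow (hf : HasPd k f f' p) (n : ℕ) :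
    HasPd k (fun q => f q ^ n) (n * f p ^ (n - 1) * f') p := by
  have := HasDerivAt.fun_pow hf n
  simpa [HasPd] using this

theorem const_mul (c : ℝ) (hf : HasPd k f f' p) : HasPd k (fun q => c * f q) (c * f') p :=
  HasDerivAt.const_mul c hf

theorem congr_val {f'' : ℝ} (hf : HasPd k f f' p) (e : f' = f'') : HasPd k f f'' p := e ▸ hf

end HasPd

theorem eq_of_pd_eq_zero {U : Set Pt} (hU : IsOpen U) (hc : IsPreconnected U) {f : Pt → ℝ}
    (hf : ContDiffOn ℝ (⊤ : ℕ∞) f U) (h0 : ∀ k, ∀ p ∈ U, pd k f p = 0) {p q : Pt} (hp : p ∈ U)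
    (hq : q ∈ U) : f p = f q := by
  refine hU.is_const_of_fderiv_eq_zero hc (hf.differentiableOn (by simp)) ?_ hp hq
  intro x hx
  have hd := (hf.contDiffAt (hU.mem_nhds hx)).differentiableAt (by simp)
  ext v
  have : v = ∑ k, v k • (Pi.single k 1 : Pt) := by
    ext i; simp [Finset.sum_apply, Pi.single_apply]
  rw [this]
  have e0 := h0 0 x hx
  have e1 := h0 1 x hx
  rw [pd_eq_fderiv hd] at e0 e1
  simp [e0, e1]

/-! ### The coefficients of `R₃⁽³⁾` -/

theorem coeffA_val (p : Pt) : coeffA 0 0 p = 1 ∧ coeffA 0 1 p = p 1 / p 0 ∧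
    coeffA 1 0 p = p 1 / p 0 ∧ coeffA 1 1 p = ((p 1) ^ 2 + 1) / (p 0) ^ 2 := by
  refine ⟨by simp [coeffA, coeffE, coeffS], by simp [coeffA, coeffE, coeffS],
    by simp [coeffA, coeffE, coeffS], ?_⟩
  simp only [coeffA, coeffE, coeffS]
  simp
  rw [← add_div, ← two_mul, mul_div_mul_left _ _ two_ne_zero]

theorem pd_coeffS (p : Pt) (hp : p 0 ≠ 0) :
    (∀ k l, pd k (coeffS l 0) p = 0) ∧
    pd 0 (coeffS 0 1) p = -(p 1 / p 0 ^ 2) ∧ pd 1 (coeffS 0 1) p = 1 / p 0 ∧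
    pd 0 (coeffS 1 1) p = -(((p 1) ^ 2 + 1) / p 0 ^ 3) ∧
    pd 1 (coeffS 1 1) p = p 1 / p 0 ^ 2 := by
  have e1 : coeffS 0 1 = fun u => u 1 / u 0 := by funext u; simp [coeffS]
  have e2 : coeffS 1 1 = fun u => (u 1 ^ 2 + 1) / (2 * u 0 ^ 2) := by funext u; simp [coeffS]
  have hp2 : 2 * p 0 ^ 2 ≠ 0 := mul_ne_zero two_ne_zero (pow_ne_zero 2 hp)
  have d1 := fun k => (HasPd.coord k 1 p).div (HasPd.coord k 0 p) hp
  have d2 := fun k => (((HasPd.coord k 1 p).pow 2).add (HasPd.const 1)).div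
    (((HasPd.coord k 0 p).pow 2).const_mul 2) hp2
  refine ⟨?_, ?_, ?_, ?_, ?_⟩
  · intro k l
    have : coeffS l 0 = fun _ => 0 := by funext u; simp [coeffS]
    rw [this]; exact (HasPd.const 0).pd_eq
  · rw [e1]; refine ((d1 0).congr_val ?_).pd_eq; simp; field_simp
  · rw [e1]; refine ((d1 1).congr_val ?_).pd_eq; simp; field_simp
  · rw [e2]; refine ((d2 0).congr_val ?_).pd_eq; simp; field_simp
  · rw [e2]; refine ((d2 1).congr_val ?_).pd_eq; simp; field_simp

/-! ### The system of differential equations for `g` -/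

section

variable {U : Set Pt} {g : Contra} {Γ : Conn}

/-- The coefficients `Γ` of a compatible operator are determined by `g`. -/
theorem Gamma_of_compatible (hU : IsOpen U) (hU0 : ∀ p ∈ U, p 0 ≠ 0) (hc : CompatibleR33 U g Γ)
    {p : Pt} (hp : p ∈ U) :
    (∀ k, Γ p 0 0 k = 1 / 2 * pd k (fun v => g v 0 0) p) ∧
    (∀ k, Γ p 1 1 k = 1 / 2 * pd k (fun v => g v 1 1) p) ∧
    Γ p 0 1 0 = 1 / 2 * (pd 0 (fun v => g v 0 1) p + g p 0 1 / p 0) ∧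
    Γ p 0 1 1 = 1 / 2 * (pd 1 (fun v => g v 0 1) p - g p 0 0 / p 0) ∧
    Γ p 1 0 0 = 1 / 2 * (pd 0 (fun v => g v 0 1) p - g p 0 1 / p 0) ∧
    Γ p 1 0 1 = 1 / 2 * (pd 1 (fun v => g v 0 1) p + g p 0 0 / p 0) ∧
    pd 0 (fun v => g v 0 1) p + p 1 / p 0 * pd 1 (fun v => g v 0 1) p
      - p 1 / p 0 * pd 0 (fun v => g v 0 0) p
      - (p 1 ^ 2 + 1) / p 0 ^ 2 * pd 1 (fun v => g v 0 0) p
      + p 1 / p 0 ^ 2 * g p 0 0 - g p 0 1 / p 0 = 0 ∧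
    p 1 / p 0 * pd 0 (fun v => g v 0 1) p
      + (p 1 ^ 2 + 1) / p 0 ^ 2 * pd 1 (fun v => g v 0 1) p - pd 0 (fun v => g v 1 1) p
      - p 1 / p 0 * pd 1 (fun v => g v 1 1) p - (p 1 ^ 2 + 1) / p 0 ^ 3 * g p 0 0
      + p 1 / p 0 ^ 2 * g p 0 1 = 0 := by
  have x0 := hU0 p hp
  have hs : g p 1 0 = g p 0 1 := (hc.symm p hp).apply 0 1
  have hsd : ∀ k, pd k (fun v => g v 1 0) p = pd k (fun v => g v 0 1) p := fun k =>
    pd_congr hU (fun q hq => (hc.symm q hq).apply 0 1) hp k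
  obtain ⟨A00, A01, A10, A11⟩ := coeffA_val p
  obtain ⟨s0, s1, s2, s3, s4⟩ := pd_coeffS p x0
  have I := fun i j m => compat_zeroth hU hU0 hc hp i j m
  have hat : ∀ j m i, 2 * ∑ l, coeffA l i p * Γ p j m l
      = ∑ l, coeffA l i p * pd l (fun v => g v j m) p
        + ∑ l, coeffA l j p * pd l (fun v => g v m i) p
        - ∑ l, coeffA l m p * pd l (fun v => g v i j) p := by
    intro j m i
    have i1 := I i j m
    have i2 := I j m i
    have i3 := I m i j
    simp only [Fin.sum_univ_two] at i1 i2 i3 ⊢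
    linear_combination i1 + i2 - i3
  have J1 := compat_first hU hU0 hc hp 0 1 0
  have J2 := compat_first hU hU0 hc hp 1 0 1
  have a010 := hat 0 1 0
  have a011 := hat 0 1 1
  have a100 := hat 1 0 0
  have a101 := hat 1 0 1
  have a000 := hat 0 0 0
  have a001 := hat 0 0 1
  have a110 := hat 1 1 0
  have a111 := hat 1 1 1
  simp only [Fin.sum_univ_two, A00, A01, A10, A11, s0, s1, s2, s3, s4, hs, hsd] at *
  set x := p 0
  set y := p 1
  have r1 : pd 0 (fun v => g v 0 1) p + y / x * pd 1 (fun v => g v 0 1) p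
      - y / x * pd 0 (fun v => g v 0 0) p
      - (y ^ 2 + 1) / x ^ 2 * pd 1 (fun v => g v 0 0) p
      + y / x ^ 2 * g p 0 0 - g p 0 1 / x = 0 := by
    linear_combination (1 / 2) * J1 - a010
  have r2 : y / x * pd 0 (fun v => g v 0 1) p
      + (y ^ 2 + 1) / x ^ 2 * pd 1 (fun v => g v 0 1) p - pd 0 (fun v => g v 1 1) p
      - y / x * pd 1 (fun v => g v 1 1) p - (y ^ 2 + 1) / x ^ 3 * g p 0 0
      + y / x ^ 2 * g p 0 1 = 0 := by
    linear_combination (1 / 2) * J2 - a101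
  refine ⟨?_, ?_, ?_, ?_, ?_, ?_, r1, r2⟩
  · intro k
    fin_cases k
    · linear_combination (norm := skip) (y ^ 2 + 1) / 2 * a000 - x * y / 2 * a001
      simp only [Fin.zero_eta]; field_simp; ring
    · linear_combination (norm := skip) -(x * y) / 2 * a000 + x ^ 2 / 2 * a001
      simp only [Fin.mk_one]; field_simp; ring
  · intro k
    fin_cases k
    · linear_combination (norm := skip) (y ^ 2 + 1) / 2 * a110 - x * y / 2 * a111
      simp only [Fin.zero_eta]; field_simp; ring
    · linear_combination (norm := skip) -(x * y) / 2 * a110 + x ^ 2 / 2 * a111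
      simp only [Fin.mk_one]; field_simp; ring
  · linear_combination (norm := skip) (y ^ 2 + 1) / 2 * a010 - x * y / 2 * a011
      + (y ^ 2 + 1) / 2 * r1 + x * y / 2 * r2
    field_simp; ring
  · linear_combination (norm := skip) -(x * y) / 2 * a010 + x ^ 2 / 2 * a011
      - x * y / 2 * r1 - x ^ 2 / 2 * r2
    field_simp; ring
  · linear_combination (norm := skip) (y ^ 2 + 1) / 2 * a100 - x * y / 2 * a101
      - (y ^ 2 + 1) / 2 * r1 - x * y / 2 * r2
    field_simp; ring
  · linear_combination (norm := skip) -(x * y) / 2 * a100 + x ^ 2 / 2 * a101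
      + x * y / 2 * r1 + x ^ 2 / 2 * r2
    field_simp; ring

end

section

variable {U : Set Pt} {g : Contra} {Γ : Conn}

theorem pd_comm (hU : IsOpen U) {f : Pt → ℝ} (hf : ContDiffOn ℝ (⊤ : ℕ∞) f U) {p : Pt}
    (hp : p ∈ U) (k l : Fin 2) : pd k (pd l f) p = pd l (pd k f) p := by
  have hsymm : IsSymmSndFDerivAt ℝ f p := (hf.contDiffAt (hU.mem_nhds hp)).isSymmSndFDerivAt
    (by simp only [minSmoothness_of_isRCLikeNormedField]
        exact WithTop.coe_le_coe.2 (le_top (a := (2 : ℕ∞))))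
  have hd : ∀ q ∈ U, DifferentiableAt ℝ f q := fun q hq =>
    (hf.contDiffAt (hU.mem_nhds hq)).differentiableAt (by simp)
  have hF : DifferentiableAt ℝ (fderiv ℝ f) p :=
    ((hf.fderiv_of_isOpen hU (m := (⊤ : ℕ∞)) (by simp)).contDiffAt
      (hU.mem_nhds hp)).differentiableAt (by simp)
  have e : ∀ a b : Fin 2, pd a (pd b f) p
      = fderiv ℝ (fderiv ℝ f) p (Pi.single a 1) (Pi.single b 1) := by
    intro a b
    rw [pd_congr hU (fun q hq => pd_eq_fderiv (hd q hq) b) hp a,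
      pd_eq_fderiv (hF.clm_apply (differentiableAt_const _))]
    simp [fderiv_clm_apply hF (differentiableAt_const _)]
  rw [e, e, hsymm.eq]

/-- The closed system of differential equations satisfied by the metric of an operator compatible
with `R₃⁽³⁾`: three equations of first order, and the second derivatives which are not obtained
by differentiating them. -/
theorem pde_of_compatible (hU : IsOpen U) (hU0 : ∀ p ∈ U, p 0 ≠ 0) (hc : CompatibleR33 U g Γ)
    {p : Pt} (hp : p ∈ U) :
    pd 1 (fun v => g v 0 1) p = g p 0 0 / p 0 - pd 0 (fun v => g v 0 0) p ∧
    (∀ k l, pd k (pd l (fun v => g v 0 0)) p = 0) ∧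
    pd 0 (pd 0 (fun v => g v 0 1)) p
      = g p 0 1 / p 0 ^ 2 - pd 0 (fun v => g v 0 1) p / p 0 ∧
    pd 1 (pd 0 (fun v => g v 0 1)) p = -(pd 1 (fun v => g v 0 1) p / p 0) ∧
    pd 0 (pd 1 (fun v => g v 1 1)) p
      = (pd 0 (fun v => g v 0 1) p + g p 0 1 / p 0 - pd 1 (fun v => g v 1 1) p) / p 0 ∧
    pd 1 (pd 1 (fun v => g v 1 1)) p = -(2 * pd 0 (fun v => g v 0 0) p / p 0) := by
  have sg := hc.smooth_g
  have sd := fun i j k => contDiffOn_pd hU (sg i j) k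
  have first := fun q hq => Gamma_of_compatible hU hU0 hc (p := q) hq
  have hsymm : ∀ q ∈ U, g q 1 0 = g q 0 1 := fun q hq => (hc.symm q hq).apply 0 1
  have hsd : ∀ k, ∀ q ∈ U, pd k (fun v => g v 1 0) q = pd k (fun v => g v 0 1) q := fun k q hq =>
    pd_congr hU hsymm hq k
  have hsd2 : ∀ k l, ∀ q ∈ U, pd k (pd l (fun v => g v 1 0)) q
      = pd k (pd l (fun v => g v 0 1)) q := fun k l q hq => pd_congr hU (hsd l) hq k
  have comm00 : ∀ q ∈ U, pd 0 (pd 1 (fun v => g v 0 0)) q = pd 1 (pd 0 (fun v => g v 0 0)) q :=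
    fun q hq => pd_comm hU (sg 0 0) hq 0 1
  have comm01 : ∀ q ∈ U, pd 0 (pd 1 (fun v => g v 0 1)) q = pd 1 (pd 0 (fun v => g v 0 1)) q :=
    fun q hq => pd_comm hU (sg 0 1) hq 0 1
  have comm11 : ∀ q ∈ U, pd 0 (pd 1 (fun v => g v 1 1)) q = pd 1 (pd 0 (fun v => g v 1 1)) q :=
    fun q hq => pd_comm hU (sg 1 1) hq 0 1
  -- one-variable derivatives of the building blocks
  have D : ∀ i j l, ∀ q ∈ U, HasPd l (fun v => g v i j) (pd l (fun v => g v i j) q) q :=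
    fun i j l q hq => HasPd.of_contDiffOn hU (sg i j) hq l
  have D2 : ∀ i j k l, ∀ q ∈ U, HasPd l (pd k (fun v => g v i j))
      (pd l (pd k (fun v => g v i j)) q) q :=
    fun i j k l q hq => HasPd.of_contDiffOn hU (sd i j k) hq l
  have X := fun l q => HasPd.coord l 0 q
  have Y := fun l q => HasPd.coord l 1 q
  have dG00 : ∀ k l, ∀ q ∈ U, pd l (fun v => Γ v 0 0 k) q
      = 1 / 2 * pd l (pd k (fun v => g v 0 0)) q := by
    intro k l q hq
    rw [pd_congr hU (fun q hq => (first q hq).1 k) hq]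
    exact ((D2 0 0 k l q hq).const_mul _).pd_eq
  have dG11 : ∀ k l, ∀ q ∈ U, pd l (fun v => Γ v 1 1 k) q
      = 1 / 2 * pd l (pd k (fun v => g v 1 1)) q := by
    intro k l q hq
    rw [pd_congr hU (fun q hq => (first q hq).2.1 k) hq]
    exact ((D2 1 1 k l q hq).const_mul _).pd_eq
  have dG010 : ∀ l, ∀ q ∈ U, pd l (fun v => Γ v 0 1 0) q
      = 1 / 2 * (pd l (pd 0 (fun v => g v 0 1)) q + (pd l (fun v => g v 0 1) q * q 0
        - g q 0 1 * (if 0 = l then 1 else 0)) / q 0 ^ 2) := by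
    intro l q hq
    rw [pd_congr hU (fun q hq => (first q hq).2.2.1) hq]
    exact (((D2 0 1 0 l q hq).add ((D 0 1 l q hq).div (X l q) (hU0 q hq))).const_mul _).pd_eq
  have dG011 : ∀ l, ∀ q ∈ U, pd l (fun v => Γ v 0 1 1) q
      = 1 / 2 * (pd l (pd 1 (fun v => g v 0 1)) q - (pd l (fun v => g v 0 0) q * q 0
        - g q 0 0 * (if 0 = l then 1 else 0)) / q 0 ^ 2) := by
    intro l q hq
    rw [pd_congr hU (fun q hq => (first q hq).2.2.2.1) hq]
    exact (((D2 0 1 1 l q hq).sub ((D 0 0 l q hq).div (X l q) (hU0 q hq))).const_mul _).pd_eq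
  have dG100 : ∀ l, ∀ q ∈ U, pd l (fun v => Γ v 1 0 0) q
      = 1 / 2 * (pd l (pd 0 (fun v => g v 0 1)) q - (pd l (fun v => g v 0 1) q * q 0
        - g q 0 1 * (if 0 = l then 1 else 0)) / q 0 ^ 2) := by
    intro l q hq
    rw [pd_congr hU (fun q hq => (first q hq).2.2.2.2.1) hq]
    exact (((D2 0 1 0 l q hq).sub ((D 0 1 l q hq).div (X l q) (hU0 q hq))).const_mul _).pd_eq
  have dG101 : ∀ l, ∀ q ∈ U, pd l (fun v => Γ v 1 0 1) q
      = 1 / 2 * (pd l (pd 1 (fun v => g v 0 1)) q + (pd l (fun v => g v 0 0) q * q 0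
        - g q 0 0 * (if 0 = l then 1 else 0)) / q 0 ^ 2) := by
    intro l q hq
    rw [pd_congr hU (fun q hq => (first q hq).2.2.2.2.2.1) hq]
    exact (((D2 0 1 1 l q hq).add ((D 0 0 l q hq).div (X l q) (hU0 q hq))).const_mul _).pd_eq
  -- the derivatives in the direction `u²` of the two first-order equations found so far
  have dII : ∀ q ∈ U,
      pd 1 (pd 0 (fun v => g v 0 1)) q
        + (1 / q 0 * pd 1 (fun v => g v 0 1) q + q 1 / q 0 * pd 1 (pd 1 (fun v => g v 0 1)) q)
        - (1 / q 0 * pd 0 (fun v => g v 0 0) q + q 1 / q 0 * pd 1 (pd 0 (fun v => g v 0 0)) q)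
        - (2 * q 1 / q 0 ^ 2 * pd 1 (fun v => g v 0 0) q
          + (q 1 ^ 2 + 1) / q 0 ^ 2 * pd 1 (pd 1 (fun v => g v 0 0)) q)
        + (1 / q 0 ^ 2 * g q 0 0 + q 1 / q 0 ^ 2 * pd 1 (fun v => g v 0 0) q)
        - pd 1 (fun v => g v 0 1) q / q 0 = 0 ∧
      1 / q 0 * pd 0 (fun v => g v 0 1) q + q 1 / q 0 * pd 1 (pd 0 (fun v => g v 0 1)) q
        + (2 * q 1 / q 0 ^ 2 * pd 1 (fun v => g v 0 1) q
          + (q 1 ^ 2 + 1) / q 0 ^ 2 * pd 1 (pd 1 (fun v => g v 0 1)) q)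
        - pd 1 (pd 0 (fun v => g v 1 1)) q
        - (1 / q 0 * pd 1 (fun v => g v 1 1) q + q 1 / q 0 * pd 1 (pd 1 (fun v => g v 1 1)) q)
        - (2 * q 1 / q 0 ^ 3 * g q 0 0 + (q 1 ^ 2 + 1) / q 0 ^ 3 * pd 1 (fun v => g v 0 0) q)
        + (1 / q 0 ^ 2 * g q 0 1 + q 1 / q 0 ^ 2 * pd 1 (fun v => g v 0 1) q) = 0 := by
    intro q hq
    have x0 := hU0 q hq
    have a := (Y 1 q).div (X 1 q) x0
    have b := (((Y 1 q).pow 2).add (HasPd.const 1)).div ((X 1 q).pow 2) (pow_ne_zero 2 x0)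
    have b3 := (((Y 1 q).pow 2).add (HasPd.const 1)).div ((X 1 q).pow 3) (pow_ne_zero 3 x0)
    have c := (Y 1 q).div ((X 1 q).pow 2) (pow_ne_zero 2 x0)
    have F1 := (((((D2 0 1 0 1 q hq).add (a.mul (D2 0 1 1 1 q hq))).sub
      (a.mul (D2 0 0 0 1 q hq))).sub (b.mul (D2 0 0 1 1 q hq))).add (c.mul (D 0 0 1 q hq))).sub
      ((D 0 1 1 q hq).div (X 1 q) x0)
    have F2 := (((((a.mul (D2 0 1 0 1 q hq)).add (b.mul (D2 0 1 1 1 q hq))).sub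
      (D2 1 1 0 1 q hq)).sub (a.mul (D2 1 1 1 1 q hq))).sub (b3.mul (D 0 0 1 q hq))).add
      (c.mul (D 0 1 1 q hq))
    have Z1 := F1.pd_eq.symm.trans ((pd_congr hU (h := fun _ => 0)
      (fun q hq => (first q hq).2.2.2.2.2.2.1) hq 1).trans (HasPd.const 0).pd_eq)
    have Z2 := F2.pd_eq.symm.trans ((pd_congr hU (h := fun _ => 0)
      (fun q hq => (first q hq).2.2.2.2.2.2.2) hq 1).trans (HasPd.const 0).pd_eq)
    simp at Z1 Z2
    refine ⟨?_, ?_⟩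
    · rw [← Z1]; field_simp
    · rw [← Z2]; field_simp
  have E := fun i j m k q (hq : q ∈ U) => compat_second hU hU0 hc hq i j m k
  -- the equations of first order in the derivative of the field, in terms of `g` alone
  have key : ∀ q ∈ U,
      (pd 0 (pd 0 (fun v => g v 0 0)) q + q 1 / q 0 * pd 1 (pd 0 (fun v => g v 0 0)) q = 0) ∧
      (3 / 2 * (q 1 / q 0) * pd 1 (pd 0 (fun v => g v 0 0)) q
        + 3 / 2 * ((q 1 ^ 2 + 1) / q 0 ^ 2) * pd 1 (pd 1 (fun v => g v 0 0)) q
        - 1 / 2 * pd 1 (pd 0 (fun v => g v 0 1)) q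
        - 1 / 2 * (q 1 / q 0) * pd 1 (pd 1 (fun v => g v 0 1)) q
        + q 1 / (2 * q 0 ^ 2) * pd 1 (fun v => g v 0 0) q
        - 1 / (2 * q 0) * pd 1 (fun v => g v 0 1) q = 0) ∧
      (pd 0 (pd 0 (fun v => g v 0 1)) q + q 1 / q 0 * pd 1 (pd 0 (fun v => g v 0 1)) q
        - 2 * q 1 / q 0 ^ 2 * pd 0 (fun v => g v 0 0) q + pd 0 (fun v => g v 0 1) q / q 0
        - q 1 / q 0 ^ 2 * pd 1 (fun v => g v 0 1) q + 2 * q 1 / q 0 ^ 3 * g q 0 0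
        - g q 0 1 / q 0 ^ 2 = 0) ∧
      (pd 1 (pd 0 (fun v => g v 0 1)) q + q 1 / q 0 * pd 1 (pd 1 (fun v => g v 0 1)) q
        + 1 / q 0 * pd 0 (fun v => g v 0 0) q - q 1 / q 0 ^ 2 * pd 1 (fun v => g v 0 0) q
        + 2 / q 0 * pd 1 (fun v => g v 0 1) q - 1 / q 0 ^ 2 * g q 0 0 = 0) ∧
      (q 1 / q 0 * pd 1 (pd 0 (fun v => g v 0 1)) q
        + (q 1 ^ 2 + 1) / q 0 ^ 2 * pd 1 (pd 1 (fun v => g v 0 1)) q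
        - q 1 / q 0 ^ 2 * pd 0 (fun v => g v 0 0) q - 1 / q 0 * pd 0 (fun v => g v 0 1) q
        - 2 * q 1 / q 0 ^ 2 * pd 1 (fun v => g v 0 1) q + q 1 / q 0 ^ 3 * g q 0 0
        + 1 / q 0 ^ 2 * g q 0 1 = 0) ∧
      (q 1 / q 0 * pd 1 (pd 0 (fun v => g v 1 1)) q
        + (q 1 ^ 2 + 1) / q 0 ^ 2 * pd 1 (pd 1 (fun v => g v 1 1)) q
        - (q 1 ^ 2 + 1) / q 0 ^ 3 * pd 1 (fun v => g v 0 1) q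
        - 1 / q 0 * pd 0 (fun v => g v 1 1) q + (q 1 ^ 2 + 1) / q 0 ^ 4 * g q 0 0 = 0) := by
    intro q hq
    have x0 := hU0 q hq
    obtain ⟨A00, A01, A10, A11⟩ := coeffA_val q
    obtain ⟨s0, s1, s2, s3, s4⟩ := pd_coeffS q x0
    obtain ⟨G00, G11, G010, G011, G100, G101, -, -⟩ := first q hq
    have e1 := E 0 0 0 0 q hq
    have e2 := E 0 0 1 1 q hq
    have e3 := E 0 1 0 0 q hq
    have e4 := E 0 1 0 1 q hq
    have e5 := E 1 0 1 1 q hq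
    have e6 := E 1 1 1 1 q hq
    simp only [Fin.sum_univ_two, A00, A01, A10, A11, s0, s1, s2, s3, s4, hsd _ q hq,
      hsd2 _ _ q hq, dG00 _ _ q hq, dG11 _ _ q hq, dG010 _ q hq, dG011 _ q hq, dG100 _ q hq,
      dG101 _ q hq, G00, G11, G010, G011, G100, G101, comm00 q hq, comm01 q hq, comm11 q hq,
      if_true, Fin.isValue, zero_ne_one, if_false] at e1 e2 e3 e4 e5 e6
    refine ⟨?_, ?_, ?_, ?_, ?_, ?_⟩
    · rw [← e1]; field_simp; ring
    · rw [← e2]; field_simp; ring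
    · rw [← e3]; field_simp; ring
    · rw [← e4]; field_simp; ring
    · rw [← e5]; field_simp; ring
    · rw [← e6]; field_simp; ring
  have R1 : ∀ q ∈ U, pd 1 (fun v => g v 0 1) q = g q 0 0 / q 0 - pd 0 (fun v => g v 0 0) q := by
    intro q hq
    have x0 := hU0 q hq
    obtain ⟨-, k2, -, k4, -, -⟩ := key q hq
    obtain ⟨z1, -⟩ := dII q hq
    linear_combination (norm := skip) -(2 * q 0 / 5) * (k2 + 3 / 2 * z1 - k4)
    field_simp; ring
  have R1d : ∀ l, ∀ q ∈ U, pd l (pd 1 (fun v => g v 0 1)) q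
      = (pd l (fun v => g v 0 0) q * q 0 - g q 0 0 * (if 0 = l then 1 else 0)) / q 0 ^ 2
        - pd l (pd 0 (fun v => g v 0 0)) q := by
    intro l q hq
    rw [pd_congr hU R1 hq]
    exact (((D 0 0 l q hq).div (X l q) (hU0 q hq)).sub (D2 0 0 0 l q hq)).pd_eq
  have x0 := hU0 p hp
  obtain ⟨k1, k2, k3, k4, k5, k6⟩ := key p hp
  obtain ⟨z1, z2⟩ := dII p hp
  have r1 := R1 p hp
  have r10 := R1d 0 p hp
  have r11 := R1d 1 p hp
  obtain ⟨-, -, -, -, -, -, f1, f2⟩ := first p hp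
  rw [comm01 p hp] at r10
  simp only [if_true, Fin.isValue, zero_ne_one, if_false] at r10 r11
  have hQ : pd 1 (pd 0 (fun v => g v 0 0)) p = 0 := by
    -- the determinant of `E + S + Sᵀ` is `1 / (u¹)²`
    linear_combination (norm := skip) p 0 ^ 2 * (p 1 / p 0 * (r10 - k1) - k5
      + (p 1 ^ 2 + 1) / p 0 ^ 2 * r11 - 1 / p 0 * f1 - p 1 / p 0 ^ 2 * r1)
    field_simp; ring
  have hP : pd 0 (pd 0 (fun v => g v 0 0)) p = 0 := by
    linear_combination k1 - p 1 / p 0 * hQ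
  have hR : pd 1 (pd 1 (fun v => g v 0 0)) p = 0 := by
    have h : (p 1 ^ 2 + 1) * pd 1 (pd 1 (fun v => g v 0 0)) p = 0 := by
      linear_combination (norm := skip) 2 / 3 * p 0 ^ 2 * (k2 - 3 / 2 * (p 1 / p 0) * hQ
        + 1 / 2 * r10 + 1 / 2 * (p 1 / p 0) * r11 - 1 / 2 * hP - 1 / 2 * (p 1 / p 0) * hQ
        + 1 / (2 * p 0) * r1)
      field_simp; ring
    exact (mul_eq_zero.1 h).resolve_left (by positivity)
  refine ⟨r1, ?_, ?_, ?_, ?_, ?_⟩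
  · intro k l
    fin_cases k <;> fin_cases l
    · exact hP
    · exact (comm00 p hp).trans hQ
    · exact hQ
    · exact hR
  · linear_combination (norm := skip) k3 - p 1 / p 0 * (r10 - hP) + p 1 / p 0 ^ 2 * r1
    field_simp; ring
  · linear_combination (norm := skip) r10 - hP + 1 / p 0 * r1
    field_simp; ring
  · rw [comm11 p hp]
    linear_combination (norm := skip) -p 0 ^ 2 * ((p 1 ^ 2 + 1) / p 0 ^ 2 * (z2
      - p 1 / p 0 * (r10 - hP) - (p 1 ^ 2 + 1) / p 0 ^ 2 * (r11 - hQ))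
      + p 1 / p 0 * k6 - p 1 / p 0 ^ 2 * f2) + p 1 * (p 1 ^ 2 + 1) / p 0 ^ 2 * r1
    field_simp; ring
  · linear_combination (norm := skip) p 0 ^ 2 * (p 1 / p 0 * (z2
      - p 1 / p 0 * (r10 - hP) - (p 1 ^ 2 + 1) / p 0 ^ 2 * (r11 - hQ))
      + k6 - 1 / p 0 * f2) + (2 - p 1 ^ 2) / p 0 * r1
    field_simp; ring

end

/-! ### The six-parameter family -/

theorem metric_apply (c : Param) (u : Pt) :
    c.metric u 0 0 = c.c1 * u 0 + c.c2 * u 1 + c.c3 ∧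
    c.metric u 0 1 = c.c4 * u 0 - c.c2 / (2 * u 0) + c.c3 * u 1 / u 0
      + c.c2 * (u 1) ^ 2 / (2 * u 0) ∧
    c.metric u 1 0 = c.metric u 0 1 ∧
    c.metric u 1 1 = 2 * c.c4 * u 1 + c.c1 / u 0 + c.c5 * u 1 / u 0
      - c.c1 * (u 1) ^ 2 / u 0 + c.c6 := by
  simp [Param.metric]

theorem hasPd_metric (c : Param) {p : Pt} (x0 : p 0 ≠ 0) :
    HasPd 0 (fun v => c.metric v 0 0) c.c1 p ∧ HasPd 1 (fun v => c.metric v 0 0) c.c2 p ∧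
    HasPd 0 (fun v => c.metric v 0 1) (c.c4 + c.c2 / (2 * p 0 ^ 2) - c.c3 * p 1 / p 0 ^ 2
      - c.c2 * p 1 ^ 2 / (2 * p 0 ^ 2)) p ∧
    HasPd 1 (fun v => c.metric v 0 1) ((c.c3 + c.c2 * p 1) / p 0) p ∧
    HasPd 0 (fun v => c.metric v 1 1) (-((c.c1 + c.c5 * p 1 - c.c1 * p 1 ^ 2) / p 0 ^ 2)) p ∧
    HasPd 1 (fun v => c.metric v 1 1) (2 * c.c4 + (c.c5 - 2 * c.c1 * p 1) / p 0) p := by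
  have X := fun k => HasPd.coord k 0 p
  have Y := fun k => HasPd.coord k 1 p
  have x2 : 2 * p 0 ≠ 0 := mul_ne_zero two_ne_zero x0
  have a00 := fun k => (((X k).const_mul c.c1).add ((Y k).const_mul c.c2)).add (HasPd.const c.c3)
  have a01 := fun k => ((((X k).const_mul c.c4).sub
    ((HasPd.const c.c2).div ((X k).const_mul 2) x2)).add (((Y k).const_mul c.c3).div (X k) x0)).add
    ((((Y k).pow 2).const_mul c.c2).div ((X k).const_mul 2) x2)
  have a11 := fun k => (((((Y k).const_mul (2 * c.c4)).add ((HasPd.const c.c1).div (X k) x0)).add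
    (((Y k).const_mul c.c5).div (X k) x0)).sub
    ((((Y k).pow 2).const_mul c.c1).div (X k) x0)).add (HasPd.const c.c6)
  simp only [fun v => (metric_apply c v).1, fun v => (metric_apply c v).2.1,
    fun v => (metric_apply c v).2.2.2]
  refine ⟨(a00 0).congr_val ?_, (a00 1).congr_val ?_, (a01 0).congr_val ?_, (a01 1).congr_val ?_,
    (a11 0).congr_val ?_, (a11 1).congr_val ?_⟩
  · simp
  · simp
  · simp; field_simp; ring
  · simp; field_simp
  · simp; field_simp; ring
  · simp; field_simp; ring

theorem metric_isSymm (c : Param) (u : Pt) : (c.metric u).IsSymm := by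
  ext i j
  fin_cases i <;> fin_cases j <;> simp [Param.metric]

/-- The parameters are read off from the first-order jet of the metric at a point. -/
theorem param_of_metric {U : Set Pt} (hU : IsOpen U) {g : Contra} {c : Param}
    (hg : ∀ u ∈ U, g u = c.metric u) {p : Pt} (hp : p ∈ U) (x0 : p 0 ≠ 0) :
    c.c1 = pd 0 (fun v => g v 0 0) p ∧ c.c2 = pd 1 (fun v => g v 0 0) p ∧
    c.c3 = g p 0 0 - c.c1 * p 0 - c.c2 * p 1 ∧
    c.c4 = 1 / 2 * (pd 0 (fun v => g v 0 1) p + g p 0 1 / p 0) ∧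
    c.c5 = p 0 * (pd 1 (fun v => g v 1 1) p - 2 * c.c4) + 2 * c.c1 * p 1 ∧
    c.c6 = g p 1 1 - 2 * c.c4 * p 1 - c.c1 / p 0 - c.c5 * p 1 / p 0 + c.c1 * p 1 ^ 2 / p 0 := by
  obtain ⟨d1, d2, d3, d4, d5, d6⟩ := hasPd_metric c x0
  obtain ⟨m00, m01, -, m11⟩ := metric_apply c p
  have e := fun i j k => pd_congr hU (f := fun v => g v i j) (h := fun v => c.metric v i j)
    (fun q hq => by rw [hg q hq]) hp k
  rw [e, e, e, e, d1.pd_eq, d2.pd_eq, d3.pd_eq, d6.pd_eq, hg p hp, m00, m01, m11]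
  refine ⟨rfl, rfl, by ring, ?_, ?_, ?_⟩
  · field_simp; ring
  · field_simp; ring
  · field_simp; ring

/-- The parameters are first integrals of the system `pde_of_compatible`: the expressions of
`param_of_metric` have vanishing partial derivatives. -/
theorem existsUnique_param_of_compatible {U : Set Pt} {g : Contra} {Γ : Conn} (hU : IsOpen U)
    (hne : U.Nonempty) (hU0 : ∀ p ∈ U, p 0 ≠ 0) (hconn : IsPreconnected U)
    (hc : CompatibleR33 U g Γ) : ∃! c : Param, ∀ u ∈ U, g u = c.metric u := by
  obtain ⟨p, hp⟩ := hne
  have sg := hc.smooth_g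
  have sd := fun i j k => contDiffOn_pd hU (sg i j) k
  have D : ∀ i j l, ∀ q ∈ U, HasPd l (fun v => g v i j) (pd l (fun v => g v i j) q) q :=
    fun i j l q hq => HasPd.of_contDiffOn hU (sg i j) hq l
  have D2 : ∀ i j k l, ∀ q ∈ U, HasPd l (pd k (fun v => g v i j))
      (pd l (pd k (fun v => g v i j)) q) q :=
    fun i j k l q hq => HasPd.of_contDiffOn hU (sd i j k) hq l
  have X := fun l q => HasPd.coord l 0 q
  have Y := fun l q => HasPd.coord l 1 q
  have sx : ∀ l : Fin 2, ContDiffOn ℝ (⊤ : ℕ∞) (fun q : Pt => q l) U := fun l => by fun_prop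
  have sk : ∀ a : ℝ, ContDiffOn ℝ (⊤ : ℕ∞) (fun _ : Pt => a) U := fun a => contDiffOn_const
  have P := fun q hq => pde_of_compatible hU hU0 hc (p := q) hq
  set c1 := pd 0 (fun v => g v 0 0) p with hc1
  set c2 := pd 1 (fun v => g v 0 0) p with hc2
  have k1 : ∀ q ∈ U, pd 0 (fun v => g v 0 0) q = c1 := fun q hq =>
    eq_of_pd_eq_zero hU hconn (sd 0 0 0) (fun k r hr => (P r hr).2.1 k 0) hq hp
  have k2 : ∀ q ∈ U, pd 1 (fun v => g v 0 0) q = c2 := fun q hq =>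
    eq_of_pd_eq_zero hU hconn (sd 0 0 1) (fun k r hr => (P r hr).2.1 k 1) hq hp
  set F3 : Pt → ℝ := fun q => g q 0 0 - c1 * q 0 - c2 * q 1 with hF3
  have k3 : ∀ q ∈ U, F3 q = F3 p := fun q hq => by
    refine eq_of_pd_eq_zero hU hconn
      (((sg 0 0).sub ((sk c1).mul (sx 0))).sub ((sk c2).mul (sx 1))) ?_ hq hp
    intro k r hr
    refine ((((D 0 0 k r hr).sub ((X k r).const_mul c1)).sub
      ((Y k r).const_mul c2)).congr_val ?_).pd_eq
    fin_cases k
    · simp [k1 r hr]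
    · simp [k2 r hr]
  set F4 : Pt → ℝ := fun q => 1 / 2 * (pd 0 (fun v => g v 0 1) q + g q 0 1 / q 0) with hF4
  have k4 : ∀ q ∈ U, F4 q = F4 p := fun q hq => by
    refine eq_of_pd_eq_zero hU hconn
      ((sk (1 / 2)).mul ((sd 0 1 0).add ((sg 0 1).div (sx 0) hU0))) ?_ hq hp
    intro k r hr
    have x0 := hU0 r hr
    refine (((D2 0 1 0 k r hr).add ((D 0 1 k r hr).div (X k r) x0)).const_mul
      (1 / 2)).pd_eq.trans ?_
    obtain ⟨-, -, r00, r10, -, -⟩ := P r hr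
    fin_cases k
    · simp; rw [r00]; field_simp; ring
    · simp; rw [r10]; field_simp; ring
  set F5 : Pt → ℝ := fun q => q 0 * (pd 1 (fun v => g v 1 1) q - 2 * F4 p) + 2 * c1 * q 1 with hF5
  have k5 : ∀ q ∈ U, F5 q = F5 p := fun q hq => by
    refine eq_of_pd_eq_zero hU hconn
      (((sx 0).mul ((sd 1 1 1).sub (sk _))).add ((sk (2 * c1)).mul (sx 1))) ?_ hq hp
    intro k r hr
    have x0 := hU0 r hr
    refine (((X k r).mul ((D2 1 1 1 k r hr).sub (HasPd.const (2 * F4 p)))).add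
      ((Y k r).const_mul (2 * c1))).pd_eq.trans ?_
    obtain ⟨-, -, -, -, r0, r1⟩ := P r hr
    rw [← k4 r hr]
    fin_cases k
    · simp; rw [r0]; simp only [hF4]; field_simp; ring
    · simp; rw [r1, k1 r hr]; field_simp; ring
  set F6 : Pt → ℝ := fun q => g q 1 1 - 2 * F4 p * q 1 - c1 / q 0 - F5 p * q 1 / q 0
    + c1 * q 1 ^ 2 / q 0 with hF6
  have k6 : ∀ q ∈ U, F6 q = F6 p := fun q hq => by
    refine eq_of_pd_eq_zero hU hconn
      (((((sg 1 1).sub ((sk _).mul (sx 1))).sub ((sk _).div (sx 0) hU0)).sub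
        (((sk _).mul (sx 1)).div (sx 0) hU0)).add
        (((sk _).mul ((sx 1).pow 2)).div (sx 0) hU0)) ?_ hq hp
    intro k r hr
    have x0 := hU0 r hr
    refine (((((D 1 1 k r hr).sub ((Y k r).const_mul _)).sub
      ((HasPd.const _).div (X k r) x0)).sub (((Y k r).const_mul _).div (X k r) x0)).add
      ((((Y k r).pow 2).const_mul _).div (X k r) x0)).pd_eq.trans ?_
    obtain ⟨r1, -⟩ := P r hr
    have f2 := (Gamma_of_compatible hU hU0 hc hr).2.2.2.2.2.2.2
    rw [← k4 r hr, ← k5 r hr]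
    simp only [hF5]
    rw [← k4 r hr]
    simp only [hF4, ← hc1, ← k1 r hr]
    fin_cases k
    · simp
      linear_combination (norm := skip) -f2 + (r 1 ^ 2 + 1) / r 0 ^ 2 * r1
      field_simp; ring
    · simp; field_simp; ring
  refine ⟨⟨c1, c2, F3 p, F4 p, F5 p, F6 p⟩, ?_, ?_⟩
  · intro q hq
    have x0 := hU0 q hq
    have q3 := k3 q hq
    have q4 := k4 q hq
    have q6 := k6 q hq
    have f1 := (Gamma_of_compatible hU hU0 hc hq).2.2.2.2.2.2.1
    have r1 := (P q hq).1
    obtain ⟨m00, m01, m10, m11⟩ := metric_apply ⟨c1, c2, F3 p, F4 p, F5 p, F6 p⟩ q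
    have e00 : g q 0 0 = c1 * q 0 + c2 * q 1 + F3 p := by rw [← q3]; simp only [hF3]; ring
    have e01 : g q 0 1 = F4 p * q 0 - c2 / (2 * q 0) + F3 p * q 1 / q 0
        + c2 * (q 1) ^ 2 / (2 * q 0) := by
      rw [← q3, ← q4]
      simp only [hF3, hF4, ← k1 q hq, ← k2 q hq]
      linear_combination (norm := skip) -(q 0 / 2) * f1 + q 1 / 2 * r1
      field_simp; ring
    have e11 : g q 1 1 = 2 * F4 p * q 1 + c1 / q 0 + F5 p * q 1 / q 0
      - c1 * (q 1) ^ 2 / q 0 + F6 p := by rw [← q6]; simp only [hF6]; ring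
    have e10 : g q 1 0 = g q 0 1 := (hc.symm q hq).apply 0 1
    ext i j
    fin_cases i <;> fin_cases j
    · exact e00.trans m00.symm
    · exact e01.trans m01.symm
    · exact e10.trans (e01.trans (m01.symm.trans m10.symm))
    · exact e11.trans m11.symm
  · intro d hd
    obtain ⟨d1, d2, d3, d4, d5, d6⟩ := param_of_metric hU hd hp (hU0 p hp)
    obtain ⟨a1, a2, a3, a4, a5, a6⟩ := d
    simp only at d1 d2 d3 d4 d5 d6
    subst d1 d2 d3 d4 d5 d6
    rfl

/-! ### Levi-Civita connections of contravariant metrics -/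

theorem inv_apply (M : Matrix (Fin 2) (Fin 2) ℝ) :
    M⁻¹ 0 0 = M 1 1 / M.det ∧ M⁻¹ 0 1 = -M 0 1 / M.det ∧
    M⁻¹ 1 0 = -M 1 0 / M.det ∧ M⁻¹ 1 1 = M 0 0 / M.det := by
  simp [Matrix.inv_def, Matrix.adjugate_fin_two, div_eq_inv_mul]

section

variable {g : Contra} {Γ : Conn} {u : Pt}

/-- The derivative of the inverse matrix, `∂ₖ g⁻¹ = - g⁻¹ (∂ₖ g) g⁻¹`. -/
theorem hasPd_inv {k : Fin 2} {dg : Fin 2 → Fin 2 → ℝ}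
    (hd : ∀ i j, HasPd k (fun v => g v i j) (dg i j) u) (h0 : (g u).det ≠ 0) (l j : Fin 2) :
    HasPd k (fun v => (g v)⁻¹ l j)
      (-∑ a, ∑ b, (g u)⁻¹ l a * dg a b * (g u)⁻¹ b j) u := by
  have hdet : HasPd k (fun v => (g v).det)
      (dg 0 0 * g u 1 1 + g u 0 0 * dg 1 1 - (dg 0 1 * g u 1 0 + g u 0 1 * dg 1 0)) u := by
    simp only [Matrix.det_fin_two]
    exact ((hd 0 0).mul (hd 1 1)).sub ((hd 0 1).mul (hd 1 0))
  have e := Matrix.det_fin_two (g u)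
  obtain ⟨i00, i01, i10, i11⟩ := inv_apply (g u)
  fin_cases l <;> fin_cases j
  · simp only [Fin.zero_eta, fun v => (inv_apply (g v)).1]
    refine ((hd 1 1).div hdet h0).congr_val ?_
    simp only [Fin.sum_univ_two, i00, i01, i10]
    field_simp
    rw [e]; ring
  · simp only [Fin.zero_eta, Fin.mk_one, fun v => (inv_apply (g v)).2.1]
    refine ((hd 0 1).neg.div hdet h0).congr_val ?_
    simp only [Fin.sum_univ_two, i00, i01, i11]
    field_simp
    rw [e]; ring
  · simp only [Fin.zero_eta, Fin.mk_one, fun v => (inv_apply (g v)).2.2.1]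
    refine ((hd 1 0).neg.div hdet h0).congr_val ?_
    simp only [Fin.sum_univ_two, i00, i10, i11]
    field_simp
    rw [e]; ring
  · simp only [Fin.mk_one, fun v => (inv_apply (g v)).2.2.2]
    refine ((hd 0 0).div hdet h0).congr_val ?_
    simp only [Fin.sum_univ_two, i01, i10, i11]
    field_simp
    rw [e]; ring

/-- The condition `g^{is} Γ^{jk}_s = g^{js} Γ^{ik}_s` says that `(g⁻¹)_{ip} Γ^{pk}_j` is symmetric
in `i`, `j`, that is, that the connection is torsion-free. -/
theorem lower_symm (hs : (g u).IsSymm) (h0 : (g u).det ≠ 0)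
    (hL : ∀ i j k, ∑ s, g u i s * Γ u j k s = ∑ s, g u j s * Γ u i k s) (i j k : Fin 2) :
    ∑ p, (g u)⁻¹ i p * Γ u p k j = ∑ p, (g u)⁻¹ j p * Γ u p k i := by
  have key : ∑ p, (g u)⁻¹ 0 p * Γ u p k 1 = ∑ p, (g u)⁻¹ 1 p * Γ u p k 0 := by
    obtain ⟨i00, i01, i10, i11⟩ := inv_apply (g u)
    have h := hL 0 1 k
    simp only [Fin.sum_univ_two, i00, i01, i10, i11] at h ⊢
    rw [hs.apply 0 1] at h ⊢
    field_simp
    linear_combination -h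
  fin_cases i <;> fin_cases j
  · rfl
  · exact key
  · exact key.symm
  · rfl

/-- A connection satisfying the Levi-Civita conditions has the Christoffel symbols
`Γ^k_{ij} = - (g⁻¹)_{ip} Γ^{pk}_j`. -/
theorem christoffel_of_leviCivita (hs : (g u).IsSymm) (h0 : (g u).det ≠ 0)
    (hd : ∀ i j k, HasPd k (fun v => g v i j) (Γ u i j k + Γ u j i k) u)
    (hL : ∀ i j k, ∑ s, g u i s * Γ u j k s = ∑ s, g u j s * Γ u i k s) (k i j : Fin 2) :
    christoffel g u k i j = -∑ p, (g u)⁻¹ i p * Γ u p k j := by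
  have hI := fun k l j => (hasPd_inv (fun i j => hd i j k) h0 l j).pd_eq
  have hN := lower_symm hs h0 hL
  have hsi : ∀ a b, (g u)⁻¹ a b = (g u)⁻¹ b a := fun a b => (hs.inv).apply b a
  have hgi : ∀ a b, ∑ l, g u a l * (g u)⁻¹ l b = if a = b then 1 else 0 := by
    intro a b
    have := congrFun (congrFun (Matrix.mul_nonsing_inv (g u) (Ne.isUnit h0)) a) b
    simpa [Matrix.mul_apply, Matrix.one_apply] using this
  -- `∂ₖ (g⁻¹)_{lj}` in terms of the lowered symbols
  have hT : ∀ k l j, pd k (fun v => (g v)⁻¹ l j) u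
      = -(∑ b, (g u)⁻¹ j b * ∑ a, (g u)⁻¹ l a * Γ u a b k)
        - ∑ b, (g u)⁻¹ l b * ∑ a, (g u)⁻¹ j a * Γ u a b k := by
    intro k l j
    rw [hI]
    simp only [Fin.sum_univ_two, hsi j 0, hsi j 1]
    ring
  have hl : ∀ l, pd i (fun v => (g v)⁻¹ l j) u + pd j (fun v => (g v)⁻¹ l i) u
      - pd l (fun v => (g v)⁻¹ i j) u
      = -2 * ∑ b, (g u)⁻¹ l b * ∑ a, (g u)⁻¹ i a * Γ u a b j := by
    intro l
    rw [hT, hT, hT]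
    simp only [fun b => hN l i b, fun b => hN l j b, fun b => hN j i b]
    ring
  have hk : ∀ b, g u k 0 * (g u)⁻¹ 0 b + g u k 1 * (g u)⁻¹ 1 b = if k = b then 1 else 0 := by
    intro b; simpa using hgi k b
  have hS : ∑ l, g u k l * ∑ b, (g u)⁻¹ l b * ∑ a, (g u)⁻¹ i a * Γ u a b j
      = ∑ a, (g u)⁻¹ i a * Γ u a k j := by
    have : ∑ l, g u k l * ∑ b, (g u)⁻¹ l b * ∑ a, (g u)⁻¹ i a * Γ u a b j
        = ∑ b, (∑ l, g u k l * (g u)⁻¹ l b) * ∑ a, (g u)⁻¹ i a * Γ u a b j := by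
      simp only [Fin.sum_univ_two]; ring
    rw [this]
    simp only [hgi, ite_mul, one_mul, zero_mul, Finset.sum_ite_eq, Finset.mem_univ, if_true]
  unfold christoffel
  simp only [hl]
  rw [← hS]
  simp only [Fin.sum_univ_two]
  ring

theorem contraChristoffel_of_leviCivita (hs : (g u).IsSymm) (h0 : (g u).det ≠ 0)
    (hd : ∀ i j k, HasPd k (fun v => g v i j) (Γ u i j k + Γ u j i k) u)
    (hL : ∀ i j k, ∑ s, g u i s * Γ u j k s = ∑ s, g u j s * Γ u i k s) (i j k : Fin 2) :
    contraChristoffel g u i j k = Γ u i j k := by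
  have hgi : ∀ a b, ∑ l, g u a l * (g u)⁻¹ l b = if a = b then 1 else 0 := by
    intro a b
    have := congrFun (congrFun (Matrix.mul_nonsing_inv (g u) (Ne.isUnit h0)) a) b
    simpa [Matrix.mul_apply, Matrix.one_apply] using this
  unfold contraChristoffel
  simp only [christoffel_of_leviCivita hs h0 hd hL]
  have : -∑ l, g u i l * -∑ p, (g u)⁻¹ l p * Γ u p j k
      = ∑ p, (∑ l, g u i l * (g u)⁻¹ l p) * Γ u p j k := by
    simp only [Fin.sum_univ_two]; ring
  rw [this]
  simp only [hgi, ite_mul, one_mul, zero_mul, Finset.sum_ite_eq, Finset.mem_univ, if_true]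

/-- Contravariant Christoffel symbols always satisfy the first Levi-Civita condition. -/
theorem contraChristoffel_torsionFree (hs : ∀ v, (g v).IsSymm) (u : Pt) (i j k : Fin 2) :
    ∑ s, g u i s * contraChristoffel g u j k s = ∑ s, g u j s * contraChristoffel g u i k s := by
  have hsi : ∀ a b, (fun v => (g v)⁻¹ a b) = fun v => (g v)⁻¹ b a := fun a b =>
    funext fun v => ((hs v).inv).apply b a
  have hc : ∀ k i j, christoffel g u k i j = christoffel g u k j i := by
    intro k i j
    unfold christoffel
    simp only [hsi j i]
    simp only [Fin.sum_univ_two]; ring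
  unfold contraChristoffel
  simp only [Fin.sum_univ_two]
  rw [hc k 1 0]
  ring

/-- The curvature of a Levi-Civita connection with closed coefficients `Γ^{ij}_k du^k`. -/
theorem riemann_of_leviCivita {V : Set Pt} (hV : IsOpen V) (hs : ∀ v, (g v).IsSymm)
    (h0 : ∀ v ∈ V, (g v).det ≠ 0)
    (hd : ∀ v ∈ V, ∀ i j k, HasPd k (fun v => g v i j) (Γ v i j k + Γ v j i k) v)
    (hL : ∀ v ∈ V, ∀ i j k, ∑ s, g v i s * Γ v j k s = ∑ s, g v j s * Γ v i k s) (hu : u ∈ V)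
    {D : Fin 2 → Fin 2 → Fin 2 → Fin 2 → ℝ}
    (hD : ∀ i j k l, HasPd l (fun v => Γ v i j k) (D i j k l) u)
    (hclosed : ∀ i j k l, D i j k l = D i j l k) (l k i j : Fin 2) :
    riemann g u l k i j = ∑ q, (g u)⁻¹ k q * ∑ p, ∑ r,
      (g u)⁻¹ p r * (Γ u r q i * Γ u p l j - Γ u r q j * Γ u p l i) := by
  have hsi : ∀ a b, (g u)⁻¹ a b = (g u)⁻¹ b a := fun a b => ((hs u).inv).apply b a
  have hC : ∀ v ∈ V, ∀ k i j, christoffel g v k i j = -∑ p, (g v)⁻¹ j p * Γ v p k i := by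
    intro v hv k i j
    rw [christoffel_of_leviCivita (hs v) (h0 v hv) (hd v hv) (hL v hv),
      lower_symm (hs v) (h0 v hv) (hL v hv)]
  have hI := fun k l j => hasPd_inv (fun i j => hd u hu i j k) (h0 u hu) l j
  have hP : ∀ l j k i, pd i (fun v => christoffel g v l j k) u
      = -∑ p, ((-∑ a, ∑ b, (g u)⁻¹ k a * (Γ u a b i + Γ u b a i) * (g u)⁻¹ b p) * Γ u p l j
        + (g u)⁻¹ k p * D p l j i) := by
    intro l j k i
    rw [pd_congr hV (fun v hv => hC v hv l j k) hu i]
    simp only [Fin.sum_univ_two (f := fun p => _ * _), Fin.sum_univ_two (f := fun p => _ + _)]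
    refine ((((hI i k 0).mul (hD 0 l j i)).add ((hI i k 1).mul (hD 1 l j i))).neg).pd_eq.trans ?_
    simp only [Fin.sum_univ_two]
  unfold riemann
  simp only [hP, hC u hu, hclosed _ _ j i]
  simp only [Fin.sum_univ_two, hsi 1 0]
  ring

end

/-! ### The connection of the family -/

/-- The coefficients `Γ^{ij}_k` which compatibility with `R₃⁽³⁾` attaches to the metric with
parameters `c`. -/
noncomputable def Param.conn (c : Param) : Conn := fun u i j k =>
  ![![![c.c1 / 2, c.c2 / 2], ![c.c4, -(c.c1 / 2)]],
    ![![c.c2 / (2 * u 0 ^ 2) - c.c3 * u 1 / u 0 ^ 2 - c.c2 * u 1 ^ 2 / (2 * u 0 ^ 2),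
        (c.c3 + c.c2 * u 1) / u 0 + c.c1 / 2],
      ![-((c.c1 + c.c5 * u 1 - c.c1 * u 1 ^ 2) / (2 * u 0 ^ 2)),
        c.c4 + (c.c5 - 2 * c.c1 * u 1) / (2 * u 0)]]] i j k

theorem conn_apply (c : Param) (u : Pt) :
    c.conn u 0 0 0 = c.c1 / 2 ∧ c.conn u 0 0 1 = c.c2 / 2 ∧
    c.conn u 0 1 0 = c.c4 ∧ c.conn u 0 1 1 = -(c.c1 / 2) ∧
    c.conn u 1 0 0 = c.c2 / (2 * u 0 ^ 2) - c.c3 * u 1 / u 0 ^ 2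
      - c.c2 * u 1 ^ 2 / (2 * u 0 ^ 2) ∧
    c.conn u 1 0 1 = (c.c3 + c.c2 * u 1) / u 0 + c.c1 / 2 ∧
    c.conn u 1 1 0 = -((c.c1 + c.c5 * u 1 - c.c1 * u 1 ^ 2) / (2 * u 0 ^ 2)) ∧
    c.conn u 1 1 1 = c.c4 + (c.c5 - 2 * c.c1 * u 1) / (2 * u 0) := by
  refine ⟨rfl, rfl, rfl, rfl, rfl, rfl, rfl, rfl⟩

theorem conn_of_compatible {U : Set Pt} {g : Contra} {Γ : Conn} {c : Param} (hU : IsOpen U)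
    (hU0 : ∀ p ∈ U, p 0 ≠ 0) (hc : CompatibleR33 U g Γ) (hg : ∀ u ∈ U, g u = c.metric u) {p : Pt}
    (hp : p ∈ U) : Γ p = c.conn p := by
  have x0 := hU0 p hp
  obtain ⟨G00, G11, G010, G011, G100, G101, -⟩ := Gamma_of_compatible hU hU0 hc hp
  obtain ⟨d1, d2, d3, d4, d5, d6⟩ := hasPd_metric c x0
  obtain ⟨m00, m01, -, m11⟩ := metric_apply c p
  obtain ⟨n1, n2, n3, n4, n5, n6, n7, n8⟩ := conn_apply c p
  have e := fun i j k => pd_congr hU (f := fun v => g v i j) (h := fun v => c.metric v i j)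
    (fun q hq => by rw [hg q hq]) hp k
  simp only [e, hg p hp, m00, m01] at G00 G11 G010 G011 G100 G101
  rw [d3.pd_eq] at G010 G100
  rw [d4.pd_eq] at G011 G101
  have G000 := G00 0
  have G001 := G00 1
  have G110 := G11 0
  have G111 := G11 1
  rw [d1.pd_eq] at G000
  rw [d2.pd_eq] at G001
  rw [d5.pd_eq] at G110
  rw [d6.pd_eq] at G111
  funext i j k
  fin_cases i <;> fin_cases j <;> fin_cases k
  · refine G000.trans (Eq.trans ?_ n1.symm); ring
  · refine G001.trans (Eq.trans ?_ n2.symm); ring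
  · refine G010.trans (Eq.trans ?_ n3.symm); field_simp; ring
  · refine G011.trans (Eq.trans ?_ n4.symm); field_simp; ring
  · refine G100.trans (Eq.trans ?_ n5.symm); field_simp; ring
  · refine G101.trans (Eq.trans ?_ n6.symm); field_simp; ring
  · refine G110.trans (Eq.trans ?_ n7.symm); field_simp
  · refine G111.trans (Eq.trans ?_ n8.symm); field_simp

theorem hasPd_metric_conn (c : Param) {p : Pt} (x0 : p 0 ≠ 0) (i j k : Fin 2) :
    HasPd k (fun v => c.metric v i j) (c.conn p i j k + c.conn p j i k) p := by
  obtain ⟨d1, d2, d3, d4, d5, d6⟩ := hasPd_metric c x0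
  obtain ⟨n1, n2, n3, n4, n5, n6, n7, n8⟩ := conn_apply c p
  fin_cases i <;> fin_cases j <;> fin_cases k <;>
    simp only [Fin.zero_eta, Fin.mk_one, fun v => (metric_apply c v).2.2.1]
  · refine d1.congr_val ?_; rw [n1]; ring
  · refine d2.congr_val ?_; rw [n2]; ring
  · refine d3.congr_val ?_; rw [n3, n5]; ring
  · refine d4.congr_val ?_; rw [n4, n6]; ring
  · refine d3.congr_val ?_; rw [n3, n5]; ring
  · refine d4.congr_val ?_; rw [n4, n6]; ring
  · refine d5.congr_val ?_; rw [n7]; field_simp; ring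
  · refine d6.congr_val ?_; rw [n8]; field_simp; ring

/-- Each `Γ^{ij}_k du^k` is closed. -/
theorem exists_hasPd_conn (c : Param) {p : Pt} (x0 : p 0 ≠ 0) :
    ∃ D : Fin 2 → Fin 2 → Fin 2 → Fin 2 → ℝ,
      (∀ i j k l, HasPd l (fun v => c.conn v i j k) (D i j k l) p) ∧
      ∀ i j k l, D i j k l = D i j l k := by
  have X := fun k => HasPd.coord k 0 p
  have Y := fun k => HasPd.coord k 1 p
  have x1 : p 0 ^ 2 ≠ 0 := pow_ne_zero 2 x0
  have x2 : 2 * p 0 ^ 2 ≠ 0 := mul_ne_zero two_ne_zero x1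
  have x3 : 2 * p 0 ≠ 0 := mul_ne_zero two_ne_zero x0
  have a100 := fun k => (((HasPd.const c.c2).div (((X k).pow 2).const_mul 2) x2).sub
    (((Y k).const_mul c.c3).div ((X k).pow 2) x1)).sub
    ((((Y k).pow 2).const_mul c.c2).div (((X k).pow 2).const_mul 2) x2)
  have a101 := fun k => (((HasPd.const c.c3).add ((Y k).const_mul c.c2)).div (X k) x0).add
    (HasPd.const (c.c1 / 2))
  have a110 := fun k => ((((HasPd.const c.c1).add ((Y k).const_mul c.c5)).sub
    (((Y k).pow 2).const_mul c.c1)).div (((X k).pow 2).const_mul 2) x2).neg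
  have a111 := fun k => (HasPd.const c.c4).add (((HasPd.const c.c5).sub
    ((Y k).const_mul (2 * c.c1))).div ((X k).const_mul 2) x3)
  have hD : ∀ i j k l, HasPd l (fun v => c.conn v i j k) (pd l (fun v => c.conn v i j k) p) p := by
    intro i j k l
    have key : ∃ d, HasPd l (fun v => c.conn v i j k) d p := by
      fin_cases i <;> fin_cases j <;> fin_cases k
      exacts [⟨_, HasPd.const _⟩, ⟨_, HasPd.const _⟩, ⟨_, HasPd.const _⟩, ⟨_, HasPd.const _⟩,
        ⟨_, a100 l⟩, ⟨_, a101 l⟩, ⟨_, a110 l⟩, ⟨_, a111 l⟩]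
    obtain ⟨d, hd⟩ := key
    rwa [hd.pd_eq]
  refine ⟨fun i j k l => pd l (fun v => c.conn v i j k) p, hD, ?_⟩
  have key : ∀ i j, pd 1 (fun v => c.conn v i j 0) p = pd 0 (fun v => c.conn v i j 1) p := by
    intro i j
    fin_cases i <;> fin_cases j
    · exact (HasPd.const _).pd_eq.trans (HasPd.const _).pd_eq.symm
    · exact (HasPd.const _).pd_eq.trans (HasPd.const _).pd_eq.symm
    · refine (a100 1).pd_eq.trans (Eq.trans ?_ (a101 0).pd_eq.symm)
      simp; field_simp; ring
    · refine (a110 1).pd_eq.trans (Eq.trans ?_ (a111 0).pd_eq.symm)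
      simp; field_simp
  intro i j k l
  fin_cases k <;> fin_cases l
  · rfl
  · exact key i j
  · exact (key i j).symm
  · rfl

/-- The defects of the first Levi-Civita condition for the connection of the family. -/
theorem torsion_conn (c : Param) {p : Pt} (x0 : p 0 ≠ 0) :
    (∑ s, c.metric p 0 s * c.conn p 1 0 s - ∑ s, c.metric p 1 s * c.conn p 0 0 s
      = -(1 / 2) * (p 1 / p 0) * (c.c2 * c.c5 + 2 * c.c1 * c.c3)
        - 1 / 2 * (c.c2 * c.c6 - 2 * c.c3 * c.c4)) ∧
    (∑ s, c.metric p 0 s * c.conn p 1 1 s - ∑ s, c.metric p 1 s * c.conn p 0 1 s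
      = 1 / 2 * (c.c1 * c.c6 + c.c4 * c.c5)
        - 1 / 4 * ((1 + p 1 ^ 2) / p 0 ^ 2) * (c.c2 * c.c5 + 2 * c.c1 * c.c3)) := by
  obtain ⟨m00, m01, m10, m11⟩ := metric_apply c p
  obtain ⟨n1, n2, n3, n4, n5, n6, n7, n8⟩ := conn_apply c p
  simp only [Fin.sum_univ_two, m10, m00, m01, m11, n1, n2, n3, n4, n5, n6, n7, n8]
  constructor
  · field_simp; ring
  · field_simp; ring

theorem torsionFree_conn {c : Param} (hq : c.Quadrics) {p : Pt} (x0 : p 0 ≠ 0) (i j k : Fin 2) :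
    ∑ s, c.metric p i s * c.conn p j k s = ∑ s, c.metric p j s * c.conn p i k s := by
  obtain ⟨q1, q2, q3⟩ := hq
  obtain ⟨t0, t1⟩ := torsion_conn c x0
  rw [q1, q2] at t0
  rw [q1, q3] at t1
  have key : ∑ s, c.metric p 0 s * c.conn p 1 k s = ∑ s, c.metric p 1 s * c.conn p 0 k s := by
    fin_cases k
    · exact sub_eq_zero.1 (t0.trans (by ring))
    · exact sub_eq_zero.1 (t1.trans (by ring))
  fin_cases i <;> fin_cases j
  · rfl
  · exact key
  · exact key.symm
  · rfl

/-- The defects are affine functions of non-constant functions of the point, so they vanish on an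
open set only if all quadratic expressions do. -/
theorem quadrics_of_torsionFree {c : Param} {V : Set Pt} (hV : IsOpen V) (hne : V.Nonempty)
    (hV0 : ∀ p ∈ V, p 0 ≠ 0)
    (h : ∀ p ∈ V, ∀ i j k, ∑ s, c.metric p i s * c.conn p j k s
      = ∑ s, c.metric p j s * c.conn p i k s) : c.Quadrics := by
  obtain ⟨p, hp⟩ := hne
  have x0 := hV0 p hp
  have hT : ∀ q ∈ V, q 1 / q 0 * (c.c2 * c.c5 + 2 * c.c1 * c.c3)
      + (c.c2 * c.c6 - 2 * c.c3 * c.c4) = 0 := by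
    intro q hq
    have := (torsion_conn c (hV0 q hq)).1
    rw [h q hq, sub_self] at this
    linarith
  -- vary the second coordinate
  have hcont : Filter.Tendsto (fun t : ℝ => p + t • (Pi.single 1 1 : Pt)) (nhds 0) (nhds p) := by
    have : Continuous fun t : ℝ => p + t • (Pi.single 1 1 : Pt) := by fun_prop
    simpa using this.tendsto 0
  have hev := (hcont.eventually (hV.mem_nhds hp)).filter_mono
    (nhdsWithin_le_nhds (s := {0}ᶜ))
  obtain ⟨t, ht, ht0⟩ := (hev.and self_mem_nhdsWithin).exists
  have ht0 : t ≠ 0 := ht0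
  have e0 := hT p hp
  have e1 := hT _ ht
  simp at e1
  have q1 : c.c2 * c.c5 + 2 * c.c1 * c.c3 = 0 := by
    have : t / p 0 * (c.c2 * c.c5 + 2 * c.c1 * c.c3) = 0 := by
      linear_combination (norm := skip) e1 - e0
      ring
    exact (mul_eq_zero.1 this).resolve_left (div_ne_zero ht0 x0)
  have e2 := (torsion_conn c x0).2
  rw [h p hp, sub_self, q1] at e2
  rw [q1] at e0
  exact ⟨q1, by linarith, by linarith⟩

theorem leviCivita_iff_quadrics {U : Set Pt} {g : Contra} {Γ : Conn} {c : Param} (hU : IsOpen U)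
    (hne : U.Nonempty) (hU0 : ∀ p ∈ U, p 0 ≠ 0) (hc : CompatibleR33 U g Γ)
    (hg : ∀ u ∈ U, g u = c.metric u) : LeviCivita U g Γ ↔ c.Quadrics := by
  have hΓ := fun p hp => conn_of_compatible hU hU0 hc hg (p := p) hp
  constructor
  · intro h
    refine quadrics_of_torsionFree hU hne hU0 fun p hp i j k => ?_
    have := (h p hp).1 i j k
    rwa [hΓ p hp, hg p hp] at this
  · intro h p hp
    rw [hΓ p hp, hg p hp]
    refine ⟨torsionFree_conn h (hU0 p hp), fun i j k => ?_⟩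
    rw [pd_congr hU (h := fun v => c.metric v i j) (fun q hq => by rw [hg q hq]) hp k,
      (hasPd_metric_conn c (hU0 p hp) i j k).pd_eq]

/-! ### Flatness -/

theorem contraChristoffel_metric {c : Param} (hq : c.Quadrics) {p : Pt} (x0 : p 0 ≠ 0)
    (h0 : (c.metric p).det ≠ 0) (i j k : Fin 2) :
    contraChristoffel c.metric p i j k = c.conn p i j k :=
  contraChristoffel_of_leviCivita (metric_isSymm c p) h0 (hasPd_metric_conn c x0)
    (torsionFree_conn hq x0) i j k

theorem isOpen_nondegenerate (c : Param) :
    IsOpen {v : Pt | v 0 ≠ 0 ∧ (c.metric v).det ≠ 0} := by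
  have hO : IsOpen {v : Pt | v 0 ≠ 0} := isOpen_ne_fun (by fun_prop) continuous_const
  have hc : ContinuousOn (fun v => (c.metric v).det) {v : Pt | v 0 ≠ 0} := by
    simp only [Matrix.det_fin_two, metric_apply]
    have h1 : ∀ v ∈ {v : Pt | v 0 ≠ 0}, v 0 ≠ 0 := fun v hv => hv
    have h2 : ∀ v ∈ {v : Pt | v 0 ≠ 0}, 2 * v 0 ≠ 0 := fun v hv => mul_ne_zero two_ne_zero hv
    fun_prop (disch := assumption)
  exact hc.isOpen_inter_preimage hO isOpen_ne

theorem flat_metric {U : Set Pt} (hU0 : ∀ p ∈ U, p 0 ≠ 0) {c : Param} (hq : c.Quadrics) :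
    Flat U c.metric := by
  intro p hp h0 l k i j
  have x0 := hU0 p hp
  obtain ⟨D, hD, hcl⟩ := exists_hasPd_conn c x0
  rw [riemann_of_leviCivita (isOpen_nondegenerate c) (metric_isSymm c) (fun v hv => hv.2)
    (fun v hv => hasPd_metric_conn c hv.1) (fun v hv => torsionFree_conn hq hv.1) ⟨x0, h0⟩ hD hcl]
  obtain ⟨m00, m01, m10, m11⟩ := metric_apply c p
  obtain ⟨n1, n2, n3, n4, n5, n6, n7, n8⟩ := conn_apply c p
  obtain ⟨i00, i01, i10, i11⟩ := inv_apply (c.metric p)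
  -- the expression is antisymmetric in `i`, `j` and in `q`, `l`, which leaves one component
  have key : ∑ a, ∑ r, (c.metric p)⁻¹ a r * (c.conn p r 0 0 * c.conn p a 1 1
      - c.conn p r 0 1 * c.conn p a 1 0) = 0 := by
    obtain ⟨q1, q2, q3⟩ := hq
    simp only [Fin.sum_univ_two, i00, i01, i10, i11, m10]
    have : c.metric p 1 1 * (c.conn p 0 0 0 * c.conn p 0 1 1 - c.conn p 0 0 1 * c.conn p 0 1 0)
        - c.metric p 0 1 * (c.conn p 0 0 0 * c.conn p 1 1 1 + c.conn p 1 0 0 * c.conn p 0 1 1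
          - c.conn p 0 0 1 * c.conn p 1 1 0 - c.conn p 1 0 1 * c.conn p 0 1 0)
        + c.metric p 0 0 * (c.conn p 1 0 0 * c.conn p 1 1 1 - c.conn p 1 0 1 * c.conn p 1 1 0)
        = 0 := by
      simp only [m00, m01, m11, n1, n2, n3, n4, n5, n6, n7, n8]
      linear_combination (norm := skip)
        (c.c4 + (c.c5 - 2 * c.c1 * p 1) / (2 * p 0)) * (-(1 / 2) * (p 1 / p 0) * q1 - 1 / 2 * q2)
        - ((c.c3 + c.c2 * p 1) / p 0 + c.c1 / 2) *
          (1 / 2 * q3 - 1 / 4 * ((1 + p 1 ^ 2) / p 0 ^ 2) * q1)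
        + (2 * c.c4 * p 1 + c.c1 / p 0 + c.c5 * p 1 / p 0 - c.c1 * (p 1) ^ 2 / p 0 + c.c6)
          / (4 * p 0) * q1
        - (c.c4 * p 0 - c.c2 / (2 * p 0) + c.c3 * p 1 / p 0 + c.c2 * (p 1) ^ 2 / (2 * p 0))
          * (p 1 / (4 * p 0 ^ 2)) * q1
      field_simp
      ring
    field_simp
    linear_combination this
  have hsi : (c.metric p)⁻¹ 1 0 = (c.metric p)⁻¹ 0 1 := by rw [i10, i01, m10]
  simp only [Fin.sum_univ_two, hsi] at key ⊢
  fin_cases i <;> fin_cases j <;> fin_cases l <;> simp only [Fin.zero_eta, Fin.mk_one]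
  · ring
  · ring
  · linear_combination -(c.metric p)⁻¹ k 1 * key
  · linear_combination (c.metric p)⁻¹ k 0 * key
  · linear_combination (c.metric p)⁻¹ k 1 * key
  · linear_combination -(c.metric p)⁻¹ k 0 * key
  · ring
  · ring

/-! ### Flat pencils -/

/-- The parameters of the pencil `g_c - λ g_d`. -/
noncomputable def Param.comb (c d : Param) (lam : ℝ) : Param :=
  ⟨c.c1 - lam * d.c1, c.c2 - lam * d.c2, c.c3 - lam * d.c3, c.c4 - lam * d.c4, c.c5 - lam * d.c5,
    c.c6 - lam * d.c6⟩

theorem pencil_metric (c d : Param) (lam : ℝ) :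
    pencil c.metric d.metric lam = (c.comb d lam).metric := by
  funext u
  ext i j
  fin_cases i <;> fin_cases j <;> simp [pencil, Param.metric, Param.comb] <;> ring

theorem conn_comb (c d : Param) (lam : ℝ) (u : Pt) (i j k : Fin 2) :
    (c.comb d lam).conn u i j k = c.conn u i j k - lam * d.conn u i j k := by
  fin_cases i <;> fin_cases j <;> fin_cases k <;> simp [Param.conn, Param.comb] <;> ring

/-- The polarization of the quadratic conditions `Param.Quadrics`. -/
def Param.Polar (c d : Param) : Prop :=
  c.c2 * d.c5 + d.c2 * c.c5 + 2 * c.c1 * d.c3 + 2 * d.c1 * c.c3 = 0 ∧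
  c.c2 * d.c6 + d.c2 * c.c6 - 2 * c.c3 * d.c4 - 2 * d.c3 * c.c4 = 0 ∧
  c.c1 * d.c6 + d.c1 * c.c6 + c.c4 * d.c5 + d.c4 * c.c5 = 0

theorem isFlatPencil_iff_polar {U : Set Pt} (hU : IsOpen U) (hne : U.Nonempty)
    (hU0 : ∀ p ∈ U, p 0 ≠ 0) {c d : Param} (hc : c.Quadrics) (hd : d.Quadrics)
    (nc : Nondegenerate U c.metric) (nd : Nondegenerate U d.metric) :
    IsFlatPencil U c.metric d.metric ↔ c.Polar d := by
  constructor
  · intro h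
    obtain ⟨p, hp⟩ := hne
    -- a small non-zero `λ` for which the pencil is non-degenerate at `p`
    have hcont : Continuous fun lam : ℝ => (pencil c.metric d.metric lam p).det := by
      simp only [Matrix.det_fin_two, pencil, Matrix.sub_apply, Matrix.smul_apply, smul_eq_mul]
      fun_prop
    have hev := ((hcont.tendsto 0).eventually (isOpen_ne.mem_nhds
      (show (pencil c.metric d.metric 0 p).det ≠ 0 by simpa [pencil] using nc p hp))).filter_mono
      (nhdsWithin_le_nhds (s := {0}ᶜ))
    obtain ⟨lam, hl, hl0⟩ := (hev.and self_mem_nhdsWithin).exists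
    have hl0 : lam ≠ 0 := hl0
    rw [pencil_metric] at hl
    set e := c.comb d lam with he
    have hq : e.Quadrics := by
      refine quadrics_of_torsionFree (hU.inter (isOpen_nondegenerate e)) ⟨p, hp, hU0 p hp, hl⟩
        (fun q hq => hU0 q hq.1) ?_
      rintro q ⟨hqU, x0, hq⟩ i j k
      have hΓ : ∀ i j k, contraChristoffel e.metric q i j k = e.conn q i j k := by
        intro i j k
        have := (h lam).2 q hqU (by rwa [pencil_metric]) i j k
        rw [pencil_metric, contraChristoffel_metric hc x0 (nc q hqU),
          contraChristoffel_metric hd x0 (nd q hqU)] at this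
        rw [this, he, conn_comb]
      simpa only [hΓ] using contraChristoffel_torsionFree (metric_isSymm e) q i j k
    obtain ⟨e1, e2, e3⟩ := hq
    obtain ⟨c1, c2, c3⟩ := hc
    obtain ⟨d1, d2, d3⟩ := hd
    simp only [he, Param.comb] at e1 e2 e3
    refine ⟨mul_left_cancel₀ hl0 ?_, mul_left_cancel₀ hl0 ?_, mul_left_cancel₀ hl0 ?_⟩
    · linear_combination -e1 + c1 + lam ^ 2 * d1
    · linear_combination -e2 + c2 + lam ^ 2 * d2
    · linear_combination -e3 + c3 + lam ^ 2 * d3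
  · rintro ⟨p1, p2, p3⟩ lam
    have hq : (c.comb d lam).Quadrics := by
      obtain ⟨c1, c2, c3⟩ := hc
      obtain ⟨d1, d2, d3⟩ := hd
      simp only [Param.Quadrics, Param.comb]
      refine ⟨?_, ?_, ?_⟩
      · linear_combination c1 + lam ^ 2 * d1 - lam * p1
      · linear_combination c2 + lam ^ 2 * d2 - lam * p2
      · linear_combination c3 + lam ^ 2 * d3 - lam * p3
    rw [pencil_metric]
    refine ⟨flat_metric hU0 hq, fun q hqU h0 i j k => ?_⟩
    have x0 := hU0 q hqU
    rw [contraChristoffel_metric hq x0 h0, contraChristoffel_metric hc x0 (nc q hqU),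
      contraChristoffel_metric hd x0 (nd q hqU), conn_comb]

/-! ### The quadratic conditions and their polarization, case by case -/

theorem quadrics_iff_cases (c : Param) :
    c.Quadrics ↔ (c.Case1 ∨ c.Case2 ∨ c.Case3 ∨ c.Case4 ∨ c.Case5) := by
  obtain ⟨c1, c2, c3, c4, c5, c6⟩ := c
  simp only [Param.Quadrics, Param.Case1, Param.Case2, Param.Case3, Param.Case4, Param.Case5]
  constructor
  · rintro ⟨h1, h2, h3⟩
    by_cases n2 : c2 = 0
    · subst n2
      by_cases n3 : c3 = 0
      · subst n3
        by_cases n6 : c6 = 0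
        · subst n6
          by_cases n5 : c5 = 0
          · exact .inr (.inr (.inr (.inr ⟨rfl, rfl, n5, rfl⟩)))
          · refine .inr (.inr (.inr (.inl ⟨rfl, rfl, rfl, n5, ?_⟩)))
            simpa [n5] using h3
        · refine .inr (.inr (.inl ⟨rfl, rfl, n6, ?_⟩))
          field_simp; linarith
      · refine .inr (.inl ⟨rfl, n3, ?_, ?_⟩)
        · simpa [n3] using h1
        · simpa [n3] using h2
    · refine .inl ⟨n2, ?_, ?_⟩
      · field_simp; linarith
      · field_simp; linarith
  · rintro (⟨n, rfl, rfl⟩ | ⟨rfl, n, rfl, rfl⟩ | ⟨rfl, rfl, n, rfl⟩ | ⟨rfl, rfl, rfl, n, rfl⟩ |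
      ⟨rfl, rfl, rfl, rfl⟩)
    · refine ⟨?_, ?_, ?_⟩
      · field_simp; ring
      · field_simp; ring
      · field_simp; ring
    · simp
    · refine ⟨by simp, by simp, ?_⟩
      field_simp; ring
    · simp
    · simp

/-- If `g¹¹` and `g¹²` vanish identically, the metric is degenerate. -/
theorem ne_zero_of_nondegenerate {U : Set Pt} (hne : U.Nonempty) {d : Param}
    (nd : Nondegenerate U d.metric) (h2 : d.c2 = 0) (h3 : d.c3 = 0) (h4 : d.c4 = 0) :
    d.c1 ≠ 0 := by
  intro h1
  obtain ⟨p, hp⟩ := hne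
  refine nd p hp ?_
  obtain ⟨m00, m01, m10, -⟩ := metric_apply d p
  rw [Matrix.det_fin_two, m10, m00, m01, h1, h2, h3, h4]
  ring

section

variable {c d : Param}

theorem polar_case11 (hc : c.Case1) (hd : d.Case1) : c.Polar d ↔
    (d.c3 = d.c2 * c.c3 / c.c2 ∨ (d.c1 = d.c2 * c.c1 / c.c2 ∧ d.c4 = d.c2 * c.c4 / c.c2)) := by
  obtain ⟨c1, c2, c3, c4, c5, c6⟩ := c
  obtain ⟨d1, d2, d3, d4, d5, d6⟩ := d
  simp only [Param.Case1, Param.Polar] at *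
  obtain ⟨nc, rfl, rfl⟩ := hc
  obtain ⟨nd, rfl, rfl⟩ := hd
  rw [eq_div_iff nc, eq_div_iff nc, eq_div_iff nc]
  have e1 : c2 * -(2 * d1 * d3 / d2) + d2 * -(2 * c1 * c3 / c2) + 2 * c1 * d3 + 2 * d1 * c3
      = -2 / (c2 * d2) * ((d1 * c2 - d2 * c1) * (d3 * c2 - d2 * c3)) := by
    field_simp; ring
  have e2 : c2 * (2 * d3 * d4 / d2) + d2 * (2 * c3 * c4 / c2) - 2 * c3 * d4 - 2 * d3 * c4
      = 2 / (c2 * d2) * ((d4 * c2 - d2 * c4) * (d3 * c2 - d2 * c3)) := by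
    field_simp; ring
  have e3 : c1 * (2 * d3 * d4 / d2) + d1 * (2 * c3 * c4 / c2) + c4 * -(2 * d1 * d3 / d2)
      + d4 * -(2 * c1 * c3 / c2) = 2 / (c2 ^ 2 * d2) * ((c1 * (d4 * c2 - d2 * c4)
        - c4 * (d1 * c2 - d2 * c1)) * (d3 * c2 - d2 * c3)) := by
    field_simp; ring
  rw [e1, e2, e3]
  constructor
  · rintro ⟨h1, h2, -⟩
    have h1 := (mul_eq_zero.1 h1).resolve_left (by simp [nc, nd])
    have h2 := (mul_eq_zero.1 h2).resolve_left (by simp [nc, nd])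
    rcases mul_eq_zero.1 h1 with h1 | h1
    · rcases mul_eq_zero.1 h2 with h2 | h2
      · exact .inr ⟨sub_eq_zero.1 h1, sub_eq_zero.1 h2⟩
      · exact .inl (sub_eq_zero.1 h2)
    · exact .inl (sub_eq_zero.1 h1)
  · rintro (h | ⟨h, h'⟩)
    · simp [h]
    · simp [h, h']

theorem polar_case12 (hc : c.Case1) (hd : d.Case2) : c.Polar d ↔
    (d.c5 = -(2 * d.c3 * c.c1 / c.c2) ∧ d.c6 = 2 * d.c3 * c.c4 / c.c2) := by
  obtain ⟨c1, c2, c3, c4, c5, c6⟩ := c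
  obtain ⟨d1, d2, d3, d4, d5, d6⟩ := d
  simp only [Param.Case1, Param.Case2, Param.Polar] at *
  obtain ⟨nc, rfl, rfl⟩ := hc
  obtain ⟨rfl, nd, rfl, rfl⟩ := hd
  constructor
  · rintro ⟨h1, h2, -⟩
    constructor
    · field_simp; linarith
    · field_simp; linarith
  · rintro ⟨rfl, rfl⟩
    refine ⟨?_, ?_, ?_⟩
    · field_simp; ring
    · field_simp; ring
    · field_simp; ring

theorem polar_case13 (hc : c.Case1) (hd : d.Case3) : c.Polar d ↔
    (d.c6 = 2 * d.c4 * c.c3 / c.c2 ∧ d.c4 ≠ 0 ∧ c.c3 ≠ 0) := by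
  obtain ⟨c1, c2, c3, c4, c5, c6⟩ := c
  obtain ⟨d1, d2, d3, d4, d5, d6⟩ := d
  simp only [Param.Case1, Param.Case3, Param.Polar] at *
  obtain ⟨nc, rfl, rfl⟩ := hc
  obtain ⟨rfl, rfl, nd, rfl⟩ := hd
  constructor
  · rintro ⟨-, h2, -⟩
    have h : d6 = 2 * d4 * c3 / c2 := by field_simp; linarith
    refine ⟨h, ?_, ?_⟩
    · rintro rfl; simp at h; exact nd h
    · rintro rfl; simp at h; exact nd h
  · rintro ⟨rfl, n4, n3⟩
    refine ⟨?_, ?_, ?_⟩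
    · field_simp; ring
    · field_simp; ring
    · field_simp; ring

theorem polar_case14 (hc : c.Case1) (hd : d.Case4) : c.Polar d ↔
    (d.c5 = -(2 * d.c1 * c.c3 / c.c2) ∧ d.c1 ≠ 0 ∧ c.c3 ≠ 0) := by
  obtain ⟨c1, c2, c3, c4, c5, c6⟩ := c
  obtain ⟨d1, d2, d3, d4, d5, d6⟩ := d
  simp only [Param.Case1, Param.Case4, Param.Polar] at *
  obtain ⟨nc, rfl, rfl⟩ := hc
  obtain ⟨rfl, rfl, rfl, nd, rfl⟩ := hd
  constructor
  · rintro ⟨h1, -, -⟩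
    have h : d5 = -(2 * d1 * c3 / c2) := by field_simp; linarith
    refine ⟨h, ?_, ?_⟩
    · rintro rfl; simp at h; exact nd h
    · rintro rfl; simp at h; exact nd h
  · rintro ⟨rfl, n4, n3⟩
    refine ⟨?_, ?_, ?_⟩
    · field_simp; ring
    · ring
    · field_simp; ring

theorem polar_case15 (hc : c.Case1) (hd : d.Case5)
    (nd : d.c4 = 0 → d.c1 ≠ 0) : c.Polar d ↔ c.c3 = 0 := by
  obtain ⟨c1, c2, c3, c4, c5, c6⟩ := c
  obtain ⟨d1, d2, d3, d4, d5, d6⟩ := d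
  simp only [Param.Case1, Param.Case5, Param.Polar] at *
  obtain ⟨nc, rfl, rfl⟩ := hc
  obtain ⟨rfl, rfl, rfl, rfl⟩ := hd
  constructor
  · rintro ⟨h1, h2, -⟩
    by_contra n3
    have h1 : d1 = 0 := by simpa [n3] using h1
    have h2 : d4 = 0 := by simpa [n3] using h2
    exact nd h2 h1
  · rintro rfl
    simp

theorem polar_case22 (hc : c.Case2) (hd : d.Case2) : c.Polar d := by
  obtain ⟨h2, -, h1, h4⟩ := hc
  obtain ⟨k2, -, k1, k4⟩ := hd
  simp [Param.Polar, h1, h2, h4, k1, k2, k4]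

/-- For `c` in the second case and `d₂ = d₃ = 0` the polar conditions force `d₁ = d₄ = 0`, so that
`g_d` is degenerate. -/
theorem not_polar_case2 (hc : c.Case2) (h2 : d.c2 = 0) (h3 : d.c3 = 0)
    (nd : d.c4 = 0 → d.c1 ≠ 0) : ¬ c.Polar d := by
  obtain ⟨k2, n3, k1, k4⟩ := hc
  rintro ⟨p1, p2, -⟩
  refine nd ?_ ?_
  · simpa [k1, k2, k4, h2, h3, n3] using p2
  · simpa [k1, k2, k4, h2, h3, n3] using p1

theorem polar_case33 (hc : c.Case3) (hd : d.Case3) : c.Polar d ↔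
    ((d.c5 = 0 ∧ d.c6 = 0) ∨ d.c5 = d.c6 * c.c5 / c.c6 ∨ d.c4 = d.c6 * c.c4 / c.c6) := by
  obtain ⟨c1, c2, c3, c4, c5, c6⟩ := c
  obtain ⟨d1, d2, d3, d4, d5, d6⟩ := d
  simp only [Param.Case3, Param.Polar] at *
  obtain ⟨rfl, rfl, nc, rfl⟩ := hc
  obtain ⟨rfl, rfl, nd, rfl⟩ := hd
  have e : -(c4 * c5 / c6) * d6 + -(d4 * d5 / d6) * c6 + c4 * d5 + d4 * c5
      = -1 / (c6 * d6) * ((d5 * c6 - d6 * c5) * (d4 * c6 - d6 * c4)) := by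
    field_simp; ring
  rw [e, eq_div_iff nc, eq_div_iff nc]
  simp [nc, nd, sub_eq_zero]

theorem polar_case34 (hc : c.Case3) (hd : d.Case4) :
    c.Polar d ↔ d.c1 = -(d.c5 * c.c4 / c.c6) := by
  obtain ⟨h2, h3, nc, h1⟩ := hc
  obtain ⟨k2, k3, k6, nd, k4⟩ := hd
  simp only [Param.Polar, h2, h3, k2, k3, k6, k4]
  constructor
  · rintro ⟨-, -, h⟩
    field_simp; linarith
  · intro h
    rw [h]
    refine ⟨by ring, by ring, ?_⟩
    field_simp; ring

theorem polar_case35 (hc : c.Case3) (hd : d.Case5) :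
    c.Polar d ↔ d.c1 = -(d.c4 * c.c5 / c.c6) := by
  obtain ⟨h2, h3, nc, h1⟩ := hc
  obtain ⟨k2, k3, k5, k6⟩ := hd
  simp only [Param.Polar, h2, h3, k2, k3, k5, k6]
  constructor
  · rintro ⟨-, -, h⟩
    field_simp; linarith
  · intro h
    rw [h]
    refine ⟨by ring, by ring, ?_⟩
    field_simp; ring

theorem polar_case44 (hc : c.Case4) (hd : d.Case4) : c.Polar d := by
  obtain ⟨h2, h3, h6, -, h4⟩ := hc
  obtain ⟨k2, k3, k6, -, k4⟩ := hd
  simp [Param.Polar, h2, h3, h6, h4, k2, k3, k6, k4]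

theorem polar_case45 (hc : c.Case4) (hd : d.Case5) : c.Polar d ↔ d.c4 = 0 := by
  obtain ⟨h2, h3, h6, n5, h4⟩ := hc
  obtain ⟨k2, k3, k5, k6⟩ := hd
  simp [Param.Polar, h2, h3, h6, h4, n5, k2, k3, k5, k6]

theorem polar_case55 (hc : c.Case5) (hd : d.Case5) : c.Polar d := by
  obtain ⟨h2, h3, h5, h6⟩ := hc
  obtain ⟨k2, k3, k5, k6⟩ := hd
  simp [Param.Polar, h2, h3, h5, h6, k2, k3, k5, k6]

end

end Trios

theorem mainTheorem7 (U : Set Trios.Pt) (hUo : IsOpen U) (hUne : U.Nonempty)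
    (hU : ∀ u ∈ U, u 0 ≠ 0) :
    -- an operator compatible with `R₃⁽³⁾` has a metric of the six-parameter form
    (IsPreconnected U → ∀ (g : Trios.Contra) (Γ : Trios.Conn), Trios.CompatibleR33 U g Γ →
      ∃! c : Trios.Param, ∀ u ∈ U, g u = c.metric u) ∧
    -- the Levi-Civita conditions are the quadratic conditions
    (∀ (g : Trios.Contra) (Γ : Trios.Conn) (c : Trios.Param), Trios.CompatibleR33 U g Γ →
      (∀ u ∈ U, g u = c.metric u) → (Trios.LeviCivita U g Γ ↔ c.Quadrics)) ∧
    -- they imply flatness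
    (∀ c : Trios.Param, c.Quadrics → Trios.Flat U c.metric) ∧
    -- the solution of the system
    (∀ c : Trios.Param,
      c.Quadrics ↔ (c.Case1 ∨ c.Case2 ∨ c.Case3 ∨ c.Case4 ∨ c.Case5)) ∧
    -- the flat pencils
    (∀ c d : Trios.Param, Trios.Nondegenerate U c.metric → Trios.Nondegenerate U d.metric →
      (c.Case1 → d.Case1 → (Trios.IsFlatPencil U c.metric d.metric ↔
        (d.c3 = d.c2 * c.c3 / c.c2 ∨
          (d.c1 = d.c2 * c.c1 / c.c2 ∧ d.c4 = d.c2 * c.c4 / c.c2)))) ∧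
      (c.Case1 → d.Case2 → (Trios.IsFlatPencil U c.metric d.metric ↔
        (d.c5 = -(2 * d.c3 * c.c1 / c.c2) ∧ d.c6 = 2 * d.c3 * c.c4 / c.c2))) ∧
      (c.Case1 → d.Case3 → (Trios.IsFlatPencil U c.metric d.metric ↔
        (d.c6 = 2 * d.c4 * c.c3 / c.c2 ∧ d.c4 ≠ 0 ∧ c.c3 ≠ 0))) ∧
      (c.Case1 → d.Case4 → (Trios.IsFlatPencil U c.metric d.metric ↔
        (d.c5 = -(2 * d.c1 * c.c3 / c.c2) ∧ d.c1 ≠ 0 ∧ c.c3 ≠ 0))) ∧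
      (c.Case1 → d.Case5 → (Trios.IsFlatPencil U c.metric d.metric ↔ c.c3 = 0)) ∧
      (c.Case2 → d.Case2 → Trios.IsFlatPencil U c.metric d.metric) ∧
      (c.Case2 → d.Case3 → ¬ Trios.IsFlatPencil U c.metric d.metric) ∧
      (c.Case2 → d.Case4 → ¬ Trios.IsFlatPencil U c.metric d.metric) ∧
      (c.Case2 → d.Case5 → ¬ Trios.IsFlatPencil U c.metric d.metric) ∧
      (c.Case3 → d.Case3 → (Trios.IsFlatPencil U c.metric d.metric ↔
        ((d.c5 = 0 ∧ d.c6 = 0) ∨ d.c5 = d.c6 * c.c5 / c.c6 ∨ d.c4 = d.c6 * c.c4 / c.c6))) ∧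
      (c.Case3 → d.Case4 → (Trios.IsFlatPencil U c.metric d.metric ↔
        d.c1 = -(d.c5 * c.c4 / c.c6))) ∧
      (c.Case3 → d.Case5 → (Trios.IsFlatPencil U c.metric d.metric ↔
        d.c1 = -(d.c4 * c.c5 / c.c6))) ∧
      (c.Case4 → d.Case4 → Trios.IsFlatPencil U c.metric d.metric) ∧
      (c.Case4 → d.Case5 → (Trios.IsFlatPencil U c.metric d.metric ↔ d.c4 = 0)) ∧
      (c.Case5 → d.Case5 → Trios.IsFlatPencil U c.metric d.metric)) := by
  refine ⟨fun hconn g Γ hc => Trios.existsUnique_param_of_compatible hUo hUne hU hconn hc,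
    fun g Γ c hc hg => Trios.leviCivita_iff_quadrics hUo hUne hU hc hg,
    fun c hc => Trios.flat_metric hU hc, Trios.quadrics_iff_cases, fun c d nc nd => ?_⟩
  have Q := fun e => (Trios.quadrics_iff_cases e).2
  have q1 := fun e h => Q e (.inl h)
  have q2 := fun e h => Q e (.inr (.inl h))
  have q3 := fun e h => Q e (.inr (.inr (.inl h)))
  have q4 := fun e h => Q e (.inr (.inr (.inr (.inl h))))
  have q5 := fun e h => Q e (.inr (.inr (.inr (.inr h))))
  have F := fun qc qd => Trios.isFlatPencil_iff_polar hUo hUne hU qc qd nc nd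
  have N := Trios.ne_zero_of_nondegenerate hUne nd
  exact ⟨
    fun h k => (F (q1 c h) (q1 d k)).trans (Trios.polar_case11 h k),
    fun h k => (F (q1 c h) (q2 d k)).trans (Trios.polar_case12 h k),
    fun h k => (F (q1 c h) (q3 d k)).trans (Trios.polar_case13 h k),
    fun h k => (F (q1 c h) (q4 d k)).trans (Trios.polar_case14 h k),
    fun h k => (F (q1 c h) (q5 d k)).trans (Trios.polar_case15 h k (N k.1 k.2.1)),
    fun h k => (F (q2 c h) (q2 d k)).2 (Trios.polar_case22 h k),
    fun h k hp => Trios.not_polar_case2 h k.1 k.2.1 (N k.1 k.2.1) ((F (q2 c h) (q3 d k)).1 hp),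
    fun h k hp => Trios.not_polar_case2 h k.1 k.2.1 (N k.1 k.2.1) ((F (q2 c h) (q4 d k)).1 hp),
    fun h k hp => Trios.not_polar_case2 h k.1 k.2.1 (N k.1 k.2.1) ((F (q2 c h) (q5 d k)).1 hp),
    fun h k => (F (q3 c h) (q3 d k)).trans (Trios.polar_case33 h k),
    fun h k => (F (q3 c h) (q4 d k)).trans (Trios.polar_case34 h k),
    fun h k => (F (q3 c h) (q5 d k)).trans (Trios.polar_case35 h k),
    fun h k => (F (q4 c h) (q4 d k)).2 (Trios.polar_case44 h k),
    fun h k => (F (q4 c h) (q5 d k)).trans (Trios.polar_case45 h k),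
    fun h k => (F (q5 c h) (q5 d k)).2 (Trios.polar_case55 h k)⟩
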